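/- Let $V$ be a finite-dimensional complex vector space with a symplectic form $\omega$, and let $G$ be a finite group acting linearly on $V$ and preserving $\omega$ (the action need not be faithful). Let $\mathrm{Weyl}(V)$ be the quotient of the tensor algebra of $V$ by the relations $xy-yx=\omega(x,y)$, $x,y\in V$, let $G\ltimes\mathrm{Weyl}(V)$ be the semidirect (smash) product algebra, and for an associative $\mathbb C$-algebra $A$ let $H^i(A)=H^i(A,A)$ denote its Hochschild cohomology. For $i\ge 0$ put $S_i=\{g\in G:\operatorname{rank}(1-g)|_V=i\}$, and let $\mathbb C[S_i]^G$ be the space of functions $S_i\to\mathbb C$ that are invariant under conjugation by $G$. **Theorem** (Alev–Farinati–Lambre–Solotar). There are $\mathbb C$-linear isomorphisms $$\Phi_i: H^i(G\ltimes\mathrm{Weyl}(V))\;\xrightarrow{\ \sim\ }\;\mathbb C[S_i]^G\qquad(i\ge 0),$$ defined for all triples $(V,\omega,G)$ and natural in them: if $\varphi:V\to V'$ is an isomorphism of symplectic vector spaces and $\theta:G\to G'$ is a group isomorphism with $\varphi(gx)=\theta(g)\varphi(x)$ for all $g\in G$, $x\in V$, then $\Phi_i$ intertwines the isomorphism $H^i(G\ltimes\mathrm{Weyl}(V))\to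 H^i(G'\ltimes\mathrm{Weyl}(V'))$ induced by $(\varphi,\theta)$ with the transport of functions along $\theta: S_i\to S_i'$. Consequently $H^i(G\ltimes\mathrm{Weyl}(V))=0$ for every odd $i$, and $\Phi_2$ identifies $H^2(G\ltimes\mathrm{Weyl}(V))$ with $\mathbb C[S]^G$, the space of conjugation-invariant functions on the set $S=S_2$ of symplectic reflections, i.e. of the elements $g\in G$ for which $g-1$ has rank $2$ on $V$. -/

import Mathlib

universe u v

set_option maxSynthPendingDepth 3
set_option linter.checkUnivs false

noncomputable section

/-! ### Hochschild cohomology of an associative algebra with coefficients in itself -/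

namespace Hochschild

section Complex

variable (k : Type u) [CommRing k] (A : Type v) [Ring A] [Algebra k A]

/-- Hochschild `n`-cochains of `A` with values in `A`: linear maps `A ⊗ ⋯ ⊗ A → A` (`n` factors),
that is, `k`-multilinear maps in `n` variables. -/
abbrev Cochain (n : ℕ) : Type v := MultilinearMap k (fun _ : Fin n => A) A

variable {k A}

/-- If one entry of `(a₀, …, aₙ)` varies, then the `n`-tuple obtained by multiplying the `j`-th
entry with the next one varies linearly in one entry. -/
theorem contractNth_update {n : ℕ} (j : Fin n) (a : Fin (n + 1) → A) (i : Fin (n + 1)) :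
    ∃ (l : Fin n) (L : A →ₗ[k] A), ∀ x : A,
      Fin.contractNth j.castSucc (· * ·) (Function.update a i x) =
        Function.update (Fin.contractNth j.castSucc (· * ·) a) l (L x) := by
  have hj := j.isLt
  have hi := i.isLt
  rcases lt_trichotomy (i : ℕ) (j : ℕ) with h | h | h
  · refine ⟨⟨i, by omega⟩, LinearMap.id, fun x => ?_⟩
    funext m
    simp only [Fin.contractNth, Function.update_apply, Fin.ext_iff, Fin.val_castSucc, Fin.val_succ,
      LinearMap.id_apply]
    split_ifs <;> first | rfl | omega
  · refine ⟨j, LinearMap.mulRight k (a j.succ), fun x => ?_⟩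
    funext m
    simp only [Fin.contractNth, Function.update_apply, Fin.ext_iff, Fin.val_castSucc, Fin.val_succ,
      LinearMap.mulRight_apply]
    split_ifs with h1 h2 h3 h4 h5 h6 <;> first | rfl | omega | skip
    all_goals
      have : m = j := Fin.ext (by omega)
      subst this
      rfl
  · by_cases h' : (i : ℕ) = j + 1
    · refine ⟨j, LinearMap.mulLeft k (a j.castSucc), fun x => ?_⟩
      funext m
      simp only [Fin.contractNth, Function.update_apply, Fin.ext_iff, Fin.val_castSucc,
        Fin.val_succ, LinearMap.mulLeft_apply]
      split_ifs with h1 h2 h3 h4 h5 h6 <;> first | rfl | omega | skip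
      all_goals
        have : m = j := Fin.ext (by omega)
        subst this
        rfl
    · refine ⟨⟨i - 1, by omega⟩, LinearMap.id, fun x => ?_⟩
      funext m
      simp only [Fin.contractNth, Function.update_apply, Fin.ext_iff, Fin.val_castSucc,
        Fin.val_succ, LinearMap.id_apply]
      split_ifs <;> first | rfl | omega

/-- The cochain `(a₀, …, aₙ) ↦ f (a₀, …, a_j a_{j+1}, …, aₙ)`. -/
def innerFace {n : ℕ} (j : Fin n) (f : Cochain k A n) : Cochain k A (n + 1) where
  toFun a := f (Fin.contractNth j.castSucc (· * ·) a)
  map_update_add' {inst} a i x y := by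
    rw [Subsingleton.elim inst (instDecidableEqFin (n + 1))]
    obtain ⟨l, L, hL⟩ := contractNth_update (k := k) j a i
    rw [hL, hL, hL, map_add, MultilinearMap.map_update_add]
  map_update_smul' {inst} a i c x := by
    rw [Subsingleton.elim inst (instDecidableEqFin (n + 1))]
    obtain ⟨l, L, hL⟩ := contractNth_update (k := k) j a i
    rw [hL, hL, map_smul, MultilinearMap.map_update_smul]

/-- The cochain `(a₀, …, aₙ) ↦ f (a₀, …, a_{n-1}) aₙ`. -/
def rightFace {n : ℕ} (f : Cochain k A n) : Cochain k A (n + 1) where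
  toFun a := f (Fin.init a) * a (Fin.last n)
  map_update_add' {inst} a i x y := by
    rw [Subsingleton.elim inst (instDecidableEqFin (n + 1))]
    induction i using Fin.lastCases with
    | last => simp [Fin.init_update_last, mul_add]
    | cast i => simp [Fin.init_update_castSucc, (Fin.castSucc_lt_last i).ne', add_mul]
  map_update_smul' {inst} a i c x := by
    rw [Subsingleton.elim inst (instDecidableEqFin (n + 1))]
    induction i using Fin.lastCases with
    | last => simp [Fin.init_update_last]
    | cast i => simp [Fin.init_update_castSucc, (Fin.castSucc_lt_last i).ne']

/-- The cochain `(a₀, …, aₙ) ↦ a₀ f (a₁, …, aₙ)`. -/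
def leftFace {n : ℕ} (f : Cochain k A n) : Cochain k A (n + 1) where
  toFun a := a 0 * f (Fin.tail a)
  map_update_add' {inst} a i x y := by
    rw [Subsingleton.elim inst (instDecidableEqFin (n + 1))]
    induction i using Fin.cases with
    | zero => simp [Fin.tail_update_zero, add_mul]
    | succ i => simp [Fin.tail_update_succ, (Fin.succ_ne_zero i).symm, mul_add]
  map_update_smul' {inst} a i c x := by
    rw [Subsingleton.elim inst (instDecidableEqFin (n + 1))]
    induction i using Fin.cases with
    | zero => simp [Fin.tail_update_zero]
    | succ i => simp [Fin.tail_update_succ, (Fin.succ_ne_zero i).symm]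

variable (k A)

/-- The Hochschild differential
`(df)(a₁, …, aₙ₊₁) = f(a₁, …, aₙ) aₙ₊₁ - f(a₁, …, aₙ aₙ₊₁) + ⋯ + (-1)ⁿ f(a₁ a₂, …, aₙ₊₁)
  + (-1)ⁿ⁺¹ a₁ f(a₂, …, aₙ₊₁)`
(the index `j` below starts from `0`). -/
def d (n : ℕ) : Cochain k A n →ₗ[k] Cochain k A (n + 1) where
  toFun f := rightFace f + ∑ j : Fin n, (-1 : k) ^ (n - (j : ℕ)) • innerFace j f
    + (-1 : k) ^ (n + 1) • leftFace f
  map_add' f g := by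
    ext a
    simp [rightFace, innerFace, leftFace, add_mul, mul_add,
      Finset.sum_add_distrib]
    abel
  map_smul' c f := by
    ext a
    simp [rightFace, innerFace, leftFace, smul_add, Finset.smul_sum,
      smul_comm c]

theorem d_apply (n : ℕ) (f : Cochain k A n) (a : Fin (n + 1) → A) :
    d k A n f a = f (Fin.init a) * a (Fin.last n)
      + ∑ j : Fin n, (-1 : k) ^ (n - (j : ℕ)) • f (Fin.contractNth j.castSucc (· * ·) a)
      + (-1 : k) ^ (n + 1) • (a 0 * f (Fin.tail a)) := by
  simp [d, rightFace, innerFace, leftFace]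

/-- Hochschild `n`-cocycles. -/
def cocycles (n : ℕ) : Submodule k (Cochain k A n) := LinearMap.ker (d k A n)

/-- Hochschild `n`-coboundaries (there are none but zero for `n = 0`). -/
def coboundaries : (n : ℕ) → Submodule k (Cochain k A n)
  | 0 => ⊥
  | n + 1 => LinearMap.range (d k A n)

/-- The Hochschild cohomology `Hⁿ(A) = Hⁿ(A, A)`: cocycles modulo coboundaries. -/
abbrev HH (n : ℕ) : Type v :=
  cocycles k A n ⧸ (coboundaries k A n).submoduleOf (cocycles k A n)

end Complex

section Transport

variable {k : Type u} [CommRing k] {A B : Type v} [Ring A] [Algebra k A] [Ring B] [Algebra k B]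

/-- Transport of cochains along an algebra isomorphism:
`f ↦ ((b₁, …, bₙ) ↦ e (f (e⁻¹ b₁, …, e⁻¹ bₙ)))`. -/
def cochainMap (e : A ≃ₐ[k] B) (n : ℕ) : Cochain k A n →ₗ[k] Cochain k B n where
  toFun f := e.toLinearMap.compMultilinearMap (f.compLinearMap fun _ => e.symm.toLinearMap)
  map_add' f g := by ext; simp
  map_smul' c f := by ext; simp

theorem cochainMap_apply (e : A ≃ₐ[k] B) (n : ℕ) (f : Cochain k A n) (b : Fin n → B) :
    cochainMap e n f b = e (f fun i => e.symm (b i)) := rfl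

theorem d_cochainMap (e : A ≃ₐ[k] B) (n : ℕ) (f : Cochain k A n) :
    d k B n (cochainMap e n f) = cochainMap e (n + 1) (d k A n f) := by
  have key : ∀ (j : Fin n) (b : Fin (n + 1) → B),
      (fun i => e.symm (Fin.contractNth j.castSucc (· * ·) b i)) =
        Fin.contractNth j.castSucc (· * ·) (fun i => e.symm (b i)) := by
    intro j b
    funext i
    simp only [Fin.contractNth]
    split_ifs <;> simp
  ext b
  simp only [d_apply, cochainMap_apply, map_add, map_sum, map_mul, map_smul, key,
    AlgEquiv.apply_symm_apply]
  rfl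

/-- The map on Hochschild cohomology induced by an algebra isomorphism. -/
def mapHH (e : A ≃ₐ[k] B) (n : ℕ) : HH k A n →ₗ[k] HH k B n :=
  Submodule.mapQ _ _
    ((cochainMap e n).restrict (p := cocycles k A n) (q := cocycles k B n) (by
      intro f hf
      have hf' : d k A n f = 0 := hf
      change d k B n (cochainMap e n f) = 0
      rw [d_cochainMap, hf', map_zero]))
    (by
      rintro ⟨f, hf⟩ hfb
      cases n with
      | zero =>
        have h0 : f = 0 := hfb
        change cochainMap e 0 f = 0
        rw [h0, map_zero]
      | succ n =>
        obtain ⟨g, hg⟩ : f ∈ LinearMap.range (d k A n) := hfb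
        exact ⟨cochainMap e n g, by rw [d_cochainMap, hg]; rfl⟩)

end Transport

end Hochschild

/-! ### The Weyl algebra of a vector space with a bilinear form -/

section Weyl

variable {V : Type u} [AddCommGroup V] [Module ℂ V]

/-- The defining relations `x y - y x = ω(x, y)`, `x, y ∈ V`, of the Weyl algebra, in the tensor
algebra of `V`. -/
inductive WeylRel (ω : V →ₗ[ℂ] V →ₗ[ℂ] ℂ) : TensorAlgebra ℂ V → TensorAlgebra ℂ V → Prop
  | comm (x y : V) : WeylRel ω
      (TensorAlgebra.ι ℂ x * TensorAlgebra.ι ℂ y - TensorAlgebra.ι ℂ y * TensorAlgebra.ι ℂ x)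
      (algebraMap ℂ (TensorAlgebra ℂ V) (ω x y))

/-- The Weyl algebra: the quotient of the tensor algebra of `V` by the two-sided ideal generated
by the elements `x y - y x - ω(x, y)`. -/
abbrev WeylAlgebra (ω : V →ₗ[ℂ] V →ₗ[ℂ] ℂ) : Type u := RingQuot (WeylRel ω)

namespace WeylAlgebra

/-- The canonical map from `V` to its Weyl algebra. -/
def ι (ω : V →ₗ[ℂ] V →ₗ[ℂ] ℂ) : V →ₗ[ℂ] WeylAlgebra ω :=
  (RingQuot.mkAlgHom ℂ (WeylRel ω)).toLinearMap ∘ₗ TensorAlgebra.ι ℂ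

theorem ι_comm (ω : V →ₗ[ℂ] V →ₗ[ℂ] ℂ) (x y : V) :
    ι ω x * ι ω y - ι ω y * ι ω x = algebraMap ℂ _ (ω x y) := by
  have h := RingQuot.mkAlgHom_rel ℂ (WeylRel.comm (ω := ω) x y)
  simpa [ι] using h

variable {W : Type u} [AddCommGroup W] [Module ℂ W] {X : Type u} [AddCommGroup X] [Module ℂ X]
variable {ω : V →ₗ[ℂ] V →ₗ[ℂ] ℂ} {ω' : W →ₗ[ℂ] W →ₗ[ℂ] ℂ} {ω'' : X →ₗ[ℂ] X →ₗ[ℂ] ℂ}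

/-- The algebra homomorphism of Weyl algebras induced by a linear map that preserves the forms. -/
def map (φ : V →ₗ[ℂ] W) (h : ∀ x y, ω' (φ x) (φ y) = ω x y) : WeylAlgebra ω →ₐ[ℂ] WeylAlgebra ω' :=
  RingQuot.liftAlgHom ℂ ⟨TensorAlgebra.lift ℂ (ι ω' ∘ₗ φ), by
    rintro _ _ ⟨x, y⟩
    simp [ι_comm, h]⟩

@[simp]
theorem map_ι (φ : V →ₗ[ℂ] W) (h : ∀ x y, ω' (φ x) (φ y) = ω x y) (x : V) :
    map φ h (ι ω x) = ι ω' (φ x) := by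
  simp [map, ι]

theorem hom_ext {B : Type v} [Semiring B] [Algebra ℂ B] {f g : WeylAlgebra ω →ₐ[ℂ] B}
    (h : ∀ x, f (ι ω x) = g (ι ω x)) : f = g := by
  apply RingQuot.ringQuot_ext'
  apply TensorAlgebra.hom_ext
  ext x
  exact h x

theorem map_map (φ : V →ₗ[ℂ] W) (h : ∀ x y, ω' (φ x) (φ y) = ω x y)
    (ψ : W →ₗ[ℂ] X) (h' : ∀ x y, ω'' (ψ x) (ψ y) = ω' x y)
    (χ : V →ₗ[ℂ] X) (h'' : ∀ x y, ω'' (χ x) (χ y) = ω x y) (hχ : ∀ x, χ x = ψ (φ x))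
    (a : WeylAlgebra ω) : map χ h'' a = map ψ h' (map φ h a) := by
  have : map χ h'' = (map ψ h').comp (map φ h) := hom_ext fun x => by simp [hχ]
  rw [this]
  rfl

theorem map_id (φ : V →ₗ[ℂ] V) (h : ∀ x y, ω (φ x) (φ y) = ω x y) (hφ : ∀ x, φ x = x)
    (a : WeylAlgebra ω) : map φ h a = a := by
  have : map φ h = AlgHom.id ℂ (WeylAlgebra ω) := hom_ext fun x => by simp [hφ]
  rw [this]
  rfl

end WeylAlgebra

end Weyl

/-! ### Finite groups acting on symplectic vector spaces -/

/-- A finite-dimensional complex symplectic vector space `(V, ω)` with a linear action `ρ` of a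
finite group `G` that preserves `ω`. The action need not be faithful. -/
structure SymplecticAction where
  V : Type u
  G : Type v
  [addCommGroup : AddCommGroup V]
  [module : Module ℂ V]
  [finiteDimensional : FiniteDimensional ℂ V]
  [group : Group G]
  [finite : Finite G]
  ω : V →ₗ[ℂ] V →ₗ[ℂ] ℂ
  alternating : ω.IsAlt
  nondegenerate : ω.Nondegenerate
  ρ : Representation ℂ G V
  invariant : ∀ g x y, ω (ρ g x) (ρ g y) = ω x y

namespace SymplecticAction

attribute [instance] addCommGroup module finiteDimensional group finite

/-- The Weyl algebra `Weyl(V)`. -/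
abbrev Weyl (D : SymplecticAction.{u, v}) : Type u := WeylAlgebra D.ω

/-- The action of `G` on `Weyl(V)` by algebra automorphisms that extends its action on `V`. -/
instance (D : SymplecticAction.{u, v}) : MulSemiringAction D.G D.Weyl where
  smul g a := WeylAlgebra.map (D.ρ g) (D.invariant g) a
  one_smul a := WeylAlgebra.map_id _ _ (by simp) a
  mul_smul g h a := WeylAlgebra.map_map _ _ _ _ _ _ (by simp) a
  smul_zero g := map_zero (WeylAlgebra.map (D.ρ g) (D.invariant g))
  smul_add g := map_add (WeylAlgebra.map (D.ρ g) (D.invariant g))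
  smul_one g := map_one (WeylAlgebra.map (D.ρ g) (D.invariant g))
  smul_mul g := map_mul (WeylAlgebra.map (D.ρ g) (D.invariant g))

theorem smul_def (D : SymplecticAction.{u, v}) (g : D.G) (a : D.Weyl) :
    g • a = WeylAlgebra.map (D.ρ g) (D.invariant g) a := rfl

instance (D : SymplecticAction.{u, v}) : SMulCommClass D.G ℂ D.Weyl where
  smul_comm g c a := map_smul (WeylAlgebra.map (D.ρ g) (D.invariant g)) c a

/-- The semidirect product `G ⋉ Weyl(V)`: finite sums of terms `single g a` (standing for `a g`,
with `a ∈ Weyl(V)` and `g ∈ G`), with `single g a * single h b = single (g h) (a * g • b)`. -/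
abbrev Semidirect (D : SymplecticAction.{u, v}) : Type (max u v) := SkewMonoidAlgebra D.Weyl D.G

/-- The set `S_i` of the elements `g ∈ G` such that `1 - g` has rank `i` on `V`. -/
def rankSet (D : SymplecticAction.{u, v}) (i : ℕ) : Set D.G :=
  {g | Module.finrank ℂ (LinearMap.range (1 - D.ρ g)) = i}

/-- The set of symplectic reflections: the elements `g ∈ G` such that `g - 1` has rank `2`
on `V`. -/
def symplecticReflections (D : SymplecticAction.{u, v}) : Set D.G :=
  {g | Module.finrank ℂ (LinearMap.range (D.ρ g - 1)) = 2}

/-- The Hochschild cohomology `Hⁱ(G ⋉ Weyl(V))`. -/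
abbrev cohomology (D : SymplecticAction.{u, v}) (i : ℕ) : Type (max u v) :=
  Hochschild.HH ℂ D.Semidirect i

/-- The space of conjugation-invariant complex functions on a set `S` of elements of a group. -/
def invariantFunctions {G : Type v} [Group G] (S : Set G) : Submodule ℂ (S → ℂ) where
  carrier := {f | ∀ s t : S, IsConj (s : G) (t : G) → f s = f t}
  add_mem' hf hg s t h := by simp [hf s t h, hg s t h]
  zero_mem' _ _ _ := rfl
  smul_mem' c f hf s t h := by simp [hf s t h]

/-- An isomorphism `(V, ω, G) → (V', ω', G')`: a linear isomorphism `φ : V → V'` that preserves the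
forms and a group isomorphism `θ : G → G'` such that `φ (g x) = θ(g) (φ x)`. -/
structure Iso (D D' : SymplecticAction.{u, v}) where
  φ : D.V ≃ₗ[ℂ] D'.V
  θ : D.G ≃* D'.G
  map_form : ∀ x y, D'.ω (φ x) (φ y) = D.ω x y
  map_act : ∀ g x, φ (D.ρ g x) = D'.ρ (θ g) (φ x)

namespace Iso

variable {D D' : SymplecticAction.{u, v}}

/-- The inverse isomorphism. -/
def symm (e : Iso D D') : Iso D' D where
  φ := e.φ.symm
  θ := e.θ.symm
  map_form x y := by
    obtain ⟨x, rfl⟩ := e.φ.surjective x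
    obtain ⟨y, rfl⟩ := e.φ.surjective y
    simp [e.map_form]
  map_act g x := by
    obtain ⟨x, rfl⟩ := e.φ.surjective x
    obtain ⟨g, rfl⟩ := e.θ.surjective g
    simp [← e.map_act]

/-- The induced homomorphism of Weyl algebras. -/
def weylHom (e : Iso D D') : D.Weyl →ₐ[ℂ] D'.Weyl :=
  WeylAlgebra.map e.φ.toLinearMap e.map_form

theorem weylHom_smul (e : Iso D D') (g : D.G) (a : D.Weyl) :
    e.weylHom (g • a) = e.θ g • e.weylHom a := by
  have h : ∀ x y, D'.ω ((e.φ.toLinearMap ∘ₗ D.ρ g) x) ((e.φ.toLinearMap ∘ₗ D.ρ g) y) =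
      D.ω x y := fun x y => by simp [e.map_form, D.invariant]
  rw [smul_def, smul_def, weylHom,
    ← WeylAlgebra.map_map _ _ _ _ (e.φ.toLinearMap ∘ₗ D.ρ g) h (fun _ => rfl),
    ← WeylAlgebra.map_map _ _ _ _ (e.φ.toLinearMap ∘ₗ D.ρ g) h (by simp [e.map_act])]

theorem weylHom_symm (e : Iso D D') (a : D.Weyl) : e.symm.weylHom (e.weylHom a) = a := by
  rw [weylHom, weylHom, ← WeylAlgebra.map_map _ _ _ _ LinearMap.id (fun _ _ => rfl) (by simp [symm])]
  exact WeylAlgebra.map_id _ _ (fun _ => rfl) a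

/-- The induced homomorphism `G ⋉ Weyl(V) → G' ⋉ Weyl(V')`, sending `a g` to `φ(a) θ(g)`. -/
def semidirectHom (e : Iso D D') : D.Semidirect →ₐ[ℂ] D'.Semidirect :=
  SkewMonoidAlgebra.liftNCAlgHom
    { SkewMonoidAlgebra.singleOneRingHom.comp (e.weylHom : D.Weyl →+* D'.Weyl) with
      commutes' := fun c => by
        simp [SkewMonoidAlgebra.singleOneRingHom] }
    ((SkewMonoidAlgebra.of D'.Weyl D'.G).comp (e.θ : D.G →* D'.G))
    (by
      intro a g
      simp [SkewMonoidAlgebra.singleOneRingHom, SkewMonoidAlgebra.of_apply,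
        SkewMonoidAlgebra.single_mul_single, weylHom_smul])

@[simp]
theorem semidirectHom_single (e : Iso D D') (g : D.G) (a : D.Weyl) :
    e.semidirectHom (SkewMonoidAlgebra.single g a) =
      SkewMonoidAlgebra.single (e.θ g) (e.weylHom a) := by
  refine (SkewMonoidAlgebra.liftNC_single _ _ g a).trans ?_
  simp [SkewMonoidAlgebra.singleOneRingHom, SkewMonoidAlgebra.of_apply,
    SkewMonoidAlgebra.single_mul_single]

theorem semidirectHom_symm (e : Iso D D') (x : D.Semidirect) :
    e.symm.semidirectHom (e.semidirectHom x) = x := by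
  induction x using SkewMonoidAlgebra.induction_on with
  | zero => simp
  | single g a =>
    rw [semidirectHom_single, semidirectHom_single, weylHom_symm]
    simp [symm]
  | add x y hx hy => rw [map_add, map_add, hx, hy]

/-- The induced algebra isomorphism `G ⋉ Weyl(V) ≃ G' ⋉ Weyl(V')`, sending `a g` to
`φ(a) θ(g)`. -/
def semidirectEquiv (e : Iso D D') : D.Semidirect ≃ₐ[ℂ] D'.Semidirect :=
  AlgEquiv.ofAlgHom e.semidirectHom e.symm.semidirectHom
    (AlgHom.ext fun x => e.symm.semidirectHom_symm x) (AlgHom.ext fun x => e.semidirectHom_symm x)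

theorem mem_rankSet (e : Iso D D') {i : ℕ} {g : D.G} (hg : g ∈ D.rankSet i) :
    e.θ g ∈ D'.rankSet i := by
  have h : LinearMap.range (1 - D'.ρ (e.θ g)) =
      (LinearMap.range (1 - D.ρ g)).map (e.φ : D.V →ₗ[ℂ] D'.V) := by
    have hc : (1 - D'.ρ (e.θ g)) ∘ₗ (e.φ : D.V →ₗ[ℂ] D'.V) =
        (e.φ : D.V →ₗ[ℂ] D'.V) ∘ₗ (1 - D.ρ g) := by
      ext x
      simp [e.map_act]
    rw [← LinearMap.range_comp, ← hc, LinearMap.range_comp, LinearEquiv.range, Submodule.map_top]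
  change Module.finrank ℂ (LinearMap.range (1 - D'.ρ (e.θ g))) = i
  rw [h, LinearEquiv.finrank_map_eq]
  exact hg

end Iso

end SymplecticAction

end

/-! Let B = G ⋉ Weyl(V). The Hochschild complex of B is replaced by a small one: the G-invariant
alternating forms on V with values in B, whose Koszul differential is built from the commuting
operators b ↦ xb - bx for x in V.

No resolution is used for the comparison. For every bimodule M both theories are shifted in degree
along 0 → M → Hom(B, M) → Coker → 0. In degree 0 the cocycles of both are the center of M
(`mem_center_iff`). In positive degrees both are acyclic on Hom(B, M): by
`Bimodule.exists_d_eq_of_coind` on the Hochschild side, and by `mem_exact_of_coind` together with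
averaging over G on the Koszul side. The outcome is a relation `Rel` between cocycles. It involves
no choices, so it is compatible with isomorphisms of triples (`Iso.rel_transport`).

The Koszul complex of B splits over g in G into complexes of Weyl(V)-valued forms with the twisted
commutators a ↦ xa - a g(x). Take a basis adapted to V = im(1 - g) ⊕ ker(1 - g). A suitable homotopy
has a laplacian that acts on the value of a form at basis vectors b_I as an oscillator number
operator plus an integer: the number of moved basis vectors missing from I plus the number of fixed
ones in I (`AdaptedBasis.lap_apply`, `AdaptedBasis.exists_nat`). Its kernel therefore lives only in
degree rank(1 - g), where it is a line, and it computes the cohomology.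

Naturality requires a canonical generator of that line. It is a power of the two-form ω((1 - g)x, (1
- g)y), denoted `tau`, which is nonzero by `Koszul.exists_powForm_ne_zero` and is preserved by all
isomorphisms, conjugations by G included. Hence the invariant classes are the sums of ψ(g) τ_g g
with ψ a class function on S_i. The canonical form vanishes in odd degree, so S_i is empty for odd
i. -/

noncomputable section

/-! ### Hochschild cochains with coefficients in a bimodule -/

namespace Hochschild

/-- A bimodule structure on `M` over a `k`-algebra `B`: the left and right multiplications. -/
structure Bimodule (k : Type u) [CommRing k] (B : Type v) [Ring B] [Algebra k B]
    (M : Type v) [AddCommGroup M] [Module k M] where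
  l : B →ₗ[k] M →ₗ[k] M
  r : B →ₗ[k] M →ₗ[k] M
  l_one : ∀ m, l 1 m = m
  r_one : ∀ m, r 1 m = m
  l_mul : ∀ a b m, l (a * b) m = l a (l b m)
  r_mul : ∀ a b m, r (a * b) m = r b (r a m)
  l_r : ∀ a b m, l a (r b m) = r b (l a m)

namespace Bimodule

variable {k : Type u} [CommRing k] {B : Type v} [Ring B] [Algebra k B]

variable (k B) in
/-- The algebra as a bimodule over itself. -/
def self : Bimodule k B B where
  l := LinearMap.mul k B
  r := (LinearMap.mul k B).flip
  l_one := by simp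
  r_one := by simp
  l_mul := by simp [mul_assoc]
  r_mul := by simp [mul_assoc]
  l_r := by simp [mul_assoc]

variable {M : Type v} [AddCommGroup M] [Module k M] {N : Type v} [AddCommGroup N] [Module k N]

/-- The coinduced bimodule `Hom(B, M)`: `(b φ)(x) = b φ(x)` and `(φ b)(x) = φ(b x)`. -/
def coind (β : Bimodule k B M) : Bimodule k B (B →ₗ[k] M) where
  l := LinearMap.mk₂ k (fun b φ => β.l b ∘ₗ φ) (by intros; ext; simp) (by intros; ext; simp)
    (by intros; ext; simp) (by intros; ext; simp)
  r := LinearMap.mk₂ k (fun b φ => φ ∘ₗ LinearMap.mulLeft k b) (by intros; ext; simp [add_mul])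
    (by intros; ext; simp) (by intros; ext; simp) (by intros; ext; simp)
  l_one _ := by ext; simp [β.l_one]
  r_one _ := by ext; simp
  l_mul _ _ _ := by ext; simp [β.l_mul]
  r_mul _ _ _ := by ext; simp
  l_r _ _ _ := by ext; simp

@[simp]
theorem coind_l (β : Bimodule k B M) (b : B) (φ : B →ₗ[k] M) (x : B) :
    β.coind.l b φ x = β.l b (φ x) := rfl

@[simp]
theorem coind_r (β : Bimodule k B M) (b : B) (φ : B →ₗ[k] M) (x : B) :
    β.coind.r b φ x = φ (b * x) := rfl

/-- The embedding of `M` into the coinduced bimodule. -/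
def toCoind (β : Bimodule k B M) : M →ₗ[k] B →ₗ[k] M := β.r.flip

@[simp]
theorem toCoind_apply (β : Bimodule k B M) (m : M) (x : B) : β.toCoind m x = β.r x m := rfl

theorem toCoind_injective (β : Bimodule k B M) : Function.Injective β.toCoind := by
  intro m m' h
  simpa [β.r_one] using LinearMap.congr_fun h 1

/-- Homomorphisms of bimodules, compatible with an algebra isomorphism. -/
structure IsHom {B' : Type v} [Ring B'] [Algebra k B'] (β : Bimodule k B M) (γ : Bimodule k B' N)
    (e : B ≃ₐ[k] B') (τ : M →ₗ[k] N) : Prop where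
  l : ∀ b m, τ (β.l b m) = γ.l (e b) (τ m)
  r : ∀ b m, τ (β.r b m) = γ.r (e b) (τ m)

theorem isHom_toCoind (β : Bimodule k B M) : β.IsHom β.coind AlgEquiv.refl β.toCoind where
  l b m := by ext x; simp [β.l_r]
  r b m := by ext x; simp [β.r_mul]

/-- Evaluation at `1` of the coinduced bimodule. -/
def evalOne : (B →ₗ[k] M) →ₗ[k] M := LinearMap.applyₗ 1

@[simp]
theorem evalOne_apply (φ : B →ₗ[k] M) : evalOne φ = φ 1 := rfl

/-- The linear space underlying the cokernel of `M → Hom(B, M)`. -/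
abbrev Coker (k : Type u) [CommRing k] (B : Type v) [Ring B] [Algebra k B]
    (M : Type v) [AddCommGroup M] [Module k M] : Type v :=
  LinearMap.ker (evalOne : (B →ₗ[k] M) →ₗ[k] M)

/-- The projection of `Hom(B, M)` onto the cokernel of `M → Hom(B, M)`. -/
def toCoker (β : Bimodule k B M) : (B →ₗ[k] M) →ₗ[k] Coker k B M :=
  (LinearMap.id - β.toCoind ∘ₗ evalOne).codRestrict _ fun φ => by simp [β.r_one]

theorem coe_toCoker (β : Bimodule k B M) (φ : B →ₗ[k] M) :
    (β.toCoker φ : B →ₗ[k] M) = φ - β.toCoind (φ 1) := rfl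

@[simp]
theorem toCoker_coe (β : Bimodule k B M) (φ : Coker k B M) : β.toCoker φ = φ := by
  have h : (φ : B →ₗ[k] M) 1 = 0 := φ.2
  ext1
  simp [coe_toCoker, h]

@[simp]
theorem toCoker_toCoind (β : Bimodule k B M) (m : M) : β.toCoker (β.toCoind m) = 0 := by
  ext1
  simp [coe_toCoker, β.r_one]

theorem eq_toCoind_of_toCoker_eq_zero (β : Bimodule k B M) {φ : B →ₗ[k] M}
    (h : β.toCoker φ = 0) : φ = β.toCoind (φ 1) := by
  rw [← sub_eq_zero, ← coe_toCoker, h, ZeroMemClass.coe_zero]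

/-- Replacing φ by its representative that vanishes at 1 changes it by an element of M, and M is a
sub-bimodule of Hom(B, M). This and `toCoker_r` make the actions on representatives well defined. -/
theorem toCoker_l (β : Bimodule k B M) (b : B) (φ : B →ₗ[k] M) :
    β.toCoker (β.coind.l b (β.toCoker φ)) = β.toCoker (β.coind.l b φ) := by
  have := β.isHom_toCoind.l b (φ 1)
  rw [AlgEquiv.coe_refl, id] at this
  simp [coe_toCoker, ← this]

theorem toCoker_r (β : Bimodule k B M) (b : B) (φ : B →ₗ[k] M) :
    β.toCoker (β.coind.r b (β.toCoker φ)) = β.toCoker (β.coind.r b φ) := by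
  have := β.isHom_toCoind.r b (φ 1)
  rw [AlgEquiv.coe_refl, id] at this
  simp [coe_toCoker, ← this]

/-- The cokernel of `M → Hom(B, M)`. -/
def coker (β : Bimodule k B M) : Bimodule k B (Coker k B M) where
  l := LinearMap.mk₂ k (fun b φ => β.toCoker (β.coind.l b φ)) (by intros; simp) (by intros; simp)
    (by intros; simp) (by intros; simp)
  r := LinearMap.mk₂ k (fun b φ => β.toCoker (β.coind.r b φ)) (by intros; simp) (by intros; simp)
    (by intros; simp) (by intros; simp)
  l_one _ := by simp [β.coind.l_one]
  r_one _ := by simp [β.coind.r_one]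
  l_mul _ _ _ := by simp [β.coind.l_mul, toCoker_l]
  r_mul _ _ _ := by simp [β.coind.r_mul, toCoker_r]
  l_r _ _ _ := by simp [β.coind.l_r, toCoker_l, toCoker_r]

theorem isHom_toCoker (β : Bimodule k B M) : β.coind.IsHom β.coker AlgEquiv.refl β.toCoker where
  l b φ := (β.toCoker_l b φ).symm
  r b φ := (β.toCoker_r b φ).symm

/-- Cochains with values in a bimodule. -/
abbrev Cochain (k : Type u) [CommRing k] (B : Type v) [Ring B] [Algebra k B]
    (M : Type v) [AddCommGroup M] [Module k M] (n : ℕ) : Type v :=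
  MultilinearMap k (fun _ : Fin n => B) M

/-- Currying of the last variable. -/
def curry {n : ℕ} : Cochain k B M (n + 1) ≃ₗ[k] Cochain k B (B →ₗ[k] M) n :=
  (multilinearCurryRightEquiv k (fun _ : Fin (n + 1) => B) M)

theorem curry_apply {n : ℕ} (f : Cochain k B M (n + 1)) (a : Fin n → B) (x : B) :
    curry f a x = f (Fin.snoc a x) := rfl

theorem curry_symm_apply {n : ℕ} (f : Cochain k B (B →ₗ[k] M) n) (a : Fin (n + 1) → B) :
    curry.symm f a = f (Fin.init a) (a (Fin.last n)) := rfl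

/-- Composition of cochains with a linear map. -/
def post (τ : M →ₗ[k] N) (n : ℕ) : Cochain k B M n →ₗ[k] Cochain k B N n where
  toFun f := τ.compMultilinearMap f
  map_add' f g := by ext; simp
  map_smul' c f := by ext; simp

@[simp]
theorem post_apply (τ : M →ₗ[k] N) (n : ℕ) (f : Cochain k B M n) (a : Fin n → B) :
    post τ n f a = τ (f a) := rfl

/-- The Hochschild differential, defined by recursion: up to a boundary term, it is compatible
with the currying of the last variable. -/
def d : (n : ℕ) → {M : Type v} → [AddCommGroup M] → [Module k M] → Bimodule k B M →
    Cochain k B M n →ₗ[k] Cochain k B M (n + 1)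
  | 0, _, _, _, β => curry.symm.toLinearMap ∘ₗ
      (post (β.toCoind - β.l.flip) 0)
  | n + 1, _, _, _, β => curry.symm.toLinearMap ∘ₗ
      (post β.toCoind (n + 1) - d n β.coind ∘ₗ curry.toLinearMap)

theorem curry_d_zero (β : Bimodule k B M) (f : Cochain k B M 0) :
    curry (d 0 β f) = post (β.toCoind - β.l.flip) 0 f := by simp [d]

theorem curry_d_succ (n : ℕ) (β : Bimodule k B M) (f : Cochain k B M (n + 1)) :
    curry (d (n + 1) β f) = post β.toCoind (n + 1) f - d n β.coind (curry f) := by simp [d]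

/-- After currying, the right action φ ↦ φ(b ·) on Hom(B, M) turns the right face in lower degree
into the last inner face, and the minus sign of the recursion accounts for the alternating signs. -/
theorem d_apply (n : ℕ) (β : Bimodule k B M) (f : Cochain k B M n) (a : Fin (n + 1) → B) :
    d n β f a = β.r (a (Fin.last n)) (f (Fin.init a))
      + ∑ j : Fin n, (-1 : k) ^ (n - (j : ℕ)) • f (Fin.contractNth j.castSucc (· * ·) a)
      + (-1 : k) ^ (n + 1) • β.l (a 0) (f (Fin.tail a)) := by
  induction n generalizing M with
  | zero =>
    have h : (Fin.tail a : Fin 0 → B) = Fin.init a := Subsingleton.elim _ _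
    simp [d, curry_symm_apply, h, sub_eq_add_neg]
  | succ n ih =>
    have key : d (n + 1) β f a = β.r (a (Fin.last _)) (f (Fin.init a))
        - d n β.coind (curry f) (Fin.init a) (a (Fin.last _)) := by
      simp [d, curry_symm_apply]
    rw [key, ih, Fin.sum_univ_castSucc]
    simp only [LinearMap.add_apply, LinearMap.sum_apply, LinearMap.smul_apply, coind_l, coind_r,
      curry_apply]
    have h1 : (Fin.snoc (Fin.init (Fin.init a)) (Fin.init a (Fin.last n) * a (Fin.last (n + 1))) :
        Fin (n + 1) → B) = Fin.contractNth (Fin.last n).castSucc (· * ·) a := by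
      funext i
      induction i using Fin.lastCases with
      | last => simp [Fin.contractNth, Fin.init]
      | cast i => simp [Fin.contractNth, Fin.init]
    have h2 : ∀ j : Fin n, (Fin.snoc (Fin.contractNth j.castSucc (· * ·) (Fin.init a))
        (a (Fin.last (n + 1))) : Fin (n + 1) → B) =
        Fin.contractNth j.castSucc.castSucc (· * ·) a := by
      intro j
      funext i
      induction i using Fin.lastCases with
      | last =>
        have := j.isLt
        simp [Fin.contractNth, Nat.not_lt.2 this.le, this.ne']
      | cast i => simp [Fin.contractNth, Fin.init]
    have h3 : (Fin.snoc (Fin.tail (Fin.init a)) (a (Fin.last (n + 1))) : Fin (n + 1) → B) =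
        Fin.tail a := by
      funext i
      induction i using Fin.lastCases with
      | last => simp [Fin.tail]
      | cast i => simp [Fin.tail, Fin.init]
    have h4 : ∀ j : Fin n, (-1 : k) ^ (n + 1 - (j : ℕ)) = - (-1 : k) ^ (n - (j : ℕ)) := by
      intro j
      rw [Nat.succ_sub j.isLt.le, pow_succ, mul_neg_one]
    simp only [h1, h2, h3, Fin.val_castSucc, h4, Fin.val_last, neg_smul, Finset.sum_neg_distrib]
    have h5 : n + 1 - n = 1 := by omega
    rw [h5, pow_succ (-1 : k) (n + 1)]
    simp only [pow_one, neg_smul, one_smul, mul_neg_one]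
    have h6 : Fin.init a (0 : Fin (n + 1)) = a 0 := rfl
    rw [h6]
    abel

theorem d_self (n : ℕ) : d n (self k B) = Hochschild.d k B n := by
  ext f a
  rw [d_apply, Hochschild.d_apply]
  rfl

/-- Transport of cochains along an algebra isomorphism and a linear map of the coefficients. -/
def transport {B' : Type v} [Ring B'] [Algebra k B'] (e : B ≃ₐ[k] B') (τ : M →ₗ[k] N) (n : ℕ)
    (f : Cochain k B M n) : Cochain k B' N n :=
  τ.compMultilinearMap (f.compLinearMap fun _ => e.symm.toLinearMap)

@[simp]
theorem transport_apply {B' : Type v} [Ring B'] [Algebra k B'] (e : B ≃ₐ[k] B') (τ : M →ₗ[k] N)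
    (n : ℕ) (f : Cochain k B M n) (b : Fin n → B') :
    transport e τ n f b = τ (f fun i => e.symm (b i)) := rfl

theorem d_transport {B' : Type v} [Ring B'] [Algebra k B'] {e : B ≃ₐ[k] B'} {τ : M →ₗ[k] N}
    {β : Bimodule k B M} {γ : Bimodule k B' N} (h : β.IsHom γ e τ) (n : ℕ) (f : Cochain k B M n) :
    d n γ (transport e τ n f) = transport e τ (n + 1) (d n β f) := by
  have key : ∀ (j : Fin n) (b : Fin (n + 1) → B'),
      (fun i => e.symm (Fin.contractNth j.castSucc (· * ·) b i)) =
        Fin.contractNth j.castSucc (· * ·) (fun i => e.symm (b i)) := by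
    intro j b
    funext i
    simp only [Fin.contractNth]
    split_ifs <;> simp
  ext b
  simp only [d_apply, transport_apply, map_add, map_sum, map_smul, key, h.l, h.r,
    AlgEquiv.apply_symm_apply]
  rfl

theorem d_post {τ : M →ₗ[k] N} {β : Bimodule k B M} {γ : Bimodule k B N}
    (h : β.IsHom γ AlgEquiv.refl τ) (n : ℕ) (f : Cochain k B M n) :
    d n γ (post τ n f) = post τ (n + 1) (d n β f) :=
  d_transport h n f

/-- Curried, the recursion expresses d² f through `toCoind` ∘ df, d(`toCoind` ∘ f) and d² of the
curried cochain. The first two cancel because `toCoind` is a bimodule map, the third vanishes by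
induction. -/
theorem d_d (n : ℕ) (β : Bimodule k B M) (f : Cochain k B M n) :
    d (n + 1) β (d n β f) = 0 := by
  apply curry.injective
  induction n generalizing M with
  | zero =>
    rw [curry_d_succ, curry_d_zero, map_zero, sub_eq_zero]
    ext a x
    have h : (Fin.tail a : Fin 0 → B) = Fin.init a := Subsingleton.elim _ _
    simp [d_apply, h, β.r_mul, β.l_mul, β.l_r, sub_eq_add_neg]
    abel
  | succ n ih =>
    rw [curry_d_succ, curry_d_succ, map_sub, d_post β.isHom_toCoind,
      curry.injective (ih β.coind (curry f)), sub_zero, sub_self, map_zero]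

/-- The coinduced bimodules are acyclic. -/
theorem exists_d_eq_of_coind (n : ℕ) (β : Bimodule k B M) (f : Cochain k B (B →ₗ[k] M) (n + 1))
    (hf : d (n + 1) β.coind f = 0) : ∃ h, d n β.coind h = f := by
  -- Evaluating the inner variable at 1 is a bimodule retraction of Hom(B, M) → Hom(B, Hom(B, M)).
  -- Applying it to the curried cocycle identity `toCoind` ∘ f = d(curry f) gives the primitive.
  let ε : (B →ₗ[k] B →ₗ[k] M) →ₗ[k] B →ₗ[k] M := LinearMap.llcomp k B _ M evalOne
  have hε : β.coind.coind.IsHom β.coind AlgEquiv.refl ε :=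
    ⟨fun b Ψ => by ext; simp [ε], fun b Ψ => by ext; simp [ε]⟩
  refine ⟨post ε n (curry f), ?_⟩
  have h := curry_d_succ n β.coind f
  rw [hf, map_zero, eq_comm, sub_eq_zero] at h
  rw [d_post hε, ← h]
  ext a x
  simp [ε]

variable {n : ℕ}

theorem post_toCoind_injective (β : Bimodule k B M) :
    Function.Injective (post β.toCoind n : Cochain k B M n → _) := by
  intro f g h
  ext a
  exact β.toCoind_injective (MultilinearMap.congr_fun h a)

theorem post_toCoker_post_toCoind (β : Bimodule k B M) (f : Cochain k B M n) :
    post β.toCoker n (post β.toCoind n f) = 0 := by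
  ext1 a
  simp

theorem exists_post_toCoind (β : Bimodule k B M) (f : Cochain k B (B →ₗ[k] M) n)
    (h : post β.toCoker n f = 0) : ∃ g, post β.toCoind n g = f :=
  ⟨post evalOne n f, by
    ext1 a
    exact (β.eq_toCoind_of_toCoker_eq_zero (MultilinearMap.congr_fun h a)).symm⟩

theorem exists_post_toCoker (β : Bimodule k B M) (f : Cochain k B (Coker k B M) n) :
    ∃ g, post β.toCoker n g = f :=
  ⟨post (Submodule.subtype _) n f, by ext1 a; simp⟩

/-- The coboundaries. -/
def boundaries (β : Bimodule k B M) : (n : ℕ) → Submodule k (Cochain k B M n)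
  | 0 => ⊥
  | n + 1 => LinearMap.range (d n β)

theorem boundaries_self (n : ℕ) : (self k B).boundaries n = Hochschild.coboundaries k B n := by
  cases n with
  | zero => rfl
  | succ n => rw [boundaries, Hochschild.coboundaries, d_self]

end Bimodule
end Hochschild

/-! ### The Koszul complex of a family of commuting operators -/

namespace Koszul

open AlternatingMap (alternatizeUncurryFin alternatizeUncurryFinLM alternatizeUncurryFin_add
  alternatizeUncurryFin_smul alternatizeUncurryFin_apply
  alternatizeUncurryFin_alternatizeUncurryFinLM_comp_of_symmetric)

variable {k : Type*} [Field k] {V : Type*} [AddCommGroup V] [Module k V]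
  {M : Type*} [AddCommGroup M] [Module k M] {N : Type*} [AddCommGroup N] [Module k N]

theorem sum_alternatingMap_apply {ι J : Type*} (s : Finset J) (f : J → V [⋀^ι]→ₗ[k] M)
    (x : ι → V) : (∑ j ∈ s, f j) x = ∑ j ∈ s, f j x := by
  classical
  induction s using Finset.induction_on with
  | empty => simp
  | insert a s ha ih => simp [Finset.sum_insert ha, ih]

/-- The form-valued linear map `v ↦ D v ∘ κ`. -/
def actOn (D : V →ₗ[k] M →ₗ[k] M) {n : ℕ} (κ : V [⋀^Fin n]→ₗ[k] M) :
    V →ₗ[k] V [⋀^Fin n]→ₗ[k] M where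
  toFun v := (D v).compAlternatingMap κ
  map_add' v w := by ext; simp
  map_smul' c v := by ext; simp

@[simp]
theorem actOn_apply (D : V →ₗ[k] M →ₗ[k] M) {n : ℕ} (κ : V [⋀^Fin n]→ₗ[k] M) (v : V)
    (x : Fin n → V) : actOn D κ v x = D v (κ x) := rfl

/-- The differential of the Koszul complex of alternating forms with values in `M`. -/
def d (D : V →ₗ[k] M →ₗ[k] M) (n : ℕ) : V [⋀^Fin n]→ₗ[k] M →ₗ[k] V [⋀^Fin (n + 1)]→ₗ[k] M where
  toFun κ := alternatizeUncurryFin (actOn D κ)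
  map_add' κ κ' := by
    rw [← alternatizeUncurryFin_add]
    congr 1
    ext
    simp
  map_smul' c κ := by
    rw [RingHom.id_apply, ← alternatizeUncurryFin_smul]
    congr 1
    ext
    simp

theorem d_apply (D : V →ₗ[k] M →ₗ[k] M) (n : ℕ) (κ : V [⋀^Fin n]→ₗ[k] M) (x : Fin (n + 1) → V) :
    d D n κ x = ∑ i : Fin (n + 1), (-1 : ℤ) ^ (i : ℕ) • D (x i) (κ (i.removeNth x)) :=
  alternatizeUncurryFin_apply _ _

/-- The composite D x ∘ D y is symmetric in x and y, so its alternation is zero. -/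
theorem d_d {D : V →ₗ[k] M →ₗ[k] M} (hD : ∀ x y m, D x (D y m) = D y (D x m)) (n : ℕ)
    (κ : V [⋀^Fin n]→ₗ[k] M) : d D (n + 1) (d D n κ) = 0 := by
  let F : V →ₗ[k] V →ₗ[k] V [⋀^Fin n]→ₗ[k] M :=
    LinearMap.mk₂ k (fun v w => (D v).compAlternatingMap ((D w).compAlternatingMap κ))
      (by intros; ext; simp) (by intros; ext; simp) (by intros; ext; simp) (by intros; ext; simp)
  have hF : ∀ v w, F v w = F w v := fun v w => by
    ext x
    exact hD v w (κ x)
  rw [← alternatizeUncurryFin_alternatizeUncurryFinLM_comp_of_symmetric hF]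
  change alternatizeUncurryFin _ = _
  congr 1
  ext v x
  simp [F, d, alternatizeUncurryFin_apply, map_sum]

/-- Pullback of forms along a linear map, combined with a linear map of the coefficients. -/
def pull {W : Type*} [AddCommGroup W] [Module k W] (φ : W →ₗ[k] V) (τ : M →ₗ[k] N) (n : ℕ) :
    V [⋀^Fin n]→ₗ[k] M →ₗ[k] W [⋀^Fin n]→ₗ[k] N where
  toFun κ := τ.compAlternatingMap (κ.compLinearMap φ)
  map_add' _ _ := by ext; simp
  map_smul' _ _ := by ext; simp

@[simp]
theorem pull_apply {W : Type*} [AddCommGroup W] [Module k W] (φ : W →ₗ[k] V) (τ : M →ₗ[k] N)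
    (n : ℕ) (κ : V [⋀^Fin n]→ₗ[k] M) (x : Fin n → W) :
    pull φ τ n κ x = τ (κ fun i => φ (x i)) := rfl

theorem d_pull {W : Type*} [AddCommGroup W] [Module k W] {φ : W →ₗ[k] V} {τ : M →ₗ[k] N}
    {D : V →ₗ[k] M →ₗ[k] M} {D' : W →ₗ[k] N →ₗ[k] N} (h : ∀ y m, τ (D (φ y) m) = D' y (τ m))
    (n : ℕ) (κ : V [⋀^Fin n]→ₗ[k] M) : d D' n (pull φ τ n κ) = pull φ τ (n + 1) (d D n κ) := by
  ext x
  simp only [d_apply, pull_apply, map_sum, map_zsmul, h]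
  rfl

/-- The exact forms. -/
def exact (D : V →ₗ[k] M →ₗ[k] M) : (n : ℕ) → Submodule k (V [⋀^Fin n]→ₗ[k] M)
  | 0 => ⊥
  | n + 1 => LinearMap.range (d D n)

theorem pull_mem_exact {W : Type*} [AddCommGroup W] [Module k W] {φ : W →ₗ[k] V} {τ : M →ₗ[k] N}
    {D : V →ₗ[k] M →ₗ[k] M} {D' : W →ₗ[k] N →ₗ[k] N} (h : ∀ y m, τ (D (φ y) m) = D' y (τ m))
    {n : ℕ} {κ : V [⋀^Fin n]→ₗ[k] M} (hκ : κ ∈ exact D n) : pull φ τ n κ ∈ exact D' n := by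
  cases n with
  | zero =>
    have h0 : κ = 0 := hκ
    rw [h0, map_zero]
    exact zero_mem _
  | succ n =>
    obtain ⟨ν, rfl⟩ := hκ
    exact ⟨pull φ τ n ν, d_pull h n ν⟩

section Homotopy

variable {J : Type*} [Fintype J] (v : J → V) (H : J → M →ₗ[k] M)

/-- The operator `κ ↦ ∑ j, H j ∘ κ (v j, …)`. -/
def homotopy (n : ℕ) : V [⋀^Fin (n + 1)]→ₗ[k] M →ₗ[k] V [⋀^Fin n]→ₗ[k] M where
  toFun κ := ∑ j, (H j).compAlternatingMap (κ.curryLeft (v j))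
  map_add' κ κ' := by simp [Finset.sum_add_distrib]
  map_smul' c κ := by simp [Finset.smul_sum]

theorem homotopy_apply (n : ℕ) (κ : V [⋀^Fin (n + 1)]→ₗ[k] M) (x : Fin n → V) :
    homotopy v H n κ x = ∑ j, H j (κ (Fin.cons (v j) x)) := by
  rw [homotopy, LinearMap.coe_mk, AddHom.coe_mk, sum_alternatingMap_apply]
  rfl

/-- The anticommutator of `homotopy` with the differential. -/
def laplacian (D : V →ₗ[k] M →ₗ[k] M) : (n : ℕ) → V [⋀^Fin n]→ₗ[k] M →ₗ[k] V [⋀^Fin n]→ₗ[k] M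
  | 0 => homotopy v H 0 ∘ₗ d D 0
  | n + 1 => d D n ∘ₗ homotopy v H n + homotopy v H (n + 1) ∘ₗ d D (n + 1)

variable {v H}

theorem laplacian_d {D : V →ₗ[k] M →ₗ[k] M} (hD : ∀ x y m, D x (D y m) = D y (D x m)) (n : ℕ)
    (κ : V [⋀^Fin n]→ₗ[k] M) : laplacian v H D (n + 1) (d D n κ) = d D n (laplacian v H D n κ) := by
  cases n <;> simp [laplacian, d_d hD]

theorem laplacian_mem_exact {D : V →ₗ[k] M →ₗ[k] M} (n : ℕ) {κ : V [⋀^Fin n]→ₗ[k] M}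
    (hκ : d D n κ = 0) : laplacian v H D n κ ∈ exact D n := by
  cases n with
  | zero => simp [laplacian, hκ]
  | succ n => exact ⟨homotopy v H n κ, by simp [laplacian, hκ]⟩

/-- In the anticommutator the terms with D(x_i) to the left and to the right of H_j cancel up to the
scalar commutator γ_j(x_i). These scalars remain as a derivation acting on the arguments of the
form. -/
theorem laplacian_apply {D : V →ₗ[k] M →ₗ[k] M} {γ : J → V → k}
    (hγ : ∀ x j m, D x (H j m) = H j (D x m) + γ j x • m) (n : ℕ) (κ : V [⋀^Fin n]→ₗ[k] M)
    (x : Fin n → V) :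
    laplacian v H D n κ x = ∑ j, H j (D (v j) (κ x)) +
      ∑ i, κ (Function.update x i (∑ j, γ j (x i) • v j)) := by
  have h1 : ∀ (n : ℕ) (κ : V [⋀^Fin n]→ₗ[k] M) (x : Fin n → V),
      homotopy v H n (d D n κ) x = ∑ j, H j (D (v j) (κ x)) + ∑ i : Fin n, ∑ j,
        (-1 : ℤ) ^ ((i : ℕ) + 1) • H j (D (x i) (κ (i.succ.removeNth (Fin.cons (v j) x : Fin (n + 1) → V)))) := by
    intro n κ x
    rw [homotopy_apply, Finset.sum_comm (s := Finset.univ (α := Fin n)), ← Finset.sum_add_distrib]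
    refine Finset.sum_congr rfl fun j _ => ?_
    rw [d_apply, Fin.sum_univ_succ]
    simp [map_sum]
  cases n with
  | zero => simp [laplacian, h1]
  | succ n =>
    have h2 : ∀ (i : Fin (n + 1)) (j : J),
        i.succ.removeNth (Fin.cons (v j) x : Fin (n + 2) → V) =
          Fin.cons (v j) (i.removeNth x) := by
      intro i j
      funext m
      induction m using Fin.cases <;> simp [Fin.removeNth_apply]
    have h3 : ∀ (i : Fin (n + 1)) (y : V), κ (Function.update x i y) =
        (-1 : ℤ) ^ (i : ℕ) • κ (Fin.cons y (i.removeNth x)) := by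
      intro i y
      have := AlternatingMap.neg_one_pow_smul_map_insertNth κ i y (i.removeNth x)
      rw [Fin.insertNth_removeNth] at this
      change _ = (-1 : ℤ) ^ (i : ℕ) • κ (Matrix.vecCons y (i.removeNth x))
      rw [← this, smul_smul, ← pow_add, Even.neg_one_pow ⟨_, rfl⟩, one_smul]
    have h4 : ∀ i : Fin (n + 1), κ (Function.update x i (∑ j, γ j (x i) • v j)) =
        ∑ j, (-1 : ℤ) ^ (i : ℕ) • γ j (x i) • κ (Fin.cons (v j) (i.removeNth x)) := by
      intro i
      rw [AlternatingMap.map_update_sum]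
      refine Finset.sum_congr rfl fun j _ => ?_
      rw [AlternatingMap.map_update_smul, h3, smul_comm]
    simp only [laplacian, LinearMap.add_apply, LinearMap.comp_apply, AlternatingMap.add_apply, h1,
      h2, h4]
    rw [add_left_comm, d_apply, ← Finset.sum_add_distrib]
    congr 1
    refine Finset.sum_congr rfl fun i _ => ?_
    rw [homotopy_apply, map_sum, Finset.smul_sum, ← Finset.sum_add_distrib]
    refine Finset.sum_congr rfl fun j _ => ?_
    rw [hγ, pow_succ, mul_neg_one, neg_smul, smul_add]
    abel

end Homotopy

end Koszul

/-! ### Raising and lowering operators -/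

namespace Oscillator

variable {k : Type*} [Field k] {X : Type*} [AddCommGroup X] [Module k X]
  {J : Type*}

/-- The space obtained from `G` by applying `n` raising operators. -/
def level (a' : J → X →ₗ[k] X) (G : Submodule k X) : ℕ → Submodule k X
  | 0 => G
  | n + 1 => ⨆ j, (level a' G n).map (a' j)

/-- Canonical commutation relations with a vacuum space `G` that generates everything. -/
structure IsSystem [DecidableEq J] (a a' : J → X →ₗ[k] X) (G : Submodule k X) : Prop where
  lower_raise : ∀ i j x, a i (a' j x) = a' j (a i x) + if i = j then x else 0
  raise_comm : ∀ i j x, a' i (a' j x) = a' j (a' i x)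
  vacuum : ∀ i, ∀ x ∈ G, a i x = 0
  generates : ∀ S : Submodule k X, G ≤ S → (∀ i, ∀ x ∈ S, a i x ∈ S) →
    (∀ i, ∀ x ∈ S, a' i x ∈ S) → S = ⊤

/-- The number operator. -/
def number [Fintype J] (a a' : J → X →ₗ[k] X) : X →ₗ[k] X := ∑ j, a' j ∘ₗ a j

theorem number_apply [Fintype J] (a a' : J → X →ₗ[k] X) (x : X) :
    number a a' x = ∑ j, a' j (a j x) := by
  simp [number]

namespace IsSystem

variable [DecidableEq J] {a a' : J → X →ₗ[k] X} {G : Submodule k X}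

theorem raise_mem {n : ℕ} {x : X} (hx : x ∈ level a' G n) (j : J) : a' j x ∈ level a' G (n + 1) :=
  Submodule.mem_iSup_of_mem j ⟨x, hx, rfl⟩

theorem lower_mem (h : IsSystem a a' G) (n : ℕ) {x : X} (hx : x ∈ level a' G (n + 1)) (i : J) :
    a i x ∈ level a' G n := by
  induction n generalizing x with
  | zero =>
    suffices level a' G 1 ≤ (level a' G 0).comap (a i) from this hx
    refine iSup_le fun j => Submodule.map_le_iff_le_comap.2 fun y hy => ?_
    simp only [Submodule.mem_comap, h.lower_raise, h.vacuum i y hy, map_zero, zero_add]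
    split_ifs
    exacts [hy, zero_mem _]
  | succ n ih =>
    suffices level a' G (n + 2) ≤ (level a' G (n + 1)).comap (a i) from this hx
    refine iSup_le fun j => Submodule.map_le_iff_le_comap.2 fun y hy => ?_
    simp only [Submodule.mem_comap, h.lower_raise]
    refine add_mem (raise_mem (ih hy) j) ?_
    split_ifs
    exacts [hy, zero_mem _]

/-- The number operator kills the vacuum, and each raising operator increases its eigenvalue by one.
-/
theorem number_eq [Fintype J] (h : IsSystem a a' G) (n : ℕ) {x : X} (hx : x ∈ level a' G n) :
    number a a' x = (n : k) • x := by
  induction n generalizing x with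
  | zero => simp [number_apply, h.vacuum _ x hx]
  | succ n ih =>
    suffices level a' G (n + 1) ≤ LinearMap.ker (number a a' - ((n + 1 : ℕ) : k) • LinearMap.id) by
      simpa [sub_eq_zero] using this hx
    refine iSup_le fun j => Submodule.map_le_iff_le_comap.2 fun y hy => ?_
    have h1 : number a a' (a' j y) = a' j (number a a' y) + a' j y := by
      have h2 : ∀ i, a' i (if i = j then y else 0) = if i = j then a' j y else 0 := by
        intro i
        split_ifs with hij
        exacts [by rw [hij], map_zero _]
      simp only [number_apply, h.lower_raise, map_add, Finset.sum_add_distrib, h.raise_comm _ j, h2,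
        Finset.sum_ite_eq', Finset.mem_univ, if_true, map_sum]
    simp [h1, ih hy, add_smul]

theorem iSup_level (h : IsSystem a a' G) : ⨆ n, level a' G n = ⊤ := by
  refine h.generates _ (le_iSup (level a' G) 0) (fun i => ?_) (fun i => ?_)
  · suffices ⨆ n, level a' G n ≤ (⨆ n, level a' G n).comap (a i) from this
    refine iSup_le fun n y hy => ?_
    cases n with
    | zero => simp [h.vacuum i y hy]
    | succ n => exact Submodule.mem_iSup_of_mem n (h.lower_mem n hy i)
  · suffices ⨆ n, level a' G n ≤ (⨆ n, level a' G n).comap (a' i) from this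
    exact iSup_le fun n y hy => Submodule.mem_iSup_of_mem (n + 1) (raise_mem hy i)

variable [Fintype J]

theorem level_le_eigenspace (h : IsSystem a a' G) (n : ℕ) :
    level a' G n ≤ Module.End.eigenspace (number a a') (n : k) :=
  fun _ hx => Module.End.mem_eigenspace_iff.2 (h.number_eq n hx)

variable [CharZero k]

/-- The levels lie in eigenspaces of the number operator for the eigenvalues 0, 1, 2, …, which are
distinct in characteristic zero. -/
theorem isInternal_level (h : IsSystem a a' G) : DirectSum.IsInternal (level a' G) := by
  classical
  rw [DirectSum.isInternal_submodule_iff_iSupIndep_and_iSup_eq_top]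
  exact ⟨((Module.End.eigenspaces_iSupIndep (number a a')).comp
    (Nat.cast_injective (R := k))).mono h.level_le_eigenspace, h.iSup_level⟩

/-- Linear maps can be prescribed on each level. -/
theorem exists_linearMap (h : IsSystem a a' G) {M : Type*} [AddCommGroup M] [Module k M]
    (Ψ : ℕ → X →ₗ[k] M) : ∃ φ : X →ₗ[k] M, ∀ n, ∀ x ∈ level a' G n, φ x = Ψ n x := by
  classical
  let e := LinearEquiv.ofBijective (DirectSum.coeLinearMap (level a' G)) h.isInternal_level
  refine ⟨DirectSum.toModule k ℕ M (fun n => Ψ n ∘ₗ (level a' G n).subtype) ∘ₗ e.symm.toLinearMap,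
    fun n x hx => ?_⟩
  have : e.symm x = DirectSum.lof k ℕ (fun n => level a' G n) n ⟨x, hx⟩ := by
    rw [LinearEquiv.symm_apply_eq]
    exact (DirectSum.coeLinearMap_lof (level a' G) n ⟨x, hx⟩).symm
  simp [this]

theorem ext_level (h : IsSystem a a' G) {M : Type*} [AddCommGroup M] [Module k M]
    {φ ψ : X →ₗ[k] M} (hφ : ∀ n, ∀ x ∈ level a' G n, φ x = ψ x) : φ = ψ := by
  have : ⨆ n, level a' G n ≤ LinearMap.eqLocus φ ψ := iSup_le hφ
  rw [h.iSup_level] at this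
  ext x
  exact this trivial

/-- The eigenspaces for natural numbers already span everything, so by independence the eigenspace
for -c is zero. -/
theorem eq_zero_of_number_eq (h : IsSystem a a' G) (c : ℕ) (hc : c ≠ 0) {x : X}
    (hx : number a a' x + (c : k) • x = 0) : x = 0 := by
  have h1 := (Module.End.eigenspaces_iSupIndep (number a a')) (-(c : k))
  refine (Submodule.disjoint_def.1 h1) x ?_ ?_
  · rw [Module.End.mem_eigenspace_iff, neg_smul, eq_neg_iff_add_eq_zero, hx]
  · have : (⊤ : Submodule k X) ≤ ⨆ μ, ⨆ (_ : μ ≠ -(c : k)), Module.End.eigenspace (number a a') μ := by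
      rw [← h.iSup_level]
      refine iSup_le fun n => (h.level_le_eigenspace n).trans ?_
      refine le_iSup₂_of_le (n : k) ?_ le_rfl
      rw [Ne, eq_neg_iff_add_eq_zero]
      exact_mod_cast (by omega : n + c ≠ 0)
    exact this trivial

theorem mem_of_number_eq_zero (h : IsSystem a a' G) {x : X} (hx : number a a' x = 0) : x ∈ G := by
  have h1 := (Module.End.eigenspaces_iSupIndep (number a a')) (0 : k)
  have h2 : x ∈ G ⊔ ⨆ n, level a' G (n + 1) := by
    have : (⊤ : Submodule k X) ≤ G ⊔ ⨆ n, level a' G (n + 1) := by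
      rw [← h.iSup_level]
      refine iSup_le fun n => ?_
      cases n with
      | zero => exact le_sup_left
      | succ n => exact le_sup_of_le_right (le_iSup (fun n => level a' G (n + 1)) n)
    exact this trivial
  obtain ⟨y, hy, z, hz, rfl⟩ := Submodule.mem_sup.1 h2
  have hy' : number a a' y = 0 := by simpa using h.number_eq 0 hy
  rw [map_add, hy', zero_add] at hx
  have : z = 0 := by
    refine (Submodule.disjoint_def.1 h1) z ?_ ?_
    · rw [Module.End.mem_eigenspace_iff, hx, zero_smul]
    · have : ⨆ n, level a' G (n + 1) ≤
          ⨆ μ, ⨆ (_ : μ ≠ (0 : k)), Module.End.eigenspace (number a a') μ := by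
        refine iSup_le fun n => (h.level_le_eigenspace (n + 1)).trans ?_
        exact le_iSup₂_of_le ((n + 1 : ℕ) : k) (by exact_mod_cast n.succ_ne_zero) le_rfl
      exact this hz
  simpa [this] using hy

/-- The operator `φ ↦ ∑ j, l j ∘ φ ∘ a j - φ ∘ number - c φ` is invertible for `c ≠ 0`. -/
theorem exists_inverse (h : IsSystem a a' G) {M : Type*} [AddCommGroup M] [Module k M]
    (l : J → M →ₗ[k] M) (c : ℕ) (hc : c ≠ 0) (T : (X →ₗ[k] M) →ₗ[k] X →ₗ[k] M)
    (hT : ∀ φ x, T φ x = ∑ j, l j (φ (a j x)) - φ (number a a' x) - (c : k) • φ x) :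
    Function.Bijective T := by
  have hck : ∀ n : ℕ, ((n + c : ℕ) : k) ≠ 0 := fun n => by exact_mod_cast (by omega : n + c ≠ 0)
  constructor
  · rw [injective_iff_map_eq_zero]
    intro φ hφ
    refine h.ext_level fun n => ?_
    -- The operator is triangular for the grading by levels: its diagonal part on level n is -(n +
    -- c), and the other terms involve φ only on level n - 1.
    have key : ∀ n, ∀ x ∈ level a' G n, ((n + c : ℕ) : k) • φ x = ∑ j, l j (φ (a j x)) := by
      intro n x hx
      have := hT φ x
      rw [hφ, h.number_eq n hx, map_smul, LinearMap.zero_apply] at this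
      rw [Nat.cast_add, add_smul, ← sub_eq_zero, ← neg_eq_zero, this]
      abel
    induction n with
    | zero =>
      intro x hx
      have := key 0 x hx
      simp only [h.vacuum _ x hx, map_zero, Finset.sum_const_zero] at this
      exact (smul_eq_zero.1 this).resolve_left (hck 0)
    | succ n ih =>
      intro x hx
      have := key _ x hx
      simp only [ih _ (h.lower_mem n hx _), LinearMap.zero_apply, map_zero,
        Finset.sum_const_zero] at this
      exact (smul_eq_zero.1 this).resolve_left (hck _)
  · intro ψ
    -- The triangular system is solved level by level; the n-th map matters only on level n.
    let Ψ : ℕ → X →ₗ[k] M := fun n => Nat.rec (-(c : k)⁻¹ • ψ)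
      (fun n Θ => ((n + 1 + c : ℕ) : k)⁻¹ • (∑ j, l j ∘ₗ Θ ∘ₗ a j - ψ)) n
    obtain ⟨φ, hφ⟩ := h.exists_linearMap Ψ
    refine ⟨φ, h.ext_level fun n x hx => ?_⟩
    rw [hT, h.number_eq n hx, map_smul, sub_sub, ← add_smul, ← Nat.cast_add, hφ n x hx]
    cases n with
    | zero =>
      have hc' := hck 0
      rw [zero_add] at hc' ⊢
      simp [Ψ, h.vacuum _ x hx, smul_smul, hc']
    | succ n =>
      have h1 : ∀ j, φ (a j x) = Ψ n (a j x) := fun j => hφ n _ (h.lower_mem n hx j)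
      have h2 : Ψ (n + 1) x = ((n + 1 + c : ℕ) : k)⁻¹ • (∑ j, l j (Ψ n (a j x)) - ψ x) := by
        simp [Ψ]
      simp only [h1, h2, smul_smul, mul_inv_cancel₀ (hck (n + 1)), one_smul]
      abel

end IsSystem

end Oscillator

/-! ### Operators on the Weyl algebra -/

namespace WeylAlgebra

variable {V : Type u} [AddCommGroup V] [Module ℂ V] (ω : V →ₗ[ℂ] V →ₗ[ℂ] ℂ)

/-- Left multiplication by vectors. -/
def opL : V →ₗ[ℂ] WeylAlgebra ω →ₗ[ℂ] WeylAlgebra ω := LinearMap.mul ℂ _ ∘ₗ ι ω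

/-- Right multiplication by vectors. -/
def opR : V →ₗ[ℂ] WeylAlgebra ω →ₗ[ℂ] WeylAlgebra ω := (LinearMap.mul ℂ _).flip ∘ₗ ι ω

/-- The commutator with a vector. -/
def opAd : V →ₗ[ℂ] WeylAlgebra ω →ₗ[ℂ] WeylAlgebra ω := opL ω - opR ω

/-- The symmetrized multiplication by a vector. -/
def opM : V →ₗ[ℂ] WeylAlgebra ω →ₗ[ℂ] WeylAlgebra ω := (2⁻¹ : ℂ) • (opL ω + opR ω)

variable {ω}

theorem opL_apply (x : V) (a : WeylAlgebra ω) : opL ω x a = ι ω x * a := rfl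

theorem opR_apply (x : V) (a : WeylAlgebra ω) : opR ω x a = a * ι ω x := rfl

theorem opAd_apply (x : V) (a : WeylAlgebra ω) : opAd ω x a = opL ω x a - opR ω x a := rfl

theorem opM_apply (x : V) (a : WeylAlgebra ω) :
    opM ω x a = (2⁻¹ : ℂ) • (opL ω x a + opR ω x a) := rfl

theorem opL_opL (x y : V) (a : WeylAlgebra ω) :
    opL ω x (opL ω y a) = opL ω y (opL ω x a) + ω x y • a := by
  simp only [opL_apply, ← mul_assoc]
  rw [← sub_eq_iff_eq_add', ← sub_mul, ι_comm, Algebra.smul_def]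

theorem opR_opR (x y : V) (a : WeylAlgebra ω) :
    opR ω x (opR ω y a) = opR ω y (opR ω x a) - ω x y • a := by
  simp only [opR_apply, mul_assoc]
  rw [eq_sub_iff_add_eq, ← eq_sub_iff_add_eq', ← mul_sub, ι_comm, Algebra.smul_def,
    Algebra.commutes]

theorem opL_opR (x y : V) (a : WeylAlgebra ω) : opL ω x (opR ω y a) = opR ω y (opL ω x a) := by
  simp only [opR_apply, opL_apply, mul_assoc]

theorem opAd_one (x : V) : opAd ω x 1 = 0 := by
  simp [opAd_apply, opL_apply, opR_apply]

theorem opAd_opAd (x y : V) (a : WeylAlgebra ω) :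
    opAd ω x (opAd ω y a) = opAd ω y (opAd ω x a) := by
  simp only [opAd_apply, map_sub, opL_opL x y, opR_opR x y, opL_opR]
  abel

/-- Together with `opAd_opAd` and `opM_opM` this is the symmetrization picture of the Weyl algebra:
symmetrized multiplications act like multiplications by linear functions, and commutators like
constant vector fields. -/
theorem opAd_opM (x y : V) (a : WeylAlgebra ω) :
    opAd ω x (opM ω y a) = opM ω y (opAd ω x a) + ω x y • a := by
  simp only [opAd_apply, opM_apply, map_sub, map_add, map_smul, opL_opL x y, opR_opR x y, opL_opR]
  module

theorem opM_opM (x y : V) (a : WeylAlgebra ω) :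
    opM ω x (opM ω y a) = opM ω y (opM ω x a) := by
  simp only [opM_apply, map_add, map_smul, opL_opL x y, opR_opR x y, opL_opR]
  module

theorem opL_eq (x : V) (a : WeylAlgebra ω) :
    opL ω x a = opM ω x a + (2⁻¹ : ℂ) • opAd ω x a := by
  simp only [opM_apply, opAd_apply]
  module

/-- A subspace that contains `1` and is stable under left multiplication by vectors is everything. -/
theorem eq_top_of_opL_mem (S : Submodule ℂ (WeylAlgebra ω)) (h1 : 1 ∈ S)
    (h : ∀ x, ∀ a ∈ S, opL ω x a ∈ S) : S = ⊤ := by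
  suffices H : ∀ t : TensorAlgebra ℂ V, ∀ a ∈ S, RingQuot.mkAlgHom ℂ (WeylRel ω) t * a ∈ S by
    rw [eq_top_iff]
    intro a _
    obtain ⟨t, rfl⟩ := RingQuot.mkAlgHom_surjective ℂ (WeylRel ω) a
    simpa using H t 1 h1
  intro t
  induction t using TensorAlgebra.induction with
  | algebraMap c =>
    intro a ha
    rw [AlgHom.commutes, ← Algebra.smul_def]
    exact S.smul_mem c ha
  | ι x => exact h x
  | mul s t hs ht =>
    intro a ha
    rw [map_mul, mul_assoc]
    exact hs _ (ht a ha)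
  | add s t hs ht =>
    intro a ha
    rw [map_add, add_mul]
    exact add_mem (hs a ha) (ht a ha)

/-- The operators p ↦ X(v)p + δ_v(p) on P satisfy the Weyl relations: each of the two mixed terms of
a commutator contributes half of ω(x, y). The Weyl algebra thus acts on a nonzero space. -/
theorem nontrivial_of_derivations (hω : ω.IsAlt) {P : Type} [CommRing P] [Nontrivial P]
    [Algebra ℂ P] (X : V →ₗ[ℂ] P) (δ : V →ₗ[ℂ] Derivation ℂ P P)
    (h : ∀ v w, δ v (X w) = algebraMap ℂ P ((2⁻¹ : ℂ) * ω v w))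
    (hδ : ∀ v w p, δ v (δ w p) = δ w (δ v p)) : Nontrivial (WeylAlgebra ω) := by
  let ρ : V →ₗ[ℂ] Module.End ℂ P :=
    { toFun := fun v => LinearMap.mulLeft ℂ (X v) + (δ v).toLinearMap
      map_add' := fun v w => by
        ext p
        simp only [LinearMap.add_apply, LinearMap.mulLeft_apply, Derivation.coeFn_coe, map_add,
          Derivation.add_apply, add_mul]
        abel
      map_smul' := fun c v => by
        ext p
        simp }
  have hρ : ∀ v p, ρ v p = X v * p + δ v p := fun v p => rfl
  let F : WeylAlgebra ω →ₐ[ℂ] Module.End ℂ P :=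
    RingQuot.liftAlgHom ℂ ⟨TensorAlgebra.lift ℂ ρ, by
      rintro _ _ ⟨x, y⟩
      ext p
      have hxy : ω y x = - ω x y := by rw [← hω.neg]
      simp only [map_sub, map_mul, TensorAlgebra.lift_ι_apply, LinearMap.sub_apply,
        Module.End.mul_apply, hρ, map_add, Derivation.leibniz, h, hδ y x, hxy, AlgHom.commutes,
        Module.algebraMap_end_apply, smul_eq_mul, mul_neg, map_neg, map_mul]
      have h2 : algebraMap ℂ P (ω x y) = 2 * (algebraMap ℂ P 2⁻¹ * algebraMap ℂ P (ω x y)) := by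
        rw [← mul_assoc, ← map_ofNat (algebraMap ℂ P) 2, ← map_mul, mul_inv_cancel₀ two_ne_zero,
          map_one, one_mul]
      rw [Algebra.smul_def]
      linear_combination (-p) * h2⟩
  exact F.toRingHom.domain_nontrivial

/-- The Weyl algebra is nonzero: it acts on polynomials. -/
theorem nontrivial_of_finiteDimensional [FiniteDimensional ℂ V] (hω : ω.IsAlt) :
    Nontrivial (WeylAlgebra ω) := by
  let b := Module.finBasis ℂ V
  let δ : V →ₗ[ℂ] Derivation ℂ (MvPolynomial (Fin (Module.finrank ℂ V)) ℂ)
      (MvPolynomial (Fin (Module.finrank ℂ V)) ℂ) :=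
    { toFun := MvPolynomial.mkDerivation ℂ
      map_add' := fun f g => MvPolynomial.derivation_ext fun i => by
        simp [MvPolynomial.mkDerivation_X]
      map_smul' := fun c f => MvPolynomial.derivation_ext fun i => by
        simp [MvPolynomial.mkDerivation_X] } ∘ₗ
    LinearMap.pi fun i => Algebra.linearMap ℂ _ ∘ₗ ((2⁻¹ : ℂ) • ω.flip (b i))
  have hδ : ∀ v i, δ v (MvPolynomial.X i) = algebraMap ℂ _ ((2⁻¹ : ℂ) * ω v (b i)) := fun v i =>
    MvPolynomial.mkDerivation_X ℂ _ i
  refine nontrivial_of_derivations hω (b.constr ℂ fun i => MvPolynomial.X i) δ (fun v w => ?_)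
    fun v w p => ?_
  · have : (δ v).toLinearMap ∘ₗ (b.constr ℂ fun i => MvPolynomial.X i) =
        (Algebra.linearMap ℂ _) ∘ₗ ((2⁻¹ : ℂ) • ω v) :=
      b.ext fun i => by
        simp only [LinearMap.comp_apply, Module.Basis.constr_basis]
        exact hδ v i
    exact LinearMap.congr_fun this w
  · have : ⁅δ v, δ w⁆ = 0 := MvPolynomial.derivation_ext fun i => by
      simp [Derivation.commutator_apply, hδ]
    have := congr_arg (fun D => D p) this
    simpa [Derivation.commutator_apply, sub_eq_zero] using this

end WeylAlgebra

/-! ### Dual bases for the symplectic form -/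

namespace WeylAlgebra

variable {V : Type u} [AddCommGroup V] [Module ℂ V] {ω : V →ₗ[ℂ] V →ₗ[ℂ] ℂ}
  {J : Type*} [Fintype J] [DecidableEq J]

theorem sum_dual_smul (b : Module.Basis J ℂ V) {c : J → V}
    (h : ∀ i j, ω (c i) (b j) = if i = j then 1 else 0) (x : V) : ∑ j, ω (c j) x • b j = x := by
  have : ∑ j, (ω (c j)).smulRight (b j) = LinearMap.id := b.ext fun i => by
    simp [h]
  simpa using LinearMap.congr_fun this x

/-- Expanding c_j in the basis b gives antisymmetric coefficients ω(c_i, c_j), contracted with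
commuting operators. This allows symmetrized multiplications to be exchanged for left
multiplications in the number operator. -/
theorem sum_opAd_opAd (hω : ω.IsAlt) (b : Module.Basis J ℂ V) {c : J → V}
    (h : ∀ i j, ω (c i) (b j) = if i = j then 1 else 0) (a : WeylAlgebra ω) :
    ∑ j, opAd ω (b j) (opAd ω (c j) a) = 0 := by
  have h1 : ∑ j, opAd ω (b j) (opAd ω (c j) a) =
      ∑ j, ∑ i, ω (c i) (c j) • opAd ω (b j) (opAd ω (b i) a) := by
    refine Finset.sum_congr rfl fun j _ => ?_
    conv_lhs => rw [← sum_dual_smul b h (c j)]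
    simp
  suffices h2 : ∑ j, opAd ω (b j) (opAd ω (c j) a) = -∑ j, opAd ω (b j) (opAd ω (c j) a) by
    rw [eq_neg_iff_add_eq_zero, ← two_smul ℂ] at h2
    exact (smul_eq_zero.1 h2).resolve_left two_ne_zero
  conv_lhs => rw [h1, Finset.sum_comm]
  rw [h1, ← Finset.sum_neg_distrib]
  refine Finset.sum_congr rfl fun j _ => ?_
  rw [← Finset.sum_neg_distrib]
  refine Finset.sum_congr rfl fun i _ => ?_
  rw [opAd_opAd, ← hω.neg, neg_smul]

theorem sum_opM_opAd (hω : ω.IsAlt) (b : Module.Basis J ℂ V) {c : J → V}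
    (h : ∀ i j, ω (c i) (b j) = if i = j then 1 else 0) (a : WeylAlgebra ω) :
    ∑ j, opM ω (b j) (opAd ω (c j) a) = ∑ j, opL ω (b j) (opAd ω (c j) a) := by
  simp only [opL_eq, Finset.sum_add_distrib, ← Finset.smul_sum]
  rw [sum_opAd_opAd hω b h, smul_zero, add_zero]

theorem opAd_opL (x y : V) (a : WeylAlgebra ω) :
    opAd ω x (opL ω y a) = opL ω y (opAd ω x a) + ω x y • a := by
  simp only [opAd_apply, map_sub, opL_opL x y, opL_opR]
  abel

theorem exists_dual [FiniteDimensional ℂ V] (hω : ω.Nondegenerate) (b : Module.Basis J ℂ V) :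
    ∃ c : Module.Basis J ℂ V, ∀ i j, ω (c i) (b j) = if i = j then 1 else 0 :=
  ⟨LinearMap.BilinForm.dualBasis ω hω b, fun i j => by
    rw [LinearMap.BilinForm.apply_dualBasis_left]
    simp [eq_comm]⟩

end WeylAlgebra

/-! ### The semidirect product as an oscillator space, and acyclicity of coinduced Koszul complexes
-/

namespace SymplecticAction

open Hochschild WeylAlgebra SkewMonoidAlgebra

variable (D : SymplecticAction.{u, v})

/-- The vectors, as elements of `G ⋉ Weyl(V)`. -/
def vec : D.V →ₗ[ℂ] D.Semidirect := lsingle ℂ 1 ∘ₗ WeylAlgebra.ι D.ω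

/-- The group elements, as elements of `G ⋉ Weyl(V)`. -/
def grp : D.G →* D.Semidirect := of D.Weyl D.G

variable {D}

theorem smul_ι (g : D.G) (x : D.V) : g • WeylAlgebra.ι D.ω x = WeylAlgebra.ι D.ω (D.ρ g x) := by
  rw [smul_def, map_ι]

theorem vec_mul_single (x : D.V) (g : D.G) (a : D.Weyl) :
    D.vec x * single g a = single g (opL D.ω x a) := by
  simp [vec, lsingle_apply, single_mul_single, opL_apply]

theorem single_mul_vec (x : D.V) (g : D.G) (a : D.Weyl) :
    single g a * D.vec x = single g (opR D.ω (D.ρ g x) a) := by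
  simp [vec, lsingle_apply, single_mul_single, opR_apply, smul_ι]

theorem vec_mul_vec (x y : D.V) :
    D.vec x * D.vec y - D.vec y * D.vec x = algebraMap ℂ D.Semidirect (D.ω x y) := by
  simp only [vec, LinearMap.comp_apply, lsingle_apply, single_mul_single, one_smul, mul_one,
    coe_algebraMap, Function.comp_apply, ← ι_comm]
  rw [← lsingle_apply (R := ℂ), ← lsingle_apply (R := ℂ), ← map_sub, lsingle_apply]

theorem grp_mul_vec (g : D.G) (x : D.V) :
    D.grp g * D.vec x = D.vec (D.ρ g x) * D.grp g := by
  simp [grp, of_apply, single_mul_vec, vec_mul_single, opL_apply, opR_apply]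

/-- A subspace of `G ⋉ Weyl(V)` that contains `G` and is stable under left multiplication by
vectors is everything. -/
theorem eq_top_of_vec_mul_mem (S : Submodule ℂ D.Semidirect) (h1 : ∀ g, D.grp g ∈ S)
    (h : ∀ x, ∀ b ∈ S, D.vec x * b ∈ S) : S = ⊤ := by
  have key : ∀ g : D.G, S.comap (lsingle ℂ g) = ⊤ := fun g =>
    eq_top_of_opL_mem _ (h1 g) fun x a ha => by
      have := h x _ ha
      rwa [lsingle_apply, vec_mul_single] at this
  rw [eq_top_iff]
  intro b _
  induction b using SkewMonoidAlgebra.induction_on with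
  | zero => exact zero_mem _
  | single g a =>
    have : a ∈ S.comap (lsingle ℂ g) := by rw [key]; trivial
    exact this
  | add x y hx hy => exact add_mem (hx trivial) (hy trivial)

/-- The coefficientwise action of an operator of `Weyl(V)` on `G ⋉ Weyl(V)`. -/
def coeffwise (T : D.Weyl →ₗ[ℂ] D.Weyl) : D.Semidirect →ₗ[ℂ] D.Semidirect :=
  coeffLinearEquiv.symm.toLinearMap ∘ₗ Finsupp.mapRange.linearMap T ∘ₗ coeffLinearEquiv.toLinearMap

@[simp]
theorem coeffwise_single (T : D.Weyl →ₗ[ℂ] D.Weyl) (g : D.G) (a : D.Weyl) :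
    coeffwise T (single g a) = single g (T a) := by
  change coeffLinearEquiv.symm (Finsupp.mapRange.linearMap T (Finsupp.single g a)) = _
  simp
  rfl

theorem linearMap_ext {M : Type*} [AddCommGroup M] [Module ℂ M] {φ ψ : D.Semidirect →ₗ[ℂ] M}
    (h : ∀ (g : D.G) (a : D.Weyl), φ (single g a) = ψ (single g a)) (b : D.Semidirect) :
    φ b = ψ b :=
  LinearMap.congr_fun (lhom_ext h) b

theorem coeffwise_opL (x : D.V) (b : D.Semidirect) : coeffwise (opL D.ω x) b = D.vec x * b :=
  linearMap_ext (ψ := LinearMap.mulLeft ℂ (D.vec x)) (fun g a => by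
    simp [vec_mul_single]) b

/-- The operators act on the Weyl coefficients only, so G ⋉ Weyl(V) is a sum of copies of Weyl(V)
indexed by G, and the vacuum space is spanned by the group elements. Left multiplications are
recovered as symmetrized multiplication plus half a commutator, which gives generation. -/
theorem isSystem {J : Type*} [Fintype J] [DecidableEq J] (b c : Module.Basis J ℂ D.V)
    (h : ∀ i j, D.ω (c i) (b j) = if i = j then 1 else 0) :
    Oscillator.IsSystem (fun j => coeffwise (opAd D.ω (c j))) (fun j => coeffwise (opM D.ω (b j)))
      (Submodule.span ℂ (Set.range D.grp)) where
  lower_raise i j x := by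
    refine linearMap_ext (φ := coeffwise (opAd D.ω (c i)) ∘ₗ coeffwise (opM D.ω (b j)))
      (ψ := coeffwise (opM D.ω (b j)) ∘ₗ coeffwise (opAd D.ω (c i)) +
        if i = j then LinearMap.id else 0) (fun g a => ?_) x |>.trans ?_
    · simp only [LinearMap.comp_apply, coeffwise_single, opAd_opM, h, LinearMap.add_apply]
      split_ifs <;> simp [single_add]
    · split_ifs <;> simp
  raise_comm i j x :=
    linearMap_ext (φ := coeffwise (opM D.ω (b i)) ∘ₗ coeffwise (opM D.ω (b j)))
      (ψ := coeffwise (opM D.ω (b j)) ∘ₗ coeffwise (opM D.ω (b i))) (fun g a => by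
        simp [opM_opM (b i)]) x
  vacuum i x hx := by
    suffices Submodule.span ℂ (Set.range D.grp) ≤ LinearMap.ker (coeffwise (opAd D.ω (c i))) from
      this hx
    rw [Submodule.span_le]
    rintro _ ⟨g, rfl⟩
    simp [grp, of_apply, opAd_one]
  generates S h1 h2 h3 := by
    have hspan : ∀ (b : Module.Basis J ℂ D.V) (F : D.V →ₗ[ℂ] D.Weyl →ₗ[ℂ] D.Weyl),
        (∀ i, ∀ x ∈ S, coeffwise (F (b i)) x ∈ S) → ∀ v, ∀ x ∈ S, coeffwise (F v) x ∈ S := by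
      intro b F hF v x hx
      have : coeffwise (F v) x = ∑ i, b.repr v i • coeffwise (F (b i)) x := by
        conv_lhs => rw [← b.sum_repr v]
        refine linearMap_ext (φ := coeffwise (F (∑ i, b.repr v i • b i)))
          (ψ := ∑ i, b.repr v i • coeffwise (F (b i))) (fun g a => ?_) x |>.trans (by simp)
        simp only [coeffwise_single, _root_.map_sum, map_smul, LinearMap.sum_apply, LinearMap.smul_apply]
        simp only [← lsingle_apply (R := ℂ), _root_.map_sum, map_smul]
      rw [this]
      exact sum_mem fun i _ => S.smul_mem _ (hF i x hx)
    refine eq_top_of_vec_mul_mem S (fun g => h1 (Submodule.subset_span ⟨g, rfl⟩)) fun v x hx => ?_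
    have : D.vec v * x = coeffwise (opM D.ω v) x + (2⁻¹ : ℂ) • coeffwise (opAd D.ω v) x := by
      rw [← coeffwise_opL]
      refine linearMap_ext (ψ := coeffwise (opM D.ω v) + (2⁻¹ : ℂ) • coeffwise (opAd D.ω v))
        (fun g a => ?_) x
      simp only [coeffwise_single, opL_eq, LinearMap.add_apply, LinearMap.smul_apply, single_add,
        smul_single]
    rw [this]
    exact add_mem (hspan b (opM D.ω) h3 v x hx) (S.smul_mem _ (hspan c (opAd D.ω) h2 v x hx))

theorem coeffwise_opAd_vec_mul (w x : D.V) (b : D.Semidirect) :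
    coeffwise (opAd D.ω w) (D.vec x * b) =
      D.vec x * coeffwise (opAd D.ω w) b + D.ω w x • b := by
  rw [← coeffwise_opL, ← coeffwise_opL]
  exact linearMap_ext (φ := coeffwise (opAd D.ω w) ∘ₗ coeffwise (opL D.ω x))
    (ψ := coeffwise (opL D.ω x) ∘ₗ coeffwise (opAd D.ω w) + D.ω w x • LinearMap.id)
    (fun g a => by
      simp only [LinearMap.comp_apply, coeffwise_single, LinearMap.add_apply,
        LinearMap.smul_apply, LinearMap.id_apply, smul_single, ← single_add, opAd_opL]) b

variable {M : Type max u v} [AddCommGroup M] [Module ℂ M]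
  {N : Type max u v} [AddCommGroup N] [Module ℂ N]

/-- The commutator with vectors on a bimodule. -/
def ad (β : Bimodule ℂ D.Semidirect M) : D.V →ₗ[ℂ] M →ₗ[ℂ] M := (β.l - β.r) ∘ₗ D.vec

theorem ad_apply (β : Bimodule ℂ D.Semidirect M) (x : D.V) (m : M) :
    ad β x m = β.l (D.vec x) m - β.r (D.vec x) m := rfl

/-- The Weyl relation yields the scalar ω(x, y) once from the left action and once from the right
action, with opposite signs. -/
theorem ad_comm (β : Bimodule ℂ D.Semidirect M) (x y : D.V) (m : M) :
    ad β x (ad β y m) = ad β y (ad β x m) := by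
  have h1 : β.l (D.vec x * D.vec y) m - β.l (D.vec y * D.vec x) m = D.ω x y • m := by
    rw [← LinearMap.sub_apply, ← map_sub, vec_mul_vec, Algebra.algebraMap_eq_smul_one, map_smul,
      LinearMap.smul_apply, β.l_one]
  have h2 : β.r (D.vec x * D.vec y) m - β.r (D.vec y * D.vec x) m = D.ω x y • m := by
    rw [← LinearMap.sub_apply, ← map_sub, vec_mul_vec, Algebra.algebraMap_eq_smul_one, map_smul,
      LinearMap.smul_apply, β.r_one]
  rw [β.l_mul, β.l_mul] at h1
  rw [β.r_mul, β.r_mul, ← h1] at h2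
  simp only [ad_apply, map_sub, β.l_r]
  rw [← sub_eq_zero, ← neg_eq_zero, ← sub_eq_zero.2 h2]
  abel

/-- The Koszul complex of a coinduced bimodule is acyclic. -/
theorem mem_exact_of_coind (β : Bimodule ℂ D.Semidirect M) (n : ℕ)
    (κ : D.V [⋀^Fin (n + 1)]→ₗ[ℂ] (D.Semidirect →ₗ[ℂ] M))
    (hκ : Koszul.d (ad β.coind) (n + 1) κ = 0) : κ ∈ Koszul.exact (ad β.coind) (n + 1) := by
  let b := Module.finBasis ℂ D.V
  obtain ⟨c, hc⟩ := exists_dual D.nondegenerate b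
  have hs := isSystem b c hc
  -- The homotopy precomposes with the lowering operators of B. The resulting laplacian only acts on
  -- values, through `T n`.
  let H := fun j => LinearMap.lcomp ℂ M (coeffwise (opAd D.ω (c j)))
  let T : ℕ → (D.Semidirect →ₗ[ℂ] M) →ₗ[ℂ] D.Semidirect →ₗ[ℂ] M := fun n =>
    ∑ j, H j ∘ₗ ad β.coind (b j) - (n : ℂ) • LinearMap.id
  have hγ : ∀ x j φ, ad β.coind x (H j φ) = H j (ad β.coind x φ) + (-D.ω (c j) x) • φ := by
    intro x j φ
    refine LinearMap.ext fun y => ?_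
    simp only [H, ad_apply, LinearMap.sub_apply, LinearMap.add_apply, LinearMap.smul_apply,
      Bimodule.coind_l, Bimodule.coind_r, LinearMap.lcomp_apply, coeffwise_opAd_vec_mul, map_add,
      map_smul]
    module
  have hlap : ∀ (n : ℕ) (κ : D.V [⋀^Fin n]→ₗ[ℂ] (D.Semidirect →ₗ[ℂ] M)),
      Koszul.laplacian b H (ad β.coind) n κ = (T n).compAlternatingMap κ := by
    intro n κ
    ext1 x
    rw [Koszul.laplacian_apply hγ]
    -- Each argument of the form contributes -1; this produces the term -n in `T n`.
    have h1 : ∀ i, ∑ j, -D.ω (c j) (x i) • b j = (-1 : ℂ) • x i := by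
      intro i
      conv_rhs => rw [← sum_dual_smul b hc (x i)]
      simp [Finset.sum_neg_distrib]
    simp only [h1, AlternatingMap.map_update_smul, Function.update_eq_self]
    simp [T, sub_eq_add_neg, Nat.cast_smul_eq_nsmul]
  have hT : ∀ n ≠ 0, Function.Bijective (T n) := by
    intro n hn
    refine hs.exists_inverse (fun j => β.l (D.vec (b j))) n hn (T n) fun φ y => ?_
    -- The laplacian produces left multiplications by b_j, while the number operator uses
    -- symmetrized ones; their sums agree by `sum_opM_opAd`.
    have h2 : Oscillator.number (fun j => coeffwise (opAd D.ω (c j)))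
        (fun j => coeffwise (opM D.ω (b j))) y =
        ∑ j, D.vec (b j) * coeffwise (opAd D.ω (c j)) y := by
      refine linearMap_ext (ψ := ∑ j, LinearMap.mulLeft ℂ (D.vec (b j)) ∘ₗ
        coeffwise (opAd D.ω (c j))) (fun g a => ?_) y |>.trans (by simp)
      simp only [Oscillator.number_apply, coeffwise_single, LinearMap.sum_apply,
        LinearMap.comp_apply, LinearMap.mulLeft_apply, vec_mul_single]
      simp only [← lsingle_apply (R := ℂ), ← _root_.map_sum]
      rw [sum_opM_opAd D.alternating b hc]
    rw [h2]
    simp [T, H, ad_apply, Finset.sum_sub_distrib]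
  let S := (LinearEquiv.ofBijective (T (n + 1)) (hT _ n.succ_ne_zero)).symm
  have hS : ∀ φ, T (n + 1) (S φ) = φ :=
    (LinearEquiv.ofBijective (T (n + 1)) (hT _ n.succ_ne_zero)).apply_symm_apply
  let η := S.toLinearMap.compAlternatingMap κ
  have h1 : Koszul.laplacian b H (ad β.coind) (n + 1) η = κ := by
    rw [hlap]
    ext1 x
    exact hS (κ x)
  -- The laplacian commutes with the differential and is injective one degree higher, so the
  -- preimage η of the cocycle κ is again a cocycle, and the laplacian of a cocycle is exact.
  have h2 : Koszul.d (ad β.coind) (n + 1) η = 0 := by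
    have h3 := Koszul.laplacian_d (v := b) (H := H) (ad_comm β.coind) (n + 1) η
    rw [h1, hκ, hlap] at h3
    ext1 x
    exact (hT _ (n + 1).succ_ne_zero).1 (by
      rw [AlternatingMap.zero_apply, map_zero]
      exact AlternatingMap.congr_fun h3 x)
  rw [← h1]
  exact Koszul.laplacian_mem_exact (n + 1) h2

end SymplecticAction

/-! ### Comparison of Hochschild cohomology with the invariants of the Koszul complex -/

/-- Averaging a preimage over the group. This is how taking invariants preserves exactness
throughout. -/
theorem Representation.exists_invariant_preimage {G X Y : Type*} [Group G] [Finite G]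
    [AddCommGroup X] [Module ℂ X] [AddCommGroup Y] [Module ℂ Y] (ρ : Representation ℂ G X)
    (σ : Representation ℂ G Y) (F : X →ₗ[ℂ] Y) (hF : ∀ g x, F (ρ g x) = σ g (F x)) {x : X}
    (hx : ∀ g, σ g (F x) = F x) : ∃ y, (∀ g, ρ g y = y) ∧ F y = F x := by
  cases nonempty_fintype G
  refine ⟨(Fintype.card G : ℂ)⁻¹ • ∑ g, ρ g x, fun g => ?_, ?_⟩
  · rw [map_smul, map_sum]
    congr 1
    refine Fintype.sum_equiv (Equiv.mulLeft g) _ _ fun h => ?_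
    simp [map_mul]
  · have : (Fintype.card G : ℂ) ≠ 0 := Nat.cast_ne_zero.2 Fintype.card_ne_zero
    simp [hF, hx, ← Nat.cast_smul_eq_nsmul ℂ, smul_smul, this]

namespace SymplecticAction

open Hochschild Bimodule

variable {D : SymplecticAction.{u, v}} {M : Type max u v} [AddCommGroup M] [Module ℂ M]
  {N : Type max u v} [AddCommGroup N] [Module ℂ N]

theorem ad_hom {β : Bimodule ℂ D.Semidirect M} {γ : Bimodule ℂ D.Semidirect N} {τ : M →ₗ[ℂ] N}
    (h : β.IsHom γ AlgEquiv.refl τ) (x : D.V) (m : M) : τ (ad β x m) = ad γ x (τ m) := by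
  simp [ad_apply, h.l, h.r]

/-- Conjugation by group elements on a bimodule. -/
def conj (β : Bimodule ℂ D.Semidirect M) (g : D.G) : M →ₗ[ℂ] M :=
  β.l (D.grp g) ∘ₗ β.r (D.grp g⁻¹)

theorem conj_apply (β : Bimodule ℂ D.Semidirect M) (g : D.G) (m : M) :
    conj β g m = β.l (D.grp g) (β.r (D.grp g⁻¹) m) := rfl

theorem conj_hom {β : Bimodule ℂ D.Semidirect M} {γ : Bimodule ℂ D.Semidirect N} {τ : M →ₗ[ℂ] N}
    (h : β.IsHom γ AlgEquiv.refl τ) (g : D.G) (m : M) : τ (conj β g m) = conj γ g (τ m) := by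
  simp [conj_apply, h.l, h.r]

theorem conj_ad (β : Bimodule ℂ D.Semidirect M) (g : D.G) (x : D.V) (m : M) :
    conj β g (ad β x m) = ad β (D.ρ g x) (conj β g m) := by
  have h1 : D.vec x * D.grp g⁻¹ = D.grp g⁻¹ * D.vec (D.ρ g x) := by
    rw [grp_mul_vec, ← Module.End.mul_apply, ← map_mul, inv_mul_cancel, map_one,
      Module.End.one_apply]
  simp only [conj_apply, ad_apply, map_sub, ← β.l_mul, ← β.r_mul, ← β.l_r, grp_mul_vec, h1]

/-- The action of `G` on forms with values in a bimodule. -/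
def act (β : Bimodule ℂ D.Semidirect M) (n : ℕ) :
    Representation ℂ D.G (D.V [⋀^Fin n]→ₗ[ℂ] M) where
  toFun g := Koszul.pull (D.ρ g⁻¹) (conj β g) n
  map_one' := by
    ext κ x
    simp [conj_apply, β.l_one, β.r_one]
  map_mul' g h := by
    ext κ x
    simp [conj_apply, β.l_mul, β.r_mul, β.l_r]

theorem act_apply (β : Bimodule ℂ D.Semidirect M) (n : ℕ) (g : D.G) (κ : D.V [⋀^Fin n]→ₗ[ℂ] M)
    (x : Fin n → D.V) : act β n g κ x = conj β g (κ fun i => D.ρ g⁻¹ (x i)) := rfl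

theorem d_act (β : Bimodule ℂ D.Semidirect M) (n : ℕ) (g : D.G) (κ : D.V [⋀^Fin n]→ₗ[ℂ] M) :
    Koszul.d (ad β) n (act β n g κ) = act β (n + 1) g (Koszul.d (ad β) n κ) :=
  Koszul.d_pull (fun y m => by
    have h : D.ρ g (D.ρ g⁻¹ y) = y := by
      rw [← Module.End.mul_apply, ← map_mul, mul_inv_cancel, map_one, Module.End.one_apply]
    rw [conj_ad, h]) n κ

/-- Composition of forms with a linear map of the coefficients. -/
abbrev post (D : SymplecticAction.{u, v}) (τ : M →ₗ[ℂ] N) (n : ℕ) :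
    D.V [⋀^Fin n]→ₗ[ℂ] M →ₗ[ℂ] D.V [⋀^Fin n]→ₗ[ℂ] N :=
  Koszul.pull LinearMap.id τ n

theorem post_act {β : Bimodule ℂ D.Semidirect M} {γ : Bimodule ℂ D.Semidirect N} {τ : M →ₗ[ℂ] N}
    (h : β.IsHom γ AlgEquiv.refl τ) (n : ℕ) (g : D.G) (κ : D.V [⋀^Fin n]→ₗ[ℂ] M) :
    D.post τ n (act β n g κ) = act γ n g (D.post τ n κ) := by
  ext x
  simp [act_apply, conj_hom h]

theorem d_post {β : Bimodule ℂ D.Semidirect M} {γ : Bimodule ℂ D.Semidirect N} {τ : M →ₗ[ℂ] N}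
    (h : β.IsHom γ AlgEquiv.refl τ) (n : ℕ) (κ : D.V [⋀^Fin n]→ₗ[ℂ] M) :
    Koszul.d (ad γ) n (D.post τ n κ) = D.post τ (n + 1) (Koszul.d (ad β) n κ) :=
  Koszul.d_pull (fun y m => ad_hom h y m) n κ

theorem post_toCoind_injective (β : Bimodule ℂ D.Semidirect M) (n : ℕ) :
    Function.Injective (D.post β.toCoind n) := by
  intro κ κ' h
  ext x
  exact β.toCoind_injective (AlternatingMap.congr_fun h x)

theorem post_toCoker_post_toCoind (β : Bimodule ℂ D.Semidirect M) (n : ℕ)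
    (κ : D.V [⋀^Fin n]→ₗ[ℂ] M) : D.post β.toCoker n (D.post β.toCoind n κ) = 0 := by
  ext1 x
  simp

theorem exists_post_toCoind (β : Bimodule ℂ D.Semidirect M) (n : ℕ)
    (κ : D.V [⋀^Fin n]→ₗ[ℂ] (D.Semidirect →ₗ[ℂ] M)) (h : D.post β.toCoker n κ = 0) :
    ∃ κ', D.post β.toCoind n κ' = κ :=
  ⟨D.post evalOne n κ, by
    ext1 x
    exact (β.eq_toCoind_of_toCoker_eq_zero (AlternatingMap.congr_fun h x)).symm⟩

theorem exists_post_toCoker (β : Bimodule ℂ D.Semidirect M) (n : ℕ)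
    (κ : D.V [⋀^Fin n]→ₗ[ℂ] Coker ℂ D.Semidirect M) (hκ : ∀ g, act β.coker n g κ = κ) :
    ∃ ν, (∀ g, act β.coind n g ν = ν) ∧ D.post β.toCoker n ν = κ := by
  have h : D.post β.toCoker n (D.post (Submodule.subtype _) n κ) = κ := by
    ext1 x
    simp
  have := (act β.coind n).exists_invariant_preimage (act β.coker n) (D.post β.toCoker n)
    (fun g κ => post_act β.isHom_toCoker n g κ) (x := D.post (Submodule.subtype _) n κ)
    (by rwa [h])
  rwa [h] at this

theorem act_of_post_toCoind (β : Bimodule ℂ D.Semidirect M) (n : ℕ) (κ : D.V [⋀^Fin n]→ₗ[ℂ] M)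
    (h : ∀ g, act β.coind n g (D.post β.toCoind n κ) = D.post β.toCoind n κ) (g : D.G) :
    act β n g κ = κ :=
  post_toCoind_injective β n (by rw [post_act β.isHom_toCoind, h])

theorem exists_d_eq_of_coind (β : Bimodule ℂ D.Semidirect M) (n : ℕ)
    (κ : D.V [⋀^Fin (n + 1)]→ₗ[ℂ] (D.Semidirect →ₗ[ℂ] M))
    (hκ : Koszul.d (ad β.coind) (n + 1) κ = 0) (hg : ∀ g, act β.coind (n + 1) g κ = κ) :
    ∃ ν, (∀ g, act β.coind n g ν = ν) ∧ Koszul.d (ad β.coind) n ν = κ := by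
  obtain ⟨ν, rfl⟩ := mem_exact_of_coind β n κ hκ
  exact (act β.coind n).exists_invariant_preimage (act β.coind (n + 1)) _
    (fun g κ => d_act β.coind n g κ) hg

/-- The central elements of a bimodule. -/
def center (β : Bimodule ℂ D.Semidirect M) : Submodule ℂ M where
  carrier := {m | ∀ b, β.l b m = β.r b m}
  add_mem' h h' b := by simp [h b, h' b]
  zero_mem' b := by simp
  smul_mem' c m h b := by simp [h b]

/-- Vectors and group elements generate G ⋉ Weyl(V), so it suffices to commute with these. This is
the agreement of both theories in degree 0, where the dimension shift starts. -/
theorem mem_center_iff (β : Bimodule ℂ D.Semidirect M) (m : M) :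
    m ∈ center β ↔ (∀ x, ad β x m = 0) ∧ ∀ g, conj β g m = m := by
  constructor
  · intro h
    refine ⟨fun x => sub_eq_zero.2 (h _), fun g => ?_⟩
    rw [conj_apply, β.l_r, h, ← β.r_mul, ← map_mul, mul_inv_cancel, map_one, β.r_one]
  · rintro ⟨h1, h2⟩
    let S : Submodule ℂ D.Semidirect := LinearMap.eqLocus (β.l.flip m) (β.r.flip m)
    have hS : S = ⊤ := by
      refine eq_top_of_vec_mul_mem S (fun g => ?_) fun x b (hb : β.l b m = β.r b m) => ?_
      · have := congr_arg (β.r (D.grp g)) (h2 g)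
        rwa [conj_apply, ← β.l_r, ← β.r_mul, ← map_mul, inv_mul_cancel, map_one, β.r_one] at this
      · change β.l _ m = β.r _ m
        rw [β.l_mul, hb, β.l_r, sub_eq_zero.1 (h1 x), β.r_mul]
    intro b
    have : b ∈ S := by rw [hS]; trivial
    exact this

theorem d_zero_eq_zero_iff {k B : Type*} [CommRing k] [Ring B] [Algebra k B] {M : Type _}
    [AddCommGroup M] [Module k M] (β : Bimodule k B M) (f : Bimodule.Cochain k B M 0) :
    Bimodule.d 0 β f = 0 ↔ ∀ b, β.l b (f ![]) = β.r b (f ![]) := by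
  have h : ∀ x : Fin 0 → B, f x = f ![] := fun x => congr_arg f (Subsingleton.elim _ _)
  rw [← curry.map_eq_zero_iff, curry_d_zero]
  constructor
  · intro h b
    have := LinearMap.congr_fun (MultilinearMap.congr_fun h ![]) b
    exact (sub_eq_zero.1 this).symm
  · intro h'
    ext x b
    simp [h x, h']

theorem koszul_d_zero_eq_zero_iff (β : Bimodule ℂ D.Semidirect M) (κ : D.V [⋀^Fin 0]→ₗ[ℂ] M) :
    Koszul.d (ad β) 0 κ = 0 ↔ ∀ x, ad β x (κ ![]) = 0 := by
  have h : ∀ (x : D.V) (y : Fin 0 → D.V), ad β x (κ y) = ad β x (κ ![]) :=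
    fun x y => congr_arg (fun y => ad β x (κ y)) (Subsingleton.elim _ _)
  constructor
  · intro h' x
    have := AlternatingMap.congr_fun h' ![x]
    simpa [Koszul.d_apply, h] using this
  · intro h'
    ext x
    simp [Koszul.d_apply, h, h']

theorem act_zero_iff (β : Bimodule ℂ D.Semidirect M) (κ : D.V [⋀^Fin 0]→ₗ[ℂ] M) :
    (∀ g, act β 0 g κ = κ) ↔ ∀ g, conj β g (κ ![]) = κ ![] := by
  have h : ∀ y : Fin 0 → D.V, κ y = κ ![] := fun y => congr_arg κ (Subsingleton.elim _ _)
  refine forall_congr' fun g => ⟨fun h' => ?_, fun h' => ?_⟩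
  · have := AlternatingMap.congr_fun h' ![]
    rwa [act_apply, h] at this
  · ext x
    rw [act_apply, h, h x, h']

/-- The forms that are invariant cocycles of the Koszul complex. -/
def IsInvCocycle (β : Bimodule ℂ D.Semidirect M) (n : ℕ) (κ : D.V [⋀^Fin n]→ₗ[ℂ] M) : Prop :=
  Koszul.d (ad β) n κ = 0 ∧ ∀ g, act β n g κ = κ

/-- The differentials of invariant forms. -/
def invExact (β : Bimodule ℂ D.Semidirect M) : (n : ℕ) → Submodule ℂ (D.V [⋀^Fin n]→ₗ[ℂ] M)
  | 0 => ⊥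
  | n + 1 => (act β n).invariants.map (Koszul.d (ad β) n)

theorem mem_invExact_of_mem_exact (β : Bimodule ℂ D.Semidirect M) (n : ℕ)
    {κ : D.V [⋀^Fin n]→ₗ[ℂ] M} (hκ : κ ∈ Koszul.exact (ad β) n) (hg : ∀ g, act β n g κ = κ) :
    κ ∈ invExact β n := by
  cases n with
  | zero => exact hκ
  | succ n =>
    obtain ⟨ν, rfl⟩ := hκ
    exact (act β n).exists_invariant_preimage (act β (n + 1)) _ (fun g κ => d_act β n g κ) hg

/-- The relation between Hochschild cocycles and invariant Koszul cocycles that induces the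
isomorphism in cohomology; it is defined by dimension shifting along
`0 → M → Hom(B, M) → Coker → 0`. -/
def Rel (D : SymplecticAction.{u, v}) : (n : ℕ) → {M : Type max u v} → [AddCommGroup M] →
    [Module ℂ M] → Bimodule ℂ D.Semidirect M → Bimodule.Cochain ℂ D.Semidirect M n →
    D.V [⋀^Fin n]→ₗ[ℂ] M → Prop
  | 0, _, _, _, β, f, κ => f ![] ∈ center β ∧ κ ![] = f ![]
  | n + 1, _, _, _, β, f, κ => ∃ h ν, (∀ g, act β.coind n g ν = ν) ∧
      Bimodule.d n β.coind h = Bimodule.post β.toCoind (n + 1) f ∧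
      Koszul.d (ad β.coind) n ν = D.post β.toCoind (n + 1) κ ∧
      Rel D n β.coker (Bimodule.post β.toCoker n h) (D.post β.toCoker n ν)

namespace Rel

theorem smul_add {n : ℕ} {β : Bimodule ℂ D.Semidirect M} {f f' : Bimodule.Cochain ℂ D.Semidirect M n}
    {κ κ' : D.V [⋀^Fin n]→ₗ[ℂ] M} (h : D.Rel n β f κ) (h' : D.Rel n β f' κ') (c : ℂ) :
    D.Rel n β (c • f + f') (c • κ + κ') := by
  induction n generalizing M with
  | zero =>
    refine ⟨add_mem (Submodule.smul_mem _ c h.1) h'.1, ?_⟩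
    rw [AlternatingMap.add_apply, AlternatingMap.smul_apply, h.2, h'.2]
    rfl
  | succ n ih =>
    obtain ⟨p, ν, h1, h2, h3, h4⟩ := h
    obtain ⟨p', ν', h1', h2', h3', h4'⟩ := h'
    refine ⟨c • p + p', c • ν + ν', fun g => ?_, ?_, ?_, ?_⟩
    · rw [map_add, map_smul, h1, h1']
    · rw [map_add, map_smul, h2, h2', map_add, map_smul]
    · rw [map_add, map_smul, h3, h3', map_add, map_smul]
    · rw [map_add, map_smul, map_add, map_smul]
      exact ih h4 h4'

theorem d_eq_zero {n : ℕ} {β : Bimodule ℂ D.Semidirect M} {f : Bimodule.Cochain ℂ D.Semidirect M n}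
    {κ : D.V [⋀^Fin n]→ₗ[ℂ] M} (h : D.Rel n β f κ) : Bimodule.d n β f = 0 := by
  cases n with
  | zero => exact (d_zero_eq_zero_iff β f).2 h.1
  | succ n =>
    obtain ⟨p, ν, h1, h2, h3, h4⟩ := h
    apply Bimodule.post_toCoind_injective β
    rw [← Bimodule.d_post β.isHom_toCoind, ← h2, d_d, map_zero]

theorem isInvCocycle {n : ℕ} {β : Bimodule ℂ D.Semidirect M}
    {f : Bimodule.Cochain ℂ D.Semidirect M n} {κ : D.V [⋀^Fin n]→ₗ[ℂ] M} (h : D.Rel n β f κ) :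
    IsInvCocycle β n κ := by
  cases n with
  | zero =>
    have h1 : κ ![] ∈ center β := by rw [h.2]; exact h.1
    rw [mem_center_iff] at h1
    exact ⟨(koszul_d_zero_eq_zero_iff β κ).2 h1.1, (act_zero_iff β κ).2 h1.2⟩
  | succ n =>
    obtain ⟨p, ν, h1, h2, h3, h4⟩ := h
    refine ⟨?_, act_of_post_toCoind β _ κ fun g => ?_⟩
    · apply post_toCoind_injective β
      rw [← d_post β.isHom_toCoind, ← h3, Koszul.d_d (ad_comm _), map_zero]
    · rw [← h3, ← d_act, h1]

/-- Acyclicity of Hom(B, M) gives a primitive p of the cocycle, and the image of p in the cokernel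
is a cocycle of lower degree. The form related to it by induction lifts to an invariant form on
Hom(B, M), whose differential comes from M. -/
theorem exists_right {n : ℕ} (β : Bimodule ℂ D.Semidirect M)
    {f : Bimodule.Cochain ℂ D.Semidirect M n} (hf : Bimodule.d n β f = 0) :
    ∃ κ, D.Rel n β f κ := by
  induction n generalizing M with
  | zero =>
    exact ⟨AlternatingMap.constOfIsEmpty ℂ D.V (Fin 0) (f ![]), (d_zero_eq_zero_iff β f).1 hf, rfl⟩
  | succ n ih =>
    obtain ⟨p, hp⟩ := Bimodule.exists_d_eq_of_coind n β (Bimodule.post β.toCoind (n + 1) f)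
      (by rw [Bimodule.d_post β.isHom_toCoind, hf, map_zero])
    obtain ⟨μ, hμ⟩ := ih β.coker (f := Bimodule.post β.toCoker n p)
      (by rw [Bimodule.d_post β.isHom_toCoker, hp, Bimodule.post_toCoker_post_toCoind])
    obtain ⟨ν, hν, rfl⟩ := exists_post_toCoker β n μ hμ.isInvCocycle.2
    obtain ⟨κ, hκ⟩ := exists_post_toCoind β (n + 1) (Koszul.d (ad β.coind) n ν)
      (by rw [← d_post β.isHom_toCoker, hμ.isInvCocycle.1])
    exact ⟨κ, p, ν, hν, hp, hκ.symm, hμ⟩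

/-- The same shift with the roles exchanged. Here acyclicity of the invariant Koszul complex of
Hom(B, M) is needed. -/
theorem exists_left {n : ℕ} (β : Bimodule ℂ D.Semidirect M) {κ : D.V [⋀^Fin n]→ₗ[ℂ] M}
    (hκ : IsInvCocycle β n κ) : ∃ f, D.Rel n β f κ := by
  induction n generalizing M with
  | zero =>
    refine ⟨MultilinearMap.constOfIsEmpty ℂ _ (κ ![]), ?_, rfl⟩
    exact (mem_center_iff β _).2
      ⟨(koszul_d_zero_eq_zero_iff β κ).1 hκ.1, (act_zero_iff β κ).1 hκ.2⟩
  | succ n ih =>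
    obtain ⟨ν, hν, hν'⟩ := exists_d_eq_of_coind β n (D.post β.toCoind (n + 1) κ)
      (by rw [d_post β.isHom_toCoind, hκ.1, map_zero])
      (fun g => by rw [← post_act β.isHom_toCoind, hκ.2])
    obtain ⟨q, hq⟩ := ih β.coker (κ := D.post β.toCoker n ν)
      ⟨by rw [d_post β.isHom_toCoker, hν', post_toCoker_post_toCoind],
        fun g => by rw [← post_act β.isHom_toCoker, hν]⟩
    obtain ⟨p, rfl⟩ := Bimodule.exists_post_toCoker β q
    obtain ⟨f, hf⟩ := Bimodule.exists_post_toCoind β (Bimodule.d n β.coind p)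
      (by rw [← Bimodule.d_post β.isHom_toCoker, hq.d_eq_zero])
    exact ⟨f, p, ν, hν, hf.symm, hν', hq⟩

end Rel

end SymplecticAction

/-! ### Boundaries correspond to boundaries -/

namespace SymplecticAction

open Hochschild Bimodule

variable {D D' : SymplecticAction.{u, v}} {M : Type max u v} [AddCommGroup M] [Module ℂ M]
  {N : Type max u v} [AddCommGroup N] [Module ℂ N]

theorem isInvCocycle_zero_iff (β : Bimodule ℂ D.Semidirect M) (κ : D.V [⋀^Fin 0]→ₗ[ℂ] M) :
    IsInvCocycle β 0 κ ↔ κ ![] ∈ center β := by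
  rw [mem_center_iff, IsInvCocycle, koszul_d_zero_eq_zero_iff, act_zero_iff]

namespace Rel

theorem mem_invExact {n : ℕ} {β : Bimodule ℂ D.Semidirect M}
    {f : Bimodule.Cochain ℂ D.Semidirect M n} {κ : D.V [⋀^Fin n]→ₗ[ℂ] M} (h : D.Rel n β f κ)
    (hf : f ∈ boundaries β n) : κ ∈ invExact β n := by
  induction n generalizing M with
  | zero =>
    have h0 : f = 0 := hf
    have h1 := h.2
    change κ = 0
    ext x
    rw [Subsingleton.elim x ![], h1, h0]
    rfl
  | succ n ih =>
    obtain ⟨p, ν, h1, h2, h3, h4⟩ := h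
    obtain ⟨m, rfl⟩ := hf
    have h5 : Bimodule.d n β.coind (p - Bimodule.post β.toCoind n m) = 0 := by
      rw [map_sub, Bimodule.d_post β.isHom_toCoind, h2, sub_self]
    -- Correcting ν by an invariant cocycle c with the same image in the cokernel makes it a form
    -- with values in M, and its differential is still κ.
    suffices H : ∃ c, IsInvCocycle β.coind n c ∧ D.post β.toCoker n (ν - c) = 0 by
      obtain ⟨c, hc, hc'⟩ := H
      obtain ⟨μ, hμ⟩ := exists_post_toCoind β n _ hc'
      refine ⟨μ, act_of_post_toCoind β n μ fun g => ?_, post_toCoind_injective β _ ?_⟩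
      · rw [hμ, map_sub, h1, hc.2]
      · rw [← d_post β.isHom_toCoind, hμ, map_sub, hc.1, sub_zero, h3]
    cases n with
    | zero =>
      -- The shift from degree 1 to degree 0 is special: cocycles on Hom(B, M) need not vanish
      -- there, but they are central elements and serve both theories at once.
      let c := AlternatingMap.constOfIsEmpty ℂ D.V (Fin 0)
        ((p - Bimodule.post β.toCoind 0 m) ![])
      refine ⟨c, (isInvCocycle_zero_iff _ _).2 ((d_zero_eq_zero_iff β.coind _).1 h5), ?_⟩
      ext1 x
      have h6 := h4.2
      rw [Subsingleton.elim x ![]]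
      simp only [Koszul.pull_apply, Bimodule.post_apply] at h6
      have h7 : (fun i : Fin 0 => LinearMap.id (R := ℂ) ((![] : Fin 0 → D.V) i)) = ![] :=
        Subsingleton.elim _ _
      rw [h7] at h6
      rw [Koszul.pull_apply, h7, AlternatingMap.sub_apply, map_sub, h6]
      change _ - β.toCoker ((p - Bimodule.post β.toCoind 0 m) ![]) = 0
      rw [_root_.sub_apply, map_sub, Bimodule.post_apply, toCoker_toCoind, sub_zero,
        sub_self]
    | succ n =>
      -- In higher degree the cocycle on Hom(B, M) is a boundary, so the image of p in the cokernel
      -- is one too and induction applies. The primitive on the Koszul side is lifted to an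
      -- invariant form.
      obtain ⟨r, hr⟩ := Bimodule.exists_d_eq_of_coind n β _ h5
      obtain ⟨μ, hμ, hμ'⟩ := ih h4 ⟨Bimodule.post β.toCoker n r, by
        rw [Bimodule.d_post β.isHom_toCoker, hr, map_sub, Bimodule.post_toCoker_post_toCoind,
          sub_zero]⟩
      obtain ⟨μ, hμ1, rfl⟩ := exists_post_toCoker β n μ hμ
      refine ⟨Koszul.d (ad β.coind) n μ, ⟨Koszul.d_d (ad_comm _) _ _, fun g => ?_⟩, ?_⟩
      · rw [← d_act, hμ1]
      · rw [map_sub, ← d_post β.isHom_toCoker, hμ', sub_self]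

theorem mem_boundaries {n : ℕ} {β : Bimodule ℂ D.Semidirect M}
    {f : Bimodule.Cochain ℂ D.Semidirect M n} {κ : D.V [⋀^Fin n]→ₗ[ℂ] M} (h : D.Rel n β f κ)
    (hκ : κ ∈ invExact β n) : f ∈ boundaries β n := by
  induction n generalizing M with
  | zero =>
    have h0 : κ = 0 := hκ
    have h1 := h.2
    change f = 0
    ext x
    rw [Subsingleton.elim x ![], ← h1, h0]
    rfl
  | succ n ih =>
    obtain ⟨p, ν, h1, h2, h3, h4⟩ := h
    obtain ⟨m, hm, rfl⟩ := hκ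
    have h5 : IsInvCocycle β.coind n (ν - D.post β.toCoind n m) := by
      refine ⟨?_, fun g => ?_⟩
      · rw [map_sub, d_post β.isHom_toCoind, h3, sub_self]
      · rw [map_sub, h1, ← post_act β.isHom_toCoind, hm]
    suffices H : ∃ c, Bimodule.d n β.coind c = 0 ∧ Bimodule.post β.toCoker n (p - c) = 0 by
      obtain ⟨c, hc, hc'⟩ := H
      obtain ⟨μ, hμ⟩ := Bimodule.exists_post_toCoind β _ hc'
      refine ⟨μ, Bimodule.post_toCoind_injective β ?_⟩
      rw [← Bimodule.d_post β.isHom_toCoind, hμ, map_sub, hc, sub_zero, h2]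
    cases n with
    | zero =>
      let c : Bimodule.Cochain ℂ D.Semidirect (D.Semidirect →ₗ[ℂ] M) 0 :=
        MultilinearMap.constOfIsEmpty ℂ _ ((ν - D.post β.toCoind 0 m) ![])
      refine ⟨c, (d_zero_eq_zero_iff β.coind _).2 ((isInvCocycle_zero_iff _ _).1 h5), ?_⟩
      ext1 x
      have h6 := h4.2
      rw [Subsingleton.elim x ![]]
      simp only [Koszul.pull_apply, Bimodule.post_apply] at h6
      have h7 : (fun i : Fin 0 => LinearMap.id (R := ℂ) ((![] : Fin 0 → D.V) i)) = ![] :=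
        Subsingleton.elim _ _
      rw [h7] at h6
      rw [Bimodule.post_apply, _root_.sub_apply, map_sub, ← h6]
      change _ - β.toCoker ((ν - D.post β.toCoind 0 m) ![]) = 0
      rw [AlternatingMap.sub_apply, map_sub, Koszul.pull_apply, toCoker_toCoind, sub_zero,
        sub_self]
    | succ n =>
      obtain ⟨r, hr, hr'⟩ := exists_d_eq_of_coind β n _ h5.1 h5.2
      obtain ⟨μ, hμ⟩ := ih h4 ⟨D.post β.toCoker n r, fun g => by
        rw [← post_act β.isHom_toCoker, hr], by
        rw [d_post β.isHom_toCoker, hr', map_sub, post_toCoker_post_toCoind, sub_zero]⟩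
      obtain ⟨μ, rfl⟩ := Bimodule.exists_post_toCoker β μ
      refine ⟨Bimodule.d n β.coind μ, d_d _ _ _, ?_⟩
      rw [map_sub, ← Bimodule.d_post β.isHom_toCoker, hμ, sub_self]

end Rel

/-! ### Naturality of the comparison -/

namespace Iso

theorem semidirectEquiv_vec (e : Iso D D') (x : D.V) :
    e.semidirectEquiv (D.vec x) = D'.vec (e.φ x) := by
  change e.semidirectHom (SkewMonoidAlgebra.single 1 (WeylAlgebra.ι D.ω x)) = _
  rw [semidirectHom_single, map_one, weylHom, WeylAlgebra.map_ι]
  rfl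

theorem semidirectEquiv_grp (e : Iso D D') (g : D.G) :
    e.semidirectEquiv (D.grp g) = D'.grp (e.θ g) := by
  change e.semidirectHom (SkewMonoidAlgebra.single g 1) = _
  rw [semidirectHom_single, map_one]
  rfl

variable {e : Iso D D'} {β : Bimodule ℂ D.Semidirect M} {γ : Bimodule ℂ D'.Semidirect N}
  {τ : M →ₗ[ℂ] N}

theorem ad_hom (h : β.IsHom γ e.semidirectEquiv τ) (x : D.V) (m : M) :
    τ (ad β x m) = ad γ (e.φ x) (τ m) := by
  rw [ad_apply, map_sub, h.l, h.r, semidirectEquiv_vec, ad_apply]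

theorem conj_hom (h : β.IsHom γ e.semidirectEquiv τ) (g : D.G) (m : M) :
    τ (conj β g m) = conj γ (e.θ g) (τ m) := by
  rw [conj_apply, h.l, h.r, semidirectEquiv_grp, semidirectEquiv_grp, map_inv, conj_apply]

theorem d_pull (h : β.IsHom γ e.semidirectEquiv τ) (n : ℕ) (κ : D.V [⋀^Fin n]→ₗ[ℂ] M) :
    Koszul.d (ad γ) n (Koszul.pull e.φ.symm.toLinearMap τ n κ) =
      Koszul.pull e.φ.symm.toLinearMap τ (n + 1) (Koszul.d (ad β) n κ) :=
  Koszul.d_pull (fun y m => by rw [ad_hom h]; simp) n κ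

theorem act_pull (h : β.IsHom γ e.semidirectEquiv τ) (n : ℕ) (κ : D.V [⋀^Fin n]→ₗ[ℂ] M)
    (g : D.G) : act γ n (e.θ g) (Koszul.pull e.φ.symm.toLinearMap τ n κ) =
      Koszul.pull e.φ.symm.toLinearMap τ n (act β n g κ) := by
  ext x
  rw [act_apply, Koszul.pull_apply, Koszul.pull_apply, act_apply, conj_hom h]
  congr 3
  funext i
  apply e.φ.injective
  simp [e.map_act]

/-- The map of coinduced bimodules induced by an isomorphism. -/
def coindMap (e : Iso D D') (τ : M →ₗ[ℂ] N) :
    (D.Semidirect →ₗ[ℂ] M) →ₗ[ℂ] D'.Semidirect →ₗ[ℂ] N where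
  toFun φ := τ ∘ₗ φ ∘ₗ e.semidirectEquiv.symm.toLinearMap
  map_add' φ ψ := by
    refine LinearMap.ext fun x => ?_
    simp
  map_smul' c φ := by
    refine LinearMap.ext fun x => ?_
    simp

theorem coindMap_apply (φ : D.Semidirect →ₗ[ℂ] M) (x : D'.Semidirect) :
    e.coindMap τ φ x = τ (φ (e.semidirectEquiv.symm x)) := rfl

theorem isHom_coindMap (h : β.IsHom γ e.semidirectEquiv τ) :
    β.coind.IsHom γ.coind e.semidirectEquiv (e.coindMap τ) where
  l b φ := by
    refine LinearMap.ext fun x => ?_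
    simp [coindMap_apply, h.l]
  r b φ := by
    refine LinearMap.ext fun x => ?_
    simp [coindMap_apply]

theorem coindMap_toCoind (h : β.IsHom γ e.semidirectEquiv τ) (m : M) :
    e.coindMap τ (β.toCoind m) = γ.toCoind (τ m) := by
  refine LinearMap.ext fun x => ?_
  simp [coindMap_apply, h.r]

/-- The map of cokernels induced by an isomorphism. -/
def cokerMap (e : Iso D D') (τ : M →ₗ[ℂ] N) :
    Coker ℂ D.Semidirect M →ₗ[ℂ] Coker ℂ D'.Semidirect N :=
  (e.coindMap τ).restrict fun φ (hφ : φ 1 = 0) => by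
    rw [LinearMap.mem_ker, evalOne_apply, coindMap_apply, map_one, hφ, map_zero]

theorem cokerMap_toCoker (h : β.IsHom γ e.semidirectEquiv τ) (φ : D.Semidirect →ₗ[ℂ] M) :
    e.cokerMap τ (β.toCoker φ) = γ.toCoker (e.coindMap τ φ) := by
  ext1
  change e.coindMap τ (β.toCoker φ : D.Semidirect →ₗ[ℂ] M) = _
  rw [coe_toCoker, coe_toCoker, map_sub, coindMap_toCoind h, coindMap_apply, map_one e.semidirectEquiv.symm]

theorem isHom_cokerMap (h : β.IsHom γ e.semidirectEquiv τ) :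
    β.coker.IsHom γ.coker e.semidirectEquiv (e.cokerMap τ) where
  l b φ := by
    change e.cokerMap τ (β.toCoker (β.coind.l b φ)) = _
    rw [cokerMap_toCoker h, (isHom_coindMap h).l]
    rfl
  r b φ := by
    change e.cokerMap τ (β.toCoker (β.coind.r b φ)) = _
    rw [cokerMap_toCoker h, (isHom_coindMap h).r]
    rfl

/-- Coinduction, cokernels, differentials and the group action are all functorial, so the witnesses
in the relation can be transported one by one. -/
theorem rel_transport (h : β.IsHom γ e.semidirectEquiv τ) {n : ℕ}
    {f : Bimodule.Cochain ℂ D.Semidirect M n} {κ : D.V [⋀^Fin n]→ₗ[ℂ] M} (hf : D.Rel n β f κ) :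
    D'.Rel n γ (transport e.semidirectEquiv τ n f) (Koszul.pull e.φ.symm.toLinearMap τ n κ) := by
  induction n generalizing M N with
  | zero =>
    have h1 : transport e.semidirectEquiv τ 0 f ![] = τ (f ![]) :=
      congr_arg (fun x => τ (f x)) (Subsingleton.elim _ _)
    have h2 : Koszul.pull e.φ.symm.toLinearMap τ 0 κ ![] = τ (κ ![]) :=
      congr_arg (fun x => τ (κ x)) (Subsingleton.elim _ _)
    refine ⟨fun b => ?_, by rw [h1, h2, hf.2]⟩
    obtain ⟨b, rfl⟩ := e.semidirectEquiv.surjective b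
    rw [h1, ← h.l, ← h.r, hf.1 b]
  | succ n ih =>
    obtain ⟨p, ν, h1, h2, h3, h4⟩ := hf
    have hI := isHom_coindMap h
    refine ⟨transport e.semidirectEquiv (e.coindMap τ) n p,
      Koszul.pull e.φ.symm.toLinearMap (e.coindMap τ) n ν, fun g => ?_, ?_, ?_, ?_⟩
    · obtain ⟨g, rfl⟩ := e.θ.surjective g
      rw [act_pull hI, h1]
    · rw [d_transport hI, h2]
      ext1 x
      exact coindMap_toCoind h _
    · rw [d_pull hI, h3]
      ext1 x
      exact coindMap_toCoind h _
    · have h5 := ih (isHom_cokerMap h) h4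
      convert h5 using 1
      · ext1 x
        exact (cokerMap_toCoker h _).symm
      · ext1 x
        exact (cokerMap_toCoker h _).symm

end Iso

end SymplecticAction

/-! ### Powers of a two-form -/

namespace Koszul

open AlternatingMap (alternatizeUncurryFin alternatizeUncurryFin_apply curryLeftLinearMap)

variable {k : Type*} [Field k] {V : Type*} [AddCommGroup V] [Module k V]

/-- Insertion of a vector into the first slot. -/
def ins (v : V) (n : ℕ) : V [⋀^Fin (n + 1)]→ₗ[k] k →ₗ[k] V [⋀^Fin n]→ₗ[k] k :=
  curryLeftLinearMap.flip v

theorem ins_apply (v : V) (n : ℕ) (κ : V [⋀^Fin (n + 1)]→ₗ[k] k) (x : Fin n → V) :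
    ins v n κ x = κ (Fin.cons v x) := rfl

theorem ins_alternatizeUncurryFin (v : V) (n : ℕ) (F : V →ₗ[k] V [⋀^Fin (n + 1)]→ₗ[k] k) :
    ins v (n + 1) (alternatizeUncurryFin F) =
      F v - alternatizeUncurryFin (ins v n ∘ₗ F) := by
  ext x
  rw [ins_apply, alternatizeUncurryFin_apply, Fin.sum_univ_succ, AlternatingMap.sub_apply,
    alternatizeUncurryFin_apply, sub_eq_add_neg, ← Finset.sum_neg_distrib]
  congr 1
  · simp
  · refine Finset.sum_congr rfl fun i _ => ?_
    have h : i.succ.removeNth (Fin.cons v x : Fin (n + 2) → V) = Fin.cons v (i.removeNth x) := by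
      funext m
      induction m using Fin.cases <;> simp [Fin.removeNth_apply]
    rw [h]
    simp [pow_succ, ins_apply]

theorem ins_alternatizeUncurryFin_zero (v : V) (F : V →ₗ[k] V [⋀^Fin 0]→ₗ[k] k) :
    ins v 0 (alternatizeUncurryFin F) = F v := by
  ext x
  rw [ins_apply, alternatizeUncurryFin_apply]
  simp

/-- The exterior product with a linear form. -/
def wedge (θ : V →ₗ[k] k) (n : ℕ) : V [⋀^Fin n]→ₗ[k] k →ₗ[k] V [⋀^Fin (n + 1)]→ₗ[k] k :=
  d (θ.smulRight LinearMap.id) n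

theorem wedge_apply (θ : V →ₗ[k] k) (n : ℕ) (κ : V [⋀^Fin n]→ₗ[k] k) (x : Fin (n + 1) → V) :
    wedge θ n κ x = ∑ i : Fin (n + 1), (-1 : ℤ) ^ (i : ℕ) • (θ (x i) * κ (i.removeNth x)) := by
  simp [wedge, d_apply]

theorem ins_wedge (v : V) (θ : V →ₗ[k] k) (n : ℕ) (κ : V [⋀^Fin (n + 1)]→ₗ[k] k) :
    ins v (n + 1) (wedge θ (n + 1) κ) = θ v • κ - wedge θ n (ins v n κ) := by
  refine (ins_alternatizeUncurryFin v n _).trans ?_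
  congr 1

theorem ins_wedge_zero (v : V) (θ : V →ₗ[k] k) (κ : V [⋀^Fin 0]→ₗ[k] k) :
    ins v 0 (wedge θ 0 κ) = θ v • κ :=
  ins_alternatizeUncurryFin_zero v _

/-- The exterior product with linear forms, depending linearly on the linear form. -/
def wedgeL (ω : V →ₗ[k] V →ₗ[k] k) (n : ℕ) (κ : V [⋀^Fin n]→ₗ[k] k) :
    V →ₗ[k] V [⋀^Fin (n + 1)]→ₗ[k] k where
  toFun v := wedge (ω v) n κ
  map_add' v w := by
    ext x
    simp [wedge_apply, add_mul, Finset.sum_add_distrib]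
  map_smul' c v := by
    ext x
    simp [wedge_apply, Finset.mul_sum, mul_assoc, mul_left_comm]

/-- Twice the exterior product with a two-form. -/
def wedgeTwo (ω : V →ₗ[k] V →ₗ[k] k) (n : ℕ) (κ : V [⋀^Fin n]→ₗ[k] k) :
    V [⋀^Fin (n + 2)]→ₗ[k] k :=
  alternatizeUncurryFin (wedgeL ω n κ)

theorem wedgeTwo_apply (ω : V →ₗ[k] V →ₗ[k] k) (n : ℕ) (κ : V [⋀^Fin n]→ₗ[k] k)
    (x : Fin (n + 2) → V) : wedgeTwo ω n κ x = ∑ i : Fin (n + 2), (-1 : ℤ) ^ (i : ℕ) •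
      ∑ j : Fin (n + 1), (-1 : ℤ) ^ (j : ℕ) •
        (ω (x i) (i.removeNth x j) * κ (j.removeNth (i.removeNth x))) := by
  simp only [wedgeTwo, alternatizeUncurryFin_apply]
  refine Finset.sum_congr rfl fun i _ => ?_
  congr 1
  exact wedge_apply _ _ _ _

theorem alternatizeUncurryFin_flip_smul (θ : V →ₗ[k] k) (n : ℕ) (κ : V [⋀^Fin n]→ₗ[k] k) :
    alternatizeUncurryFin (θ.smulRight κ) = wedge θ n κ := by
  ext x
  simp [alternatizeUncurryFin_apply, wedge_apply]

variable {ω : V →ₗ[k] V →ₗ[k] k}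

/-- Insertion is an antiderivation of the exterior product. The factor 2 arises because `wedgeTwo`
is twice the exterior product. -/
theorem ins_wedgeTwo (hω : ω.IsAlt) (v : V) (n : ℕ) (κ : V [⋀^Fin (n + 1)]→ₗ[k] k) :
    ins v (n + 2) (wedgeTwo ω (n + 1) κ) =
      (2 : k) • wedge (ω v) (n + 1) κ + wedgeTwo ω n (ins v n κ) := by
  rw [wedgeTwo, ins_alternatizeUncurryFin]
  have h : ins v (n + 1) ∘ₗ wedgeL ω (n + 1) κ =
      -((ω v).smulRight κ + wedgeL ω n (ins v n κ)) := by
    ext w x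
    have := AlternatingMap.congr_fun (ins_wedge v (ω w) n κ) x
    rw [← hω.neg] at this
    simp only [LinearMap.comp_apply, LinearMap.neg_apply, LinearMap.add_apply]
    refine this.trans ?_
    simp [wedgeL, sub_eq_add_neg, add_comm]
  have h' : alternatizeUncurryFin (-((ω v).smulRight κ + wedgeL ω n (ins v n κ))) =
      -(wedge (ω v) (n + 1) κ + wedgeTwo ω n (ins v n κ)) := by
    rw [← alternatizeUncurryFin_flip_smul, wedgeTwo, ← AlternatingMap.alternatizeUncurryFin_add,
      ← neg_one_smul k, AlternatingMap.alternatizeUncurryFin_smul, neg_one_smul]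
  rw [h, h', sub_neg_eq_add, two_smul, ← add_assoc]
  rfl

theorem ins_wedgeTwo_zero (hω : ω.IsAlt) (v : V) (κ : V [⋀^Fin 0]→ₗ[k] k) :
    ins v 1 (wedgeTwo ω 0 κ) = (2 : k) • wedge (ω v) 0 κ := by
  rw [wedgeTwo, ins_alternatizeUncurryFin]
  have h : ins v 0 ∘ₗ wedgeL ω 0 κ = (-1 : k) • (ω v).smulRight κ := by
    ext w x
    have := AlternatingMap.congr_fun (ins_wedge_zero v (ω w) κ) x
    rw [← hω.neg] at this
    refine this.trans ?_
    simp
  rw [h, AlternatingMap.alternatizeUncurryFin_smul, alternatizeUncurryFin_flip_smul, neg_one_smul,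
    sub_neg_eq_add, two_smul]
  rfl

/-- The canonical `n`-form of a two-form: up to a factor, its exterior power if `n` is even, and
zero if `n` is odd. -/
def powForm (ω : V →ₗ[k] V →ₗ[k] k) : (n : ℕ) → V [⋀^Fin n]→ₗ[k] k
  | 0 => AlternatingMap.constOfIsEmpty k V (Fin 0) 1
  | 1 => 0
  | n + 2 => wedgeTwo ω n (powForm ω n)

theorem powForm_succ_succ (n : ℕ) : powForm ω (n + 2) = wedgeTwo ω n (powForm ω n) := rfl

theorem powForm_odd {n : ℕ} (hn : Odd n) : powForm ω n = 0 := by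
  induction n using Nat.twoStepInduction with
  | zero => simp at hn
  | one => rfl
  | more n ih _ =>
    rw [powForm_succ_succ, ih (by simpa [Nat.odd_add] using hn)]
    ext x
    simp [wedgeTwo_apply]

theorem powForm_map {W : Type*} [AddCommGroup W] [Module k W] {ω' : W →ₗ[k] W →ₗ[k] k}
    (φ : V →ₗ[k] W) (h : ∀ x y, ω' (φ x) (φ y) = ω x y) (n : ℕ) (x : Fin n → V) :
    powForm ω' n (fun i => φ (x i)) = powForm ω n x := by
  induction n using Nat.twoStepInduction with
  | zero => rfl
  | one => rfl
  | more n ih _ =>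
    rw [powForm_succ_succ, powForm_succ_succ, wedgeTwo_apply, wedgeTwo_apply]
    refine Finset.sum_congr rfl fun i _ => ?_
    congr 1
    refine Finset.sum_congr rfl fun j _ => ?_
    rw [← ih]
    congr 2
    exact h _ _

theorem powForm_eq_zero (hω : ω.IsAlt) {n : ℕ} (x : Fin n → V) (i : Fin n) (hi : ω (x i) = 0) :
    powForm ω n x = 0 := by
  have key : ∀ n z, ω z = 0 → ins z n (powForm ω (n + 1)) = 0 := by
    intro n z hz
    have hw : ∀ n κ, wedge (ω z) n κ = 0 := by
      intro n κ
      ext x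
      simp [wedge_apply, hz]
    induction n using Nat.twoStepInduction with
    | zero =>
      rw [powForm]
      exact map_zero _
    | one => rw [powForm_succ_succ, ins_wedgeTwo_zero hω, hw, smul_zero]
    | more n ih _ =>
      rw [powForm_succ_succ, ins_wedgeTwo hω, ih, hw, smul_zero, zero_add]
      ext x
      simp [wedgeTwo_apply]
  obtain ⟨n, rfl⟩ : ∃ m, n = m + 1 := ⟨n - 1, by have := i.pos; omega⟩
  have h := AlternatingMap.map_insertNth (powForm ω (n + 1)) i (x i) (i.removeNth x)
  rw [Fin.insertNth_self_removeNth] at h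
  rw [h]
  have h' := AlternatingMap.congr_fun (key n (x i) hi) (i.removeNth x)
  rw [ins_apply] at h'
  change _ • powForm ω (n + 1) (Fin.cons (x i) (i.removeNth x)) = 0
  rw [h', AlternatingMap.zero_apply, smul_zero]

/-- Inserting e and then f by the antiderivation rule, every term in which e or f is paired with an
x_i vanishes. What remains is 2 from the pairing ω(e, f) plus the inductive contribution n. -/
theorem powForm_cons_cons (hω : ω.IsAlt) {e f : V} (hef : ω e f = 1) (n : ℕ) (x : Fin n → V)
    (he : ∀ i, ω e (x i) = 0) (hf : ∀ i, ω f (x i) = 0) :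
    powForm ω (n + 2) (Fin.cons e (Fin.cons f x)) = ((n + 2 : ℕ) : k) * powForm ω n x := by
  have hw : ∀ (z : V) (n : ℕ) (κ : V [⋀^Fin n]→ₗ[k] k) (x : Fin (n + 1) → V),
      (∀ i, ω z (x i) = 0) → wedge (ω z) n κ x = 0 := by
    intro z n κ x hx
    simp [wedge_apply, hx]
  change ins f n (ins e (n + 1) (powForm ω (n + 2))) x = _
  induction n using Nat.twoStepInduction with
  | zero =>
    rw [powForm_succ_succ, ins_wedgeTwo_zero hω, map_smul, ins_wedge_zero, hef]
    simp
  | one =>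
    rw [powForm_odd (by decide : Odd (1 + 2)), powForm_odd (by decide : Odd 1)]
    simp
  | more n ih _ =>
    rw [powForm_succ_succ, ins_wedgeTwo hω, map_add, map_smul, ins_wedge, ins_wedgeTwo hω, hef,
      AlternatingMap.add_apply, AlternatingMap.smul_apply, AlternatingMap.sub_apply,
      AlternatingMap.add_apply, AlternatingMap.smul_apply, AlternatingMap.smul_apply,
      hw e _ _ x he, hw f _ _ x hf, wedgeTwo_apply]
    have h1 : ∀ (i : Fin (n + 2)) (j : Fin (n + 1)),
        ins f n (ins e (n + 1) (powForm ω (n + 2))) (j.removeNth (i.removeNth x)) =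
          ((n + 2 : ℕ) : k) * powForm ω n (j.removeNth (i.removeNth x)) :=
      fun i j => ih _ (fun _ => he _) (fun _ => hf _)
    have h2 : powForm ω (n + 2) x = _ := wedgeTwo_apply ω n (powForm ω n) x
    simp only [h1]
    have h3 : (∑ i : Fin (n + 2), (-1 : ℤ) ^ (i : ℕ) • ∑ j : Fin (n + 1), (-1 : ℤ) ^ (j : ℕ) •
        (ω (x i) (i.removeNth x j) *
          (((n + 2 : ℕ) : k) * powForm ω n (j.removeNth (i.removeNth x))))) =
        ((n + 2 : ℕ) : k) * powForm ω (n + 2) x := by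
      rw [h2, Finset.mul_sum]
      refine Finset.sum_congr rfl fun i _ => ?_
      rw [mul_smul_comm, Finset.mul_sum]
      congr 1
      refine Finset.sum_congr rfl fun j _ => ?_
      rw [mul_smul_comm, mul_left_comm]
    rw [h3]
    push_cast
    simp only [smul_eq_mul]
    ring

/-- The canonical form is nonzero on a nondegenerate subspace of the right dimension; in
particular that dimension is even. -/
theorem exists_powForm_ne_zero [CharZero k] [FiniteDimensional k V] (hω : ω.IsAlt) (n : ℕ)
    (S : Submodule k V) (hS : ∀ x ∈ S, x ≠ 0 → ∃ y ∈ S, ω x y ≠ 0) (hn : Module.finrank k S = n) :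
    ∃ x : Fin n → V, (∀ i, x i ∈ S) ∧ powForm ω n x ≠ 0 := by
  induction n using Nat.strong_induction_on generalizing S with
  | _ n ih =>
  rcases Nat.eq_zero_or_pos n with rfl | hpos
  · exact ⟨![], fun i => i.elim0, one_ne_zero⟩
  have hne : S ≠ ⊥ := by
    rintro rfl
    rw [finrank_bot] at hn
    omega
  -- A hyperbolic pair e, f is split off, and the induction continues in its orthogonal complement
  -- inside S, of dimension n - 2.
  obtain ⟨e, heS, he0⟩ := S.exists_mem_ne_zero_of_ne_bot hne
  obtain ⟨f', hf'S, hf'⟩ := hS e heS he0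
  obtain ⟨f, hfS, hef⟩ : ∃ f ∈ S, ω e f = 1 :=
    ⟨(ω e f')⁻¹ • f', S.smul_mem _ hf'S, by simp [hf']⟩
  have hfe : ω f e = -1 := by rw [← hω.neg, hef]
  let L : S →ₗ[k] k × k := ((ω e).prod (ω f)) ∘ₗ S.subtype
  have hL : LinearMap.range L = ⊤ := by
    rw [LinearMap.range_eq_top]
    rintro ⟨a, b⟩
    refine ⟨a • ⟨f, hfS⟩ - b • ⟨e, heS⟩, ?_⟩
    simp [L, hef, hfe, hω.self_eq_zero]
  have hrank := L.finrank_range_add_finrank_ker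
  rw [hL, finrank_top, Module.finrank_prod, Module.finrank_self, hn] at hrank
  let S' := (LinearMap.ker L).map S.subtype
  have hS'mem : ∀ x, x ∈ S' ↔ x ∈ S ∧ ω e x = 0 ∧ ω f x = 0 := by
    intro x
    simp only [S', L, Submodule.mem_map, LinearMap.mem_ker, LinearMap.comp_apply,
      LinearMap.prod_apply, Submodule.subtype_apply, Subtype.exists, exists_and_right,
      exists_eq_right, exists_prop]
    exact and_congr_right fun _ => Prod.mk_eq_zero (x := ω e x) (y := ω f x)
  have hS'rank : Module.finrank k S' = n - 2 := by
    rw [Submodule.finrank_map_subtype_eq]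
    omega
  obtain ⟨x, hx, hx'⟩ := ih (n - 2) (by omega) S' (fun x hx hx0 => by
    obtain ⟨hxS, hxe, hxf⟩ := (hS'mem x).1 hx
    obtain ⟨y, hy, hxy⟩ := hS x hxS hx0
    have hxe' : ω x e = 0 := by rw [← hω.neg, hxe, neg_zero]
    have hxf' : ω x f = 0 := by rw [← hω.neg, hxf, neg_zero]
    -- This is the projection of y to the orthogonal complement of e and f; pairing with x is
    -- unaffected, as x is orthogonal to both.
    refine ⟨y + ω f y • e - ω e y • f, (hS'mem _).2 ⟨?_, ?_, ?_⟩, ?_⟩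
    · exact sub_mem (add_mem hy (S.smul_mem _ heS)) (S.smul_mem _ hfS)
    · simp [hef, hω.self_eq_zero]
    · simp [hfe, hω.self_eq_zero]
    · simpa [hxe', hxf'] using hxy) hS'rank
  obtain ⟨m, rfl⟩ : ∃ m, n = m + 2 := ⟨n - 2, by omega⟩
  refine ⟨Fin.cons e (Fin.cons f x), fun i => ?_, ?_⟩
  · induction i using Fin.cases with
    | zero => exact heS
    | succ i =>
      induction i using Fin.cases with
      | zero => exact hfS
      | succ i => exact ((hS'mem _).1 (hx i)).1
  · rw [powForm_cons_cons hω hef m x (fun i => ((hS'mem _).1 (hx i)).2.1)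
      (fun i => ((hS'mem _).1 (hx i)).2.2)]
    exact mul_ne_zero (by exact_mod_cast (m + 1).succ_ne_zero) hx'

end Koszul

/-! ### Twisted commutators on the Weyl algebra -/

namespace SymplecticAction

open WeylAlgebra

variable {D : SymplecticAction.{u, v}}

/-- The twisted commutator `a ↦ x a - a g(x)`. -/
def tw (g : D.G) : D.V →ₗ[ℂ] D.Weyl →ₗ[ℂ] D.Weyl := opL D.ω - opR D.ω ∘ₗ D.ρ g

theorem tw_apply (g : D.G) (x : D.V) (a : D.Weyl) :
    tw g x a = opL D.ω x a - opR D.ω (D.ρ g x) a := rfl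

/-- Left multiplications contribute ω(x, y) and right multiplications -ω(gx, gy); these cancel by
invariance. -/
theorem tw_comm (g : D.G) (x y : D.V) (a : D.Weyl) : tw g x (tw g y a) = tw g y (tw g x a) := by
  simp only [tw_apply, map_sub, opL_opL x y, opR_opR (D.ρ g x) (D.ρ g y), opL_opR, D.invariant]
  abel

theorem opAd_tw (g : D.G) (w x : D.V) (a : D.Weyl) :
    opAd D.ω w (tw g x a) = tw g x (opAd D.ω w a) + D.ω w (x - D.ρ g x) • a := by
  simp only [tw_apply, opAd_apply, map_sub, opL_opL w x, opR_opR w (D.ρ g x), opL_opR, sub_smul]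
  abel

theorem tw_opAd (g : D.G) (w x : D.V) (a : D.Weyl) :
    tw g x (opAd D.ω w a) = opAd D.ω w (tw g x a) + (-D.ω w (x - D.ρ g x)) • a := by
  rw [opAd_tw, neg_smul, add_neg_cancel_right]

theorem tw_opM (g : D.G) {z : D.V} (hz : D.ρ g z = z) (x : D.V) (a : D.Weyl) :
    tw g x (opM D.ω z a) = opM D.ω z (tw g x a) + D.ω x z • a := by
  have h : D.ω (D.ρ g x) z = D.ω x z := by
    conv_lhs => rw [← hz]
    exact D.invariant g x z
  simp only [tw_apply, opM_apply, map_sub, map_add, map_smul, opL_opL x z,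
    opR_opR (D.ρ g x) z, opL_opR, h]
  module

theorem tw_of_fixed (g : D.G) {x : D.V} (hx : D.ρ g x = x) (a : D.Weyl) :
    tw g x a = opAd D.ω x a := by
  rw [tw_apply, opAd_apply, hx]

theorem opL_sub_eq (g : D.G) (x : D.V) (a : D.Weyl) :
    opL D.ω (x - D.ρ g x) a = tw g x a - opAd D.ω (D.ρ g x) a := by
  simp only [tw_apply, opAd_apply, map_sub, LinearMap.sub_apply]
  abel

/-- The moved space of `g`. -/
abbrev moved (g : D.G) : Submodule ℂ D.V := LinearMap.range (1 - D.ρ g)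

/-- The fixed space of `g`. -/
abbrev fixed (g : D.G) : Submodule ℂ D.V := LinearMap.ker (1 - D.ρ g)

theorem mem_fixed {g : D.G} {x : D.V} : x ∈ fixed g ↔ D.ρ g x = x := by
  rw [LinearMap.mem_ker, LinearMap.sub_apply, Module.End.one_apply, sub_eq_zero, eq_comm]

theorem sub_mem_moved (g : D.G) (x : D.V) : x - D.ρ g x ∈ moved g := ⟨x, by simp⟩

theorem form_fixed_sub {g : D.G} {x : D.V} (hx : D.ρ g x = x) (y : D.V) :
    D.ω x (y - D.ρ g y) = 0 := by
  rw [map_sub, ← D.invariant g x y, hx, sub_self]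

theorem form_fixed_moved {g : D.G} {x y : D.V} (hx : D.ρ g x = x) (hy : y ∈ moved g) :
    D.ω x y = 0 := by
  obtain ⟨y, rfl⟩ := hy
  exact form_fixed_sub hx y

theorem form_moved_fixed {g : D.G} {x y : D.V} (hx : D.ρ g x = x) (hy : y ∈ moved g) :
    D.ω y x = 0 := by
  rw [← D.alternating.neg, form_fixed_moved hx hy, neg_zero]

/-- If x = y - gy is fixed, then g^k y = y - kx for all k. Taking k to be the order of g forces x =
0; complementarity follows by dimension. -/
theorem isCompl_moved_fixed (g : D.G) : IsCompl (moved g) (fixed g) := by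
  rw [Submodule.isCompl_iff_disjoint _ _ (LinearMap.finrank_range_add_finrank_ker _).ge,
    Submodule.disjoint_def]
  rintro x ⟨y, rfl⟩ hx
  rw [mem_fixed] at hx
  simp only [LinearMap.sub_apply, Module.End.one_apply] at hx ⊢
  have h : ∀ k : ℕ, D.ρ (g ^ k) y = y - (k : ℂ) • (y - D.ρ g y) := by
    intro k
    induction k with
    | zero => simp
    | succ k ih =>
      rw [pow_succ', map_mul, Module.End.mul_apply, ih, map_sub, map_smul, hx]
      push_cast
      module
  have h1 := h (orderOf g)
  rw [pow_orderOf_eq_one, map_one, Module.End.one_apply, eq_comm, sub_eq_self,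
    smul_eq_zero] at h1
  refine h1.resolve_left ?_
  exact_mod_cast (orderOf_pos g).ne'

/-- A basis of `V` that is adapted to the decomposition into the moved space and the fixed space,
with vectors dual to the images of the moved basis vectors and to the fixed basis vectors. -/
structure AdaptedBasis (g : D.G) where
  s : ℕ
  b : Module.Basis (Fin (Module.finrank ℂ (moved g)) ⊕ Fin s) ℂ D.V
  w : Fin (Module.finrank ℂ (moved g)) → D.V
  z : Fin s → D.V
  moved_mem : ∀ j, b (Sum.inl j) ∈ moved g
  fixed_b : ∀ j, D.ρ g (b (Sum.inr j)) = b (Sum.inr j)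
  fixed_z : ∀ j, D.ρ g (z j) = z j
  dual_w : ∀ i j, D.ω (w i) (b (Sum.inl j) - D.ρ g (b (Sum.inl j))) = if i = j then 1 else 0
  dual_z : ∀ i j, D.ω (b (Sum.inr i)) (z j) = if i = j then 1 else 0
  form_w_z : ∀ i j, D.ω (w i) (z j) = 0
  eq_top_of_w : ∀ P : Submodule ℂ D.V, (∀ j, w j ∈ P) → (∀ j, b (Sum.inr j) ∈ P) → P = ⊤
  eq_top_of_z : ∀ P : Submodule ℂ D.V, (∀ j, b (Sum.inl j) - D.ρ g (b (Sum.inl j)) ∈ P) →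
    (∀ j, z j ∈ P) → P = ⊤

/-- On the moved space 1 - g is invertible, so its images of the moved basis vectors, together with
the fixed basis vectors, form a second basis `b'`. The symplectic dual of `b'` supplies w and, up to
sign, z. -/
theorem exists_adaptedBasis (g : D.G) : Nonempty (AdaptedBasis g) := by
  have hc := isCompl_moved_fixed g
  let bU := Module.finBasis ℂ (moved g)
  let bF := Module.finBasis ℂ (fixed g)
  let N : moved g →ₗ[ℂ] moved g := (1 - D.ρ g).restrict fun x _ => ⟨x, rfl⟩
  have hN : Function.Injective N := by
    rw [← LinearMap.ker_eq_bot, LinearMap.ker_eq_bot']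
    intro x hx
    have h1 : (x : D.V) ∈ fixed g := congr_arg Subtype.val hx
    exact Subtype.ext (Submodule.disjoint_def.1 hc.disjoint x x.2 h1)
  let e := LinearEquiv.ofInjectiveEndo N hN
  let q := Submodule.prodEquivOfIsCompl _ _ hc
  let b := (bU.prod bF).map q
  let b' := ((bU.map e).prod bF).map q
  have hb1 : ∀ j, b (Sum.inl j) = bU j := fun j => by simp [b, q]
  have hb2 : ∀ j, b (Sum.inr j) = bF j := fun j => by simp [b, q]
  have hb3 : ∀ j, b' (Sum.inl j) = b (Sum.inl j) - D.ρ g (b (Sum.inl j)) := fun j => by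
    rw [hb1]
    simp only [b', q, e, N, Module.Basis.map_apply, Module.Basis.prod_apply]
    simp
    rfl
  have hb4 : ∀ j, b' (Sum.inr j) = b (Sum.inr j) := fun j => by simp [b, b', q]
  obtain ⟨c, hcb⟩ := exists_dual D.nondegenerate b'
  have hbF : ∀ j, D.ρ g (b (Sum.inr j)) = b (Sum.inr j) := fun j => by
    rw [hb2]
    exact mem_fixed.1 (bF j).2
  -- A vector orthogonal to the whole moved space is fixed, by invariance and nondegeneracy of the
  -- form.
  have hcF : ∀ j, D.ρ g (c (Sum.inr j)) = c (Sum.inr j) := by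
    intro j
    have h1 : ∀ x, D.ω (c (Sum.inr j)) (x - D.ρ g x) = 0 := by
      intro x
      have h2 : (⟨_, sub_mem_moved g x⟩ : moved g) ∈ Submodule.span ℂ (Set.range (bU.map e)) :=
        (bU.map e).mem_span _
      have h3 : Submodule.span ℂ (Set.range (bU.map e)) ≤
          LinearMap.ker (D.ω (c (Sum.inr j)) ∘ₗ (moved g).subtype) := by
        rw [Submodule.span_le]
        rintro _ ⟨i, rfl⟩
        have h4 := hcb (Sum.inr j) (Sum.inl i)
        simpa [b', q] using h4
      exact h3 h2
    refine sub_eq_zero.1 (D.nondegenerate.1 _ fun y => ?_)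
    obtain ⟨x, rfl⟩ : ∃ x, D.ρ g x = y := ⟨D.ρ g⁻¹ y, by simp⟩
    rw [map_sub, LinearMap.sub_apply, D.invariant]
    simpa [sub_eq_zero] using h1 x
  have hspan : ∀ x, D.ρ g x = x → ∀ P : Submodule ℂ D.V, (∀ j, c (Sum.inr j) ∈ P) → x ∈ P := by
    intro x hx P hP
    rw [← c.sum_repr x]
    refine sum_mem fun i _ => ?_
    rcases i with i | i
    · have h1 : D.ω x (b' (Sum.inl i)) = c.repr x (Sum.inl i) := by
        conv_lhs => rw [← c.sum_repr x]
        simp only [map_sum, map_smul, LinearMap.sum_apply, LinearMap.smul_apply, hcb]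
        simp
      rw [← h1, hb3, form_fixed_sub hx, zero_smul]
      exact zero_mem _
    · exact P.smul_mem _ (hP i)
  have hspan' : ∀ x, D.ρ g x = x → ∀ P : Submodule ℂ D.V, (∀ j, b (Sum.inr j) ∈ P) → x ∈ P := by
    intro x hx P hP
    have h1 : Submodule.span ℂ (Set.range bF) ≤ P.comap (fixed g).subtype := by
      rw [Submodule.span_le]
      rintro _ ⟨i, rfl⟩
      have h2 := hP i
      rw [hb2] at h2
      exact h2
    exact h1 (bF.mem_span ⟨x, mem_fixed.2 hx⟩)
  -- The sign in z compensates for z being the second argument of the form in the duality relation.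
  refine ⟨⟨_, b, fun j => c (Sum.inl j), fun j => -c (Sum.inr j), fun j => hb1 j ▸ (bU j).2, hbF,
    fun j => by rw [map_neg, hcF], fun i j => ?_, fun i j => ?_, fun i j => ?_,
    fun P h1 h2 => ?_, fun P h1 h2 => ?_⟩⟩
  · rw [← hb3, hcb]
    simp
  · rw [map_neg, D.alternating.neg, ← hb4, hcb]
    simp [eq_comm]
  · have h1 := hspan' _ (hcF j) (LinearMap.ker (D.ω (c (Sum.inl i)))) fun l => by
      rw [LinearMap.mem_ker, ← hb4, hcb]
      simp
    rw [map_neg, LinearMap.mem_ker.1 h1, neg_zero]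
  · rw [eq_top_iff, ← c.span_eq, Submodule.span_le]
    rintro _ ⟨j | j, rfl⟩
    exacts [h1 j, hspan' _ (hcF j) P h2]
  · rw [eq_top_iff, ← b'.span_eq, Submodule.span_le]
    rintro _ ⟨j | j, rfl⟩
    · rw [hb3]
      exact h1 j
    · rw [hb4]
      exact hspan _ (hbF j) P fun j => by simpa using h2 j

namespace AdaptedBasis

variable {g : D.G} (B : AdaptedBasis g)

/-- The lowering operators. -/
def lower : Fin (Module.finrank ℂ (moved g)) ⊕ Fin B.s → D.Weyl →ₗ[ℂ] D.Weyl :=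
  Sum.elim (fun j => opAd D.ω (B.w j)) fun j => opAd D.ω (B.b (Sum.inr j))

/-- The raising operators. -/
def raise : Fin (Module.finrank ℂ (moved g)) ⊕ Fin B.s → D.Weyl →ₗ[ℂ] D.Weyl :=
  Sum.elim (fun j => tw g (B.b (Sum.inl j))) fun j => opM D.ω (B.z j)

/-- The operators defining the contracting homotopy. -/
def contract : Fin (Module.finrank ℂ (moved g)) ⊕ Fin B.s → D.Weyl →ₗ[ℂ] D.Weyl :=
  Sum.elim (fun j => opAd D.ω (B.w j)) fun j => opM D.ω (B.z j)

/-- In moved directions twisted commutators raise, since [ad w, tw x] is the scalar ω(w, x - gx); in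
fixed directions symmetrized multiplications raise. The two kinds commute because moved and fixed
spaces are orthogonal, and together with commutators they recover all left multiplications. -/
theorem isSystem : Oscillator.IsSystem B.lower B.raise (Submodule.span ℂ {1}) where
  lower_raise := by
    rintro (i | i) (j | j) a
    · simp [lower, raise, opAd_tw, B.dual_w]
    · simp [lower, raise, opAd_opM, B.form_w_z]
    · simp [lower, raise, opAd_tw, form_fixed_sub (B.fixed_b i)]
    · simp [lower, raise, opAd_opM, B.dual_z]
  raise_comm := by
    rintro (i | i) (j | j) a
    · exact tw_comm g _ _ a
    · simp [raise, tw_opM g (B.fixed_z j), form_moved_fixed (B.fixed_z j) (B.moved_mem i)]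
    · simp [raise, tw_opM g (B.fixed_z i), form_moved_fixed (B.fixed_z i) (B.moved_mem j)]
    · exact opM_opM _ _ a
  vacuum := by
    rintro i x hx
    obtain ⟨c, rfl⟩ := Submodule.mem_span_singleton.1 hx
    rcases i with i | i <;> simp [lower, opAd_one]
  generates S h1 h2 h3 := by
    have hP := B.eq_top_of_w
      { carrier := {v | ∀ a ∈ S, opAd D.ω v a ∈ S}
        add_mem' := fun hv hw a ha => by
          rw [map_add]
          exact add_mem (hv a ha) (hw a ha)
        zero_mem' := fun a _ => by simp
        smul_mem' := fun c v hv a ha => by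
          rw [map_smul]
          exact S.smul_mem c (hv a ha) } (fun j => h2 (Sum.inl j)) fun j => h2 (Sum.inr j)
    have hP' : ∀ v, ∀ a ∈ S, opAd D.ω v a ∈ S := fun v => hP.ge Submodule.mem_top
    have hQ := B.eq_top_of_z
      { carrier := {v | ∀ a ∈ S, opL D.ω v a ∈ S}
        add_mem' := fun hv hw a ha => by
          rw [map_add]
          exact add_mem (hv a ha) (hw a ha)
        zero_mem' := fun a _ => by simp
        smul_mem' := fun c v hv a ha => by
          rw [map_smul]
          exact S.smul_mem c (hv a ha) }
      (fun j a ha => by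
        rw [opL_sub_eq]
        exact sub_mem (h3 (Sum.inl j) a ha) (hP' _ a ha))
      (fun j a ha => by
        rw [opL_eq]
        exact add_mem (h3 (Sum.inr j) a ha) (S.smul_mem _ (hP' _ a ha)))
    exact eq_top_of_opL_mem S (h1 (Submodule.mem_span_singleton_self 1)) fun x a ha =>
      (hQ.ge Submodule.mem_top : ∀ a ∈ S, opL D.ω x a ∈ S) a ha

end AdaptedBasis
end SymplecticAction

/-! ### Splitting off the kernel of an operator by a polynomial relation -/

namespace LinearMap

open Polynomial

variable {k : Type*} [Field k] {X Y : Type*} [AddCommGroup X] [Module k X]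
  [AddCommGroup Y] [Module k Y]

theorem apply_aeval {T : Module.End k X} {S : Module.End k Y} (f : X →ₗ[k] Y)
    (h : ∀ x, f (T x) = S (f x)) (p : k[X]) (x : X) : f (aeval T p x) = aeval S p (f x) := by
  induction p using Polynomial.induction_on' generalizing x with
  | add p q hp hq => simp [hp, hq]
  | monomial n c =>
    rw [aeval_monomial, aeval_monomial]
    simp only [Module.End.mul_apply, Module.algebraMap_end_apply, map_smul]
    congr 1
    induction n generalizing x with
    | zero => simp
    | succ n ih => rw [pow_succ, pow_succ, Module.End.mul_apply, Module.End.mul_apply, ih, h]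

variable (T : Module.End k X)

theorem aeval_eq_apply_add (q : k[X]) (x : X) :
    aeval T q x = T (aeval T q.divX x) + q.coeff 0 • x := by
  rw [apply_aeval (T := T) T (fun _ => rfl)]
  conv_lhs => rw [← divX_mul_X_add q]
  simp

/-- Since q(T)x differs from q(0)x by an element of T(X), the multiple q(0)⁻¹ q(T)x is the component
of x in the kernel of T. -/
theorem exists_sub_mem_ker {q : k[X]} (hq : q.coeff 0 ≠ 0) {x : X} (hx : T (aeval T q x) = 0) :
    ∃ u : k[X], T (x - T (aeval T u x)) = 0 := by
  refine ⟨C (-(q.coeff 0)⁻¹) * q.divX, ?_⟩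
  have h : x - T (aeval T (C (-(q.coeff 0)⁻¹) * q.divX) x) = (q.coeff 0)⁻¹ • aeval T q x := by
    rw [aeval_eq_apply_add T q x, smul_add, smul_smul, inv_mul_cancel₀ hq]
    simp [Module.algebraMap_end_apply, add_comm]
  rw [h, map_smul, hx, smul_zero]

theorem apply_eq_zero_of_apply_apply {q : k[X]} (hq : q.coeff 0 ≠ 0) {x : X}
    (hx : T (aeval T q x) = 0) (h : T (T x) = 0) : T x = 0 := by
  have h1 := aeval_eq_apply_add T q x
  have h2 := congr_arg T h1
  rw [hx, map_add, map_smul, apply_aeval (T := T) T (fun _ => rfl),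
    apply_aeval (T := T) T (fun _ => rfl), h, map_zero, zero_add] at h2
  exact (smul_eq_zero.1 h2.symm).resolve_left hq

end LinearMap

namespace Oscillator

open Polynomial

variable {k : Type*} [Field k] {X : Type*} [AddCommGroup X] [Module k X]
  {J : Type*} [Fintype J] [DecidableEq J] {a a' : J → X →ₗ[k] X} {G : Submodule k X}

/-- On level n the shifted number operator is n + c, which is either 0 or a root m + 1 of the
product once N ≥ n + c. A general vector involves finitely many levels. -/
theorem IsSystem.exists_aeval_eq_zero [CharZero k] (h : IsSystem a a' G) (c : ℕ) (x : X) :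
    ∃ N₀ : ℕ, ∀ N ≥ N₀, ∀ S : Module.End k X, (∀ y, S y = number a a' y + (c : k) • y) →
      S (aeval S (∏ m ∈ Finset.range N, (Polynomial.X - C ((m : k) + 1))) x) = 0 := by
  have hx : x ∈ ⨆ n, level a' G n := by
    rw [h.iSup_level]
    trivial
  induction hx using Submodule.iSup_induction' with
  | mem n x hx =>
    refine ⟨n + c, fun N hN S hS => ?_⟩
    have h1 : S x = ((n + c : ℕ) : k) • x := by
      rw [hS, h.number_eq n hx, ← add_smul, Nat.cast_add]
    rw [Module.End.aeval_apply_of_mem_apply_eq_smul h1, map_smul, h1, smul_smul]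
    refine smul_eq_zero_of_left ?_ _
    rcases Nat.eq_zero_or_pos (n + c) with h0 | h0
    · simp [h0]
    · rw [eval_prod, Finset.prod_eq_zero (i := n + c - 1), zero_mul]
      · rw [Finset.mem_range]
        omega
      · obtain ⟨m, hm⟩ : ∃ m, n + c = m + 1 := ⟨n + c - 1, by omega⟩
        simp [hm]
  | zero => exact ⟨0, fun N _ S _ => by simp⟩
  | add x y _ _ hx hy =>
    obtain ⟨N₁, h1⟩ := hx
    obtain ⟨N₂, h2⟩ := hy
    refine ⟨max N₁ N₂, fun N hN S hS => ?_⟩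
    rw [map_add, map_add, h1 N (le_trans (le_max_left _ _) hN) S hS,
      h2 N (le_trans (le_max_right _ _) hN) S hS, add_zero]

end Oscillator

/-! ### Harmonic forms of the twisted Koszul complex -/

namespace SymplecticAction

open WeylAlgebra

variable {D : SymplecticAction.{u, v}}

namespace AdaptedBasis

variable {g : D.G} (B : AdaptedBasis g)

/-- The laplacian of the twisted Koszul complex. -/
abbrev lap (n : ℕ) : Module.End ℂ (D.V [⋀^Fin n]→ₗ[ℂ] D.Weyl) :=
  Koszul.laplacian B.b B.contract (tw g) n

/-- The contributions of the basis vectors to the eigenvalues of the laplacian. -/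
def sign : Fin (Module.finrank ℂ (moved g)) ⊕ Fin B.s → ℤ :=
  Sum.elim (fun _ => -1) fun _ => 1

/-- In moved directions the homotopy and the differential meet in the order lower-raise, which gives
one extra unit per moved basis vector; in fixed directions the order is already raise-lower. The
arguments of the form add their signs. -/
theorem lap_apply {n : ℕ} (κ : D.V [⋀^Fin n]→ₗ[ℂ] D.Weyl)
    (I : Fin n → Fin (Module.finrank ℂ (moved g)) ⊕ Fin B.s) :
    B.lap n κ (fun i => B.b (I i)) =
      Oscillator.number B.lower B.raise (κ fun i => B.b (I i)) +
        ((Module.finrank ℂ (moved g) + ∑ i, B.sign (I i) : ℤ) : ℂ) • κ fun i => B.b (I i) := by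
  let γ : Fin (Module.finrank ℂ (moved g)) ⊕ Fin B.s → D.V → ℂ :=
    Sum.elim (fun j x => -D.ω (B.w j) (x - D.ρ g x)) fun j x => D.ω x (B.z j)
  have hγ : ∀ x j a, tw g x (B.contract j a) = B.contract j (tw g x a) + γ j x • a := by
    rintro x (j | j) a
    · exact tw_opAd g _ _ a
    · exact tw_opM g (B.fixed_z j) _ a
  have hb : ∀ i, ∑ j, γ j (B.b i) • B.b j = (B.sign i : ℂ) • B.b i := by
    rintro (i | i)
    · simp only [γ, sign, Fintype.sum_sum_type, Sum.elim_inl, Sum.elim_inr, B.dual_w,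
        form_moved_fixed (B.fixed_z _) (B.moved_mem i)]
      simp
    · simp [γ, sign, B.dual_z, B.fixed_b]
  rw [lap, Koszul.laplacian_apply hγ]
  simp only [hb, AlternatingMap.map_update_smul, Function.update_eq_self, ← Finset.sum_smul]
  rw [Oscillator.number_apply]
  simp only [Fintype.sum_sum_type, contract, lower, raise, Sum.elim_inl, Sum.elim_inr, opAd_tw,
    B.dual_w, tw_of_fixed g (B.fixed_b _), Finset.sum_add_distrib]
  simp only [if_true, Finset.sum_const, Finset.card_univ, Fintype.card_fin, Int.cast_add,
    Int.cast_sum, Int.cast_natCast, add_smul, Nat.cast_smul_eq_nsmul, one_smul]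
  abel

/-- For distinct indices the integer counts the moved basis vectors absent from I and the fixed ones
present in I. It vanishes only when I lists exactly the moved basis vectors. -/
theorem exists_nat {n : ℕ} (I : Fin n → Fin (Module.finrank ℂ (moved g)) ⊕ Fin B.s)
    (hI : Function.Injective I) :
    ∃ c : ℕ, (Module.finrank ℂ (moved g) + ∑ i, B.sign (I i) : ℤ) = c ∧
      (c = 0 → n = Module.finrank ℂ (moved g) ∧ ∀ i, ∃ j, I i = Sum.inl j) := by
  let s₁ := Finset.univ.filter fun i => (I i).isLeft
  let s₂ := Finset.univ.filter fun i => ¬(I i).isLeft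
  have h1 : s₁.card ≤ Module.finrank ℂ (moved g) := by
    have : (s₁.image I).card ≤ ((Finset.univ : Finset (Fin (Module.finrank ℂ (moved g)))).image
        (Sum.inl : _ → _ ⊕ Fin B.s)).card := by
      refine Finset.card_le_card fun x hx => ?_
      obtain ⟨i, hi, rfl⟩ := Finset.mem_image.1 hx
      obtain ⟨j, hj⟩ := Sum.isLeft_iff.1 (Finset.mem_filter.1 hi).2
      exact Finset.mem_image.2 ⟨j, Finset.mem_univ _, hj.symm⟩
    rw [Finset.card_image_of_injective _ hI] at this
    exact this.trans (Finset.card_image_le.trans (by simp))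
  have h2 : s₁.card + s₂.card = n := by
    exact (Finset.card_filter_add_card_filter_not _).trans (by simp)
  have h3 : ∑ i, B.sign (I i) = s₂.card - s₁.card := by
    have hs : ∀ i, B.sign (I i) =
        (if ¬(I i).isLeft then 1 else 0) - if (I i).isLeft then 1 else 0 := by
      intro i
      rcases I i with j | j <;> simp [sign]
    simp only [hs, Finset.sum_sub_distrib, s₁, s₂, Finset.card_filter, Nat.cast_sum, Nat.cast_ite,
      Nat.cast_one, Nat.cast_zero]
  refine ⟨Module.finrank ℂ (moved g) - s₁.card + s₂.card, by omega, fun hc => ⟨by omega, fun i => ?_⟩⟩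
  have h4 : s₂ = ∅ := Finset.card_eq_zero.1 (by omega)
  refine Sum.isLeft_iff.1 ?_
  by_contra hi
  exact Finset.notMem_empty i (h4 ▸ Finset.mem_filter.2 ⟨Finset.mem_univ i, hi⟩)

theorem lap_eq {n : ℕ} (I : Fin n → Fin (Module.finrank ℂ (moved g)) ⊕ Fin B.s)
    (hI : Function.Injective I) : ∃ c : ℕ, (c = 0 → n = Module.finrank ℂ (moved g) ∧ ∀ i, ∃ j, I i = Sum.inl j) ∧
    ∀ κ, B.lap n κ (fun i => B.b (I i)) =
      Oscillator.number B.lower B.raise (κ fun i => B.b (I i)) + (c : ℂ) • κ fun i => B.b (I i) := by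
  obtain ⟨c, hc, hc0⟩ := B.exists_nat I hI
  refine ⟨c, hc0, fun κ => ?_⟩
  rw [B.lap_apply, hc]
  simp

/-- Evaluation at basis vectors intertwines the laplacian with a shifted number operator. There are
finitely many index families I, so one product with roots 1, …, N serves them all, and 0 is not
among its roots. -/
theorem exists_aeval_lap {n : ℕ} (κ : D.V [⋀^Fin n]→ₗ[ℂ] D.Weyl) :
    ∃ q : Polynomial ℂ, q.coeff 0 ≠ 0 ∧ B.lap n (Polynomial.aeval (B.lap n) q κ) = 0 := by
  have h1 : ∀ I : Fin n → Fin (Module.finrank ℂ (moved g)) ⊕ Fin B.s, ∃ N₀ : ℕ, ∀ N ≥ N₀,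
      Function.Injective I →
      B.lap n (Polynomial.aeval (B.lap n) (∏ m ∈ Finset.range N,
        (Polynomial.X - Polynomial.C ((m : ℂ) + 1))) κ) (fun i => B.b (I i)) = 0 := by
    intro I
    by_cases hI : Function.Injective I
    swap
    · exact ⟨0, fun _ _ h => (hI h).elim⟩
    obtain ⟨c, -, hc⟩ := B.lap_eq I hI
    obtain ⟨N₀, hN⟩ := B.isSystem.exists_aeval_eq_zero c (κ fun i => B.b (I i))
    refine ⟨N₀, fun N hN' _ => ?_⟩
    let S : Module.End ℂ D.Weyl :=
      Oscillator.number B.lower B.raise + (c : ℂ) • LinearMap.id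
    let ev : (D.V [⋀^Fin n]→ₗ[ℂ] D.Weyl) →ₗ[ℂ] D.Weyl :=
      { toFun := fun κ => κ fun i => B.b (I i)
        map_add' := fun _ _ => rfl
        map_smul' := fun _ _ => rfl }
    have hev : ∀ κ, ev (B.lap n κ) = S (ev κ) := fun κ => hc κ
    change ev (B.lap n _) = 0
    rw [hev, LinearMap.apply_aeval ev hev]
    exact hN N hN' S fun y => rfl
  choose N₀ hN using h1
  refine ⟨∏ m ∈ Finset.range (Finset.univ.sup N₀),
    (Polynomial.X - Polynomial.C ((m : ℂ) + 1)), ?_, ?_⟩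
  · rw [Polynomial.coeff_zero_eq_eval_zero, Polynomial.eval_prod, Finset.prod_ne_zero_iff]
    intro m _
    simpa using (Nat.cast_add_one_ne_zero m : (m : ℂ) + 1 ≠ 0) ∘ fun h => by linear_combination -h
  · refine Module.Basis.ext_alternating B.b fun I hI => ?_
    exact hN I _ (Finset.le_sup (f := N₀) (Finset.mem_univ I)) hI

theorem lap_commute (n : ℕ) (κ : D.V [⋀^Fin n]→ₗ[ℂ] D.Weyl) :
    Koszul.d (tw g) n (B.lap n κ) = B.lap (n + 1) (Koszul.d (tw g) n κ) :=
  (Koszul.laplacian_d (tw_comm g) n κ).symm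

/-- The complement of the harmonic part is the laplacian of a polynomial in the laplacian applied to
κ, that is, the laplacian of a cocycle. -/
theorem exists_sub_mem_exact {n : ℕ} {κ : D.V [⋀^Fin n]→ₗ[ℂ] D.Weyl}
    (hκ : Koszul.d (tw g) n κ = 0) :
    ∃ κ₀, B.lap n κ₀ = 0 ∧ κ - κ₀ ∈ Koszul.exact (tw g) n := by
  obtain ⟨q, hq, h⟩ := B.exists_aeval_lap κ
  obtain ⟨p, hp⟩ := LinearMap.exists_sub_mem_ker (B.lap n) hq h
  refine ⟨_, hp, ?_⟩
  rw [sub_sub_cancel]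
  refine Koszul.laplacian_mem_exact n ?_
  rw [LinearMap.apply_aeval (Koszul.d (tw g) n) (B.lap_commute n), hκ, map_zero]

theorem apply_eq_zero {n : ℕ} {κ : D.V [⋀^Fin n]→ₗ[ℂ] D.Weyl} (hκ : B.lap n κ = 0)
    {I : Fin n → Fin (Module.finrank ℂ (moved g)) ⊕ Fin B.s} (hI : Function.Injective I)
    (h : ¬(n = Module.finrank ℂ (moved g) ∧ ∀ i, ∃ j, I i = Sum.inl j)) :
    (κ fun i => B.b (I i)) = 0 := by
  obtain ⟨c, hc0, hc⟩ := B.lap_eq I hI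
  have h1 := hc κ
  rw [hκ] at h1
  exact B.isSystem.eq_zero_of_number_eq c (fun h0 => h (hc0 h0)) h1.symm

theorem apply_mem_span {n : ℕ} {κ : D.V [⋀^Fin n]→ₗ[ℂ] D.Weyl} (hκ : B.lap n κ = 0)
    {I : Fin n → Fin (Module.finrank ℂ (moved g)) ⊕ Fin B.s} (hI : Function.Injective I) :
    (κ fun i => B.b (I i)) ∈ Submodule.span ℂ {(1 : D.Weyl)} := by
  obtain ⟨c, -, hc⟩ := B.lap_eq I hI
  have h1 := hc κ
  rw [hκ] at h1
  by_cases h0 : c = 0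
  · refine B.isSystem.mem_of_number_eq_zero ?_
    simpa [h0] using h1.symm
  · rw [B.isSystem.eq_zero_of_number_eq c h0 h1.symm]
    exact zero_mem _

theorem eq_zero_of_lap {n : ℕ} {κ : D.V [⋀^Fin n]→ₗ[ℂ] D.Weyl} (hκ : B.lap n κ = 0)
    (hn : n ≠ Module.finrank ℂ (moved g)) : κ = 0 :=
  Module.Basis.ext_alternating B.b fun _ hI => B.apply_eq_zero hκ hI fun h => hn h.1

/-- A primitive lives one degree lower, where there are no nonzero harmonic forms, so it lies in the
image of the laplacian. Hence κ is in both its image and its kernel, which meet in 0. -/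
theorem eq_zero_of_mem_exact {n : ℕ} {κ : D.V [⋀^Fin n]→ₗ[ℂ] D.Weyl} (hκ : B.lap n κ = 0)
    (hn : n = Module.finrank ℂ (moved g)) (h : κ ∈ Koszul.exact (tw g) n) : κ = 0 := by
  cases n with
  | zero => exact h
  | succ n =>
    obtain ⟨ν, rfl⟩ := h
    obtain ⟨q, hq, hν⟩ := B.exists_aeval_lap ν
    obtain ⟨p, hp⟩ := LinearMap.exists_sub_mem_ker (B.lap n) hq hν
    have h1 := B.eq_zero_of_lap hp (by omega)
    rw [sub_eq_zero] at h1
    rw [h1, B.lap_commute] at hκ ⊢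
    obtain ⟨q', hq', hν'⟩ := B.exists_aeval_lap
      (Koszul.d (tw g) n (Polynomial.aeval (B.lap n) p ν))
    exact LinearMap.apply_eq_zero_of_apply_apply _ hq' hν' hκ

end AdaptedBasis

/-! ### The canonical forms of group elements -/

/-- The two-form `ω ((1 - g) x) ((1 - g) y)`. -/
def twoForm (g : D.G) : D.V →ₗ[ℂ] D.V →ₗ[ℂ] ℂ := D.ω.compl₁₂ (1 - D.ρ g) (1 - D.ρ g)

theorem twoForm_apply (g : D.G) (x y : D.V) :
    twoForm g x y = D.ω (x - D.ρ g x) (y - D.ρ g y) := rfl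

theorem twoForm_isAlt (g : D.G) : (twoForm g).IsAlt := fun _ => D.alternating.self_eq_zero _

/-- Otherwise x - gx would be orthogonal to (1 - g)(V), which is the moved space, and to the fixed
space, so x would be fixed as well as moved. -/
theorem exists_twoForm_ne_zero (g : D.G) {x : D.V} (hx : x ∈ moved g) (hx0 : x ≠ 0) :
    ∃ y ∈ moved g, twoForm g x y ≠ 0 := by
  have hc := isCompl_moved_fixed g
  have hdec : ∀ y : D.V, ∃ u ∈ moved g, ∃ f, D.ρ g f = f ∧ u + f = y := by
    intro y
    obtain ⟨u, hu, f, hf, h⟩ := Submodule.mem_sup.1 (hc.sup_eq_top.ge (Submodule.mem_top (x := y)))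
    exact ⟨u, hu, f, mem_fixed.1 hf, h⟩
  by_contra! H
  refine hx0 (Submodule.disjoint_def.1 hc.disjoint x hx (mem_fixed.2 (sub_eq_zero.1 ?_).symm))
  refine D.nondegenerate.1 _ fun y => ?_
  obtain ⟨u, ⟨u', rfl⟩, f, hf, rfl⟩ := hdec y
  obtain ⟨u, hu, f', hf', rfl⟩ := hdec u'
  rw [map_add, form_moved_fixed hf (sub_mem_moved g x), add_zero]
  have h1 := H u hu
  rw [twoForm_apply] at h1
  simpa [hf'] using h1

/-- The canonical `n`-form of `g`. -/
def tau (g : D.G) (n : ℕ) : D.V [⋀^Fin n]→ₗ[ℂ] ℂ := Koszul.powForm (twoForm g) n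

theorem tau_ne_zero (g : D.G) {n : ℕ} (hn : n = Module.finrank ℂ (moved g)) : tau g n ≠ 0 := by
  obtain ⟨x, -, hx⟩ := Koszul.exists_powForm_ne_zero (twoForm_isAlt g) n (moved g)
    (fun _ => exists_twoForm_ne_zero g) hn.symm
  exact fun h => hx (by rw [← tau, h, AlternatingMap.zero_apply])

theorem tau_eq_zero (g : D.G) {n : ℕ} (x : Fin n → D.V) (i : Fin n) (hi : D.ρ g (x i) = x i) :
    tau g n x = 0 := by
  refine Koszul.powForm_eq_zero (twoForm_isAlt g) x i ?_
  ext y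
  simp [twoForm_apply, hi]

/-- The canonical `n`-form of `g`, with values in the Weyl algebra. -/
def tauOne (g : D.G) (n : ℕ) : D.V [⋀^Fin n]→ₗ[ℂ] D.Weyl :=
  (LinearMap.toSpanSingleton ℂ D.Weyl 1).compAlternatingMap (tau g n)

theorem tauOne_apply (g : D.G) (n : ℕ) (x : Fin n → D.V) : tauOne g n x = tau g n x • 1 := rfl

theorem tauOne_ne_zero (g : D.G) {n : ℕ} (hn : n = Module.finrank ℂ (moved g)) :
    tauOne g n ≠ 0 := by
  have := nontrivial_of_finiteDimensional D.alternating
  intro h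
  refine tau_ne_zero g hn ?_
  ext x
  have h1 := AlternatingMap.congr_fun h x
  rw [tauOne_apply, AlternatingMap.zero_apply] at h1
  exact (smul_eq_zero.1 h1).resolve_right one_ne_zero

theorem AdaptedBasis.lap_tauOne {g : D.G} (B : AdaptedBasis g) {n : ℕ}
    (hn : n = Module.finrank ℂ (moved g)) : B.lap n (tauOne g n) = 0 := by
  refine Module.Basis.ext_alternating B.b fun I hI => ?_
  rw [B.lap_apply, tauOne_apply, AlternatingMap.zero_apply]
  by_cases h : ∀ i, ∃ j, I i = Sum.inl j
  · have h1 : ∀ i, B.sign (I i) = -1 := fun i => by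
      obtain ⟨j, hj⟩ := h i
      rw [hj]
      rfl
    have h2 : Oscillator.number B.lower B.raise (1 : D.Weyl) = 0 := by
      simp only [Oscillator.number_apply, B.isSystem.vacuum _ _ (Submodule.mem_span_singleton_self 1),
        map_zero, Finset.sum_const_zero]
    simp [h1, h2, ← hn]
  · push Not at h
    obtain ⟨i, hi⟩ := h
    obtain ⟨j, hj⟩ : ∃ j, I i = Sum.inr j := by
      rcases hIi : I i with j | j
      exacts [(hi j hIi).elim, ⟨j, rfl⟩]
    rw [tau_eq_zero g _ i (by rw [hj, B.fixed_b])]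
    simp

/-- The differential of a harmonic form is harmonic, and harmonic forms vanish one degree above the
rank. -/
theorem d_tauOne (g : D.G) {n : ℕ} (hn : n = Module.finrank ℂ (moved g)) :
    Koszul.d (tw g) n (tauOne g n) = 0 := by
  obtain ⟨B⟩ := exists_adaptedBasis g
  refine B.eq_zero_of_lap ?_ (by omega)
  rw [← B.lap_commute, B.lap_tauOne hn, map_zero]

theorem eq_zero_of_smul_tauOne_mem_exact (g : D.G) {n : ℕ}
    (hn : n = Module.finrank ℂ (moved g)) {c : ℂ}
    (h : c • tauOne g n ∈ Koszul.exact (tw g) n) : c = 0 := by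
  obtain ⟨B⟩ := exists_adaptedBasis g
  have h1 := B.eq_zero_of_mem_exact (by rw [map_smul, B.lap_tauOne hn, smul_zero]) hn h
  exact (smul_eq_zero.1 h1).resolve_right (tauOne_ne_zero g hn)

theorem mem_exact_of_ne (g : D.G) {n : ℕ} (hn : n ≠ Module.finrank ℂ (moved g))
    {κ : D.V [⋀^Fin n]→ₗ[ℂ] D.Weyl} (hκ : Koszul.d (tw g) n κ = 0) :
    κ ∈ Koszul.exact (tw g) n := by
  obtain ⟨B⟩ := exists_adaptedBasis g
  obtain ⟨κ₀, h0, h⟩ := B.exists_sub_mem_exact hκ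
  rwa [B.eq_zero_of_lap h0 hn, sub_zero] at h

theorem exists_sub_smul_tauOne_mem_exact (g : D.G) {n : ℕ}
    (hn : n = Module.finrank ℂ (moved g)) {κ : D.V [⋀^Fin n]→ₗ[ℂ] D.Weyl}
    (hκ : Koszul.d (tw g) n κ = 0) : ∃ c : ℂ, κ - c • tauOne g n ∈ Koszul.exact (tw g) n := by
  obtain ⟨B⟩ := exists_adaptedBasis g
  obtain ⟨κ₀, h0, h⟩ := B.exists_sub_mem_exact hκ
  suffices H : ∃ c : ℂ, κ₀ = c • tauOne g n by
    obtain ⟨c, rfl⟩ := H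
    exact ⟨c, h⟩
  subst hn
  -- A harmonic form is determined by its value on the moved basis vectors, which is a multiple of
  -- 1; so harmonic forms make up a line, spanned by the canonical form.
  have key : ∀ μ : D.V [⋀^Fin (Module.finrank ℂ (moved g))]→ₗ[ℂ] D.Weyl, B.lap _ μ = 0 →
      (μ fun i => B.b (Sum.inl i)) = 0 → μ = 0 := by
    intro μ hμ hμ0
    refine Module.Basis.ext_alternating B.b fun I hI => ?_
    by_cases hI' : ∀ i, ∃ j, I i = Sum.inl j
    · choose σ hσ using hI'
      have hσi : Function.Injective σ := fun i j hij => hI (by rw [hσ, hσ, hij])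
      let σ' := Equiv.ofBijective σ (Finite.injective_iff_bijective.1 hσi)
      have h1 := μ.map_perm (fun i => B.b (Sum.inl i)) σ'
      rw [hμ0, smul_zero] at h1
      simp only [hσ]
      exact h1
    · exact B.apply_eq_zero hμ hI fun h => hI' h.2
  have h1 : tau g _ (fun i => B.b (Sum.inl i)) ≠ 0 := by
    intro h1
    exact tauOne_ne_zero g rfl (key _ (B.lap_tauOne rfl) (by rw [tauOne_apply, h1, zero_smul]))
  obtain ⟨c, hc⟩ := Submodule.mem_span_singleton.1 (B.apply_mem_span h0 Sum.inl_injective)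
  refine ⟨c * (tau g _ fun i => B.b (Sum.inl i))⁻¹, sub_eq_zero.1 (key _ ?_ ?_)⟩
  · rw [map_sub, map_smul, h0, B.lap_tauOne rfl, smul_zero, sub_zero]
  · rw [AlternatingMap.sub_apply, AlternatingMap.smul_apply, tauOne_apply, smul_smul, mul_assoc,
      inv_mul_cancel₀ h1, mul_one, hc, sub_self]

end SymplecticAction

/-! ### The Koszul complex of the semidirect product -/

namespace SymplecticAction

open Hochschild Bimodule WeylAlgebra SkewMonoidAlgebra

variable {D : SymplecticAction.{u, v}}

/-- The coefficients of an element of `G ⋉ Weyl(V)`. -/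
def coeffs (D : SymplecticAction.{u, v}) : D.Semidirect ≃ₗ[ℂ] (D.G → D.Weyl) :=
  coeffLinearEquiv.trans (Finsupp.linearEquivFunOnFinite ℂ D.Weyl D.G)

theorem coeffs_single_same (g : D.G) (a : D.Weyl) : D.coeffs (single g a) g = a := by
  change Finsupp.single g a g = a
  simp

theorem coeffs_single_of_ne {g h : D.G} (hgh : g ≠ h) (a : D.Weyl) :
    D.coeffs (single g a) h = 0 := by
  change Finsupp.single g a h = 0
  simp [hgh.symm]

variable (D) in
/-- The regular bimodule of `G ⋉ Weyl(V)`. -/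
abbrev regular : Bimodule ℂ D.Semidirect D.Semidirect := Bimodule.self ℂ D.Semidirect

/-- Moving x to the left past g turns it into g(x), so the commutator preserves the coefficient at g
and acts there by the twisted commutator. This splits the Koszul complex over G. -/
theorem coeffs_ad (x : D.V) (b : D.Semidirect) (g : D.G) :
    D.coeffs (ad D.regular x b) g = tw g x (D.coeffs b g) := by
  refine linearMap_ext (φ := LinearMap.proj g ∘ₗ D.coeffs.toLinearMap ∘ₗ ad D.regular x)
    (ψ := tw g x ∘ₗ LinearMap.proj g ∘ₗ D.coeffs.toLinearMap) (fun h a => ?_) b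
  have h1 : ad D.regular x (single h a) = single h (tw h x a) := by
    rw [ad_apply]
    change D.vec x * single h a - single h a * D.vec x = _
    rw [vec_mul_single, single_mul_vec, tw_apply, ← lsingle_apply (R := ℂ),
      ← lsingle_apply (R := ℂ), ← lsingle_apply (R := ℂ), map_sub]
  simp only [LinearMap.comp_apply, LinearMap.proj_apply, LinearEquiv.coe_coe, h1]
  by_cases hgh : h = g
  · subst hgh
    rw [coeffs_single_same, coeffs_single_same]
  · rw [coeffs_single_of_ne hgh, coeffs_single_of_ne hgh, map_zero]

/-- The coefficient at `g` of a form. -/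
def component (g : D.G) (n : ℕ) : D.V [⋀^Fin n]→ₗ[ℂ] D.Semidirect →ₗ[ℂ] D.V [⋀^Fin n]→ₗ[ℂ] D.Weyl :=
  Koszul.pull LinearMap.id (LinearMap.proj g ∘ₗ D.coeffs.toLinearMap) n

theorem component_apply (g : D.G) (n : ℕ) (κ : D.V [⋀^Fin n]→ₗ[ℂ] D.Semidirect)
    (x : Fin n → D.V) : component g n κ x = D.coeffs (κ x) g := rfl

theorem form_ext {n : ℕ} {κ κ' : D.V [⋀^Fin n]→ₗ[ℂ] D.Semidirect}
    (h : ∀ g, component g n κ = component g n κ') : κ = κ' := by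
  ext1 x
  refine D.coeffs.injective (funext fun g => ?_)
  exact AlternatingMap.congr_fun (h g) x

/-- The form with given coefficients. -/
def assemble {n : ℕ} (κ : D.G → D.V [⋀^Fin n]→ₗ[ℂ] D.Weyl) : D.V [⋀^Fin n]→ₗ[ℂ] D.Semidirect :=
  D.coeffs.symm.toLinearMap.compAlternatingMap (AlternatingMap.pi κ)

@[simp]
theorem component_assemble {n : ℕ} (κ : D.G → D.V [⋀^Fin n]→ₗ[ℂ] D.Weyl) (g : D.G) :
    component g n (assemble κ) = κ g := by
  ext1 x
  rw [component_apply]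
  change D.coeffs (D.coeffs.symm _) g = _
  rw [LinearEquiv.apply_symm_apply]
  rfl

theorem component_d (g : D.G) (n : ℕ) (κ : D.V [⋀^Fin n]→ₗ[ℂ] D.Semidirect) :
    component g (n + 1) (Koszul.d (ad D.regular) n κ) = Koszul.d (tw g) n (component g n κ) :=
  (Koszul.d_pull (fun y m => coeffs_ad y m g) n κ).symm

theorem component_mem_exact (g : D.G) {n : ℕ} {κ : D.V [⋀^Fin n]→ₗ[ℂ] D.Semidirect}
    (h : κ ∈ Koszul.exact (ad D.regular) n) : component g n κ ∈ Koszul.exact (tw g) n :=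
  Koszul.pull_mem_exact (fun y m => coeffs_ad y m g) h

theorem mem_exact_of_component {n : ℕ} {κ : D.V [⋀^Fin n]→ₗ[ℂ] D.Semidirect}
    (h : ∀ g, component g n κ ∈ Koszul.exact (tw g) n) : κ ∈ Koszul.exact (ad D.regular) n := by
  cases n with
  | zero => exact form_ext (κ' := 0) fun g => (h g).trans (map_zero _).symm
  | succ n =>
    choose ν hν using h
    exact ⟨assemble ν, form_ext fun g => by rw [component_d, component_assemble, hν]⟩

/-- The form whose coefficients are multiples of the canonical forms. -/
def canonical (n : ℕ) : (D.G → ℂ) →ₗ[ℂ] D.V [⋀^Fin n]→ₗ[ℂ] D.Semidirect where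
  toFun ψ := assemble fun g => ψ g • tauOne g n
  map_add' ψ ψ' := form_ext fun g => by simp [add_smul]
  map_smul' c ψ := form_ext fun g => by simp [mul_smul]

@[simp]
theorem component_canonical (n : ℕ) (ψ : D.G → ℂ) (g : D.G) :
    component g n (canonical n ψ) = ψ g • tauOne g n := component_assemble _ g

variable {n : ℕ} {ψ : D.G → ℂ}

theorem d_canonical (hψ : ∀ g ∉ D.rankSet n, ψ g = 0) :
    Koszul.d (ad D.regular) n (canonical n ψ) = 0 := by
  refine form_ext fun g => ?_
  rw [component_d, component_canonical, map_smul, map_zero]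
  by_cases hg : g ∈ D.rankSet n
  · rw [d_tauOne g hg.symm, smul_zero]
  · rw [hψ g hg, zero_smul]

theorem eq_zero_of_canonical_mem_exact (hψ : ∀ g ∉ D.rankSet n, ψ g = 0)
    (h : canonical n ψ ∈ Koszul.exact (ad D.regular) n) : ψ = 0 := by
  funext g
  by_cases hg : g ∈ D.rankSet n
  · have h1 := component_mem_exact g h
    rw [component_canonical] at h1
    exact eq_zero_of_smul_tauOne_mem_exact g hg.symm h1
  · exact hψ g hg

theorem exists_canonical {κ : D.V [⋀^Fin n]→ₗ[ℂ] D.Semidirect}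
    (hκ : Koszul.d (ad D.regular) n κ = 0) :
    ∃ ψ : D.G → ℂ, (∀ g ∉ D.rankSet n, ψ g = 0) ∧
      κ - canonical n ψ ∈ Koszul.exact (ad D.regular) n := by
  have h : ∀ g, ∃ c : ℂ, (g ∉ D.rankSet n → c = 0) ∧
      component g n κ - c • tauOne g n ∈ Koszul.exact (tw g) n := by
    intro g
    have hg' : Koszul.d (tw g) n (component g n κ) = 0 := by rw [← component_d, hκ, map_zero]
    by_cases hg : g ∈ D.rankSet n
    · obtain ⟨c, hc⟩ := exists_sub_smul_tauOne_mem_exact g hg.symm hg'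
      exact ⟨c, fun h => (h hg).elim, hc⟩
    · refine ⟨0, fun _ => rfl, ?_⟩
      rw [zero_smul, sub_zero]
      exact mem_exact_of_ne g (fun h => hg h.symm) hg'
  choose ψ h1 h2 using h
  refine ⟨ψ, h1, mem_exact_of_component fun g => ?_⟩
  rw [map_sub, component_canonical]
  exact h2 g

namespace Iso

variable {D' : SymplecticAction.{u, v}} (e : Iso D D')

theorem coeffs_semidirectEquiv (b : D.Semidirect) (g : D.G) :
    D'.coeffs (e.semidirectEquiv b) (e.θ g) = e.weylHom (D.coeffs b g) := by
  refine linearMap_ext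
    (φ := LinearMap.proj (e.θ g) ∘ₗ D'.coeffs.toLinearMap ∘ₗ e.semidirectEquiv.toLinearMap)
    (ψ := e.weylHom.toLinearMap ∘ₗ LinearMap.proj g ∘ₗ D.coeffs.toLinearMap) (fun h a => ?_) b
  change D'.coeffs (e.semidirectHom (single h a)) (e.θ g) = e.weylHom (D.coeffs (single h a) g)
  rw [semidirectHom_single]
  by_cases hgh : h = g
  · subst hgh
    rw [coeffs_single_same, coeffs_single_same]
  · rw [coeffs_single_of_ne hgh, coeffs_single_of_ne (e.θ.injective.ne hgh), map_zero]

theorem tau_map (g : D.G) (n : ℕ) (x : Fin n → D.V) :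
    tau (e.θ g) n (fun i => e.φ (x i)) = tau g n x :=
  Koszul.powForm_map e.φ.toLinearMap (fun x y => by
    simp only [twoForm_apply, LinearEquiv.coe_coe, ← e.map_act, ← map_sub, e.map_form]) n x

theorem pull_canonical (n : ℕ) (ψ : D.G → ℂ) :
    Koszul.pull e.φ.symm.toLinearMap e.semidirectEquiv.toLinearMap n (canonical n ψ) =
      canonical n (ψ ∘ e.θ.symm) := by
  refine form_ext fun g => ?_
  obtain ⟨g, rfl⟩ := e.θ.surjective g
  ext1 x
  rw [component_apply, Koszul.pull_apply]
  change D'.coeffs (e.semidirectEquiv _) _ = _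
  rw [coeffs_semidirectEquiv, ← component_apply, component_canonical, component_canonical]
  have h := e.tau_map g n fun i => e.φ.symm (x i)
  simp only [LinearEquiv.apply_symm_apply] at h
  simp [tauOne_apply, h]

end Iso

/-- Conjugation by an element of the group, as an automorphism. -/
def conjIso (g : D.G) : Iso D D where
  φ := LinearEquiv.ofLinearMap (D.ρ g) (D.ρ g⁻¹) (by ext; simp) (by ext; simp)
  θ := MulAut.conj g
  map_form := D.invariant g
  map_act h x := by simp

theorem conj_regular (g : D.G) (b : D.Semidirect) :
    conj D.regular g b = (conjIso g).semidirectEquiv b := by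
  refine linearMap_ext (ψ := (conjIso g).semidirectEquiv.toLinearMap) (fun h a => ?_) b
  change D.grp g * (single h a * D.grp g⁻¹) = (conjIso g).semidirectHom (single h a)
  rw [Iso.semidirectHom_single]
  simp only [grp, of_apply, single_mul_single, smul_one, mul_one, one_mul, ← mul_assoc]
  rfl

/-- Conjugation by g is itself an isomorphism of triples, so this is an instance of the naturality
of canonical forms. -/
theorem act_canonical (n : ℕ) (ψ : D.G → ℂ) (g : D.G) :
    act D.regular n g (canonical n ψ) = canonical n (fun h => ψ (g⁻¹ * h * g)) := by
  refine Eq.trans ?_ (((conjIso g).pull_canonical n ψ).trans ?_)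
  · ext1 x
    exact conj_regular g _
  · congr 1

theorem act_mem_exact {M : Type max u v} [AddCommGroup M] [Module ℂ M]
    (β : Bimodule ℂ D.Semidirect M) {n : ℕ} {κ : D.V [⋀^Fin n]→ₗ[ℂ] M}
    (hκ : κ ∈ Koszul.exact (ad β) n) (g : D.G) : act β n g κ ∈ Koszul.exact (ad β) n :=
  Koszul.pull_mem_exact (fun y m => by
    have h : D.ρ g (D.ρ g⁻¹ y) = y := by
      rw [← Module.End.mul_apply, ← map_mul, mul_inv_cancel, map_one, Module.End.one_apply]
    rw [conj_ad, h]) hκ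

theorem mem_exact_of_mem_invExact {M : Type max u v} [AddCommGroup M] [Module ℂ M]
    (β : Bimodule ℂ D.Semidirect M) {n : ℕ} {κ : D.V [⋀^Fin n]→ₗ[ℂ] M}
    (hκ : κ ∈ invExact β n) : κ ∈ Koszul.exact (ad β) n := by
  cases n with
  | zero => exact hκ
  | succ n =>
    obtain ⟨ν, -, hν⟩ := hκ
    exact ⟨ν, hν⟩

theorem rank_conj (g h : D.G) : g⁻¹ * h * g ∈ D.rankSet n ↔ h ∈ D.rankSet n := by
  constructor
  · intro H
    have := (conjIso g).mem_rankSet H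
    simpa [conjIso, mul_assoc] using this
  · intro H
    have := (conjIso g⁻¹).mem_rankSet H
    simpa [conjIso, mul_assoc] using this

theorem isInvCocycle_canonical (hψ : ∀ g ∉ D.rankSet n, ψ g = 0)
    (hψ' : ∀ g h, ψ (g⁻¹ * h * g) = ψ h) : IsInvCocycle D.regular n (canonical n ψ) :=
  ⟨d_canonical hψ, fun g => by rw [act_canonical]; simp only [hψ']⟩

theorem exists_invariant_canonical {κ : D.V [⋀^Fin n]→ₗ[ℂ] D.Semidirect}
    (hκ : IsInvCocycle D.regular n κ) :
    ∃ ψ : D.G → ℂ, (∀ g ∉ D.rankSet n, ψ g = 0) ∧ (∀ g h, ψ (g⁻¹ * h * g) = ψ h) ∧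
      κ - canonical n ψ ∈ invExact D.regular n := by
  obtain ⟨ψ, h1, h2⟩ := exists_canonical hκ.1
  have h3 : ∀ g h, ψ (g⁻¹ * h * g) = ψ h := by
    intro g h
    -- Since κ is invariant, ψ and its conjugate give cohomologous canonical forms, and canonical
    -- forms supported on S_n are exact only if zero.
    have h4 := sub_mem h2 (act_mem_exact D.regular h2 g)
    rw [map_sub, hκ.2, act_canonical, sub_sub_sub_cancel_left, ← map_sub] at h4
    have h5 := eq_zero_of_canonical_mem_exact (fun k hk => by
      rw [Pi.sub_apply, h1 k hk, h1 _ (by rwa [rank_conj]), sub_zero]) h4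
    exact sub_eq_zero.1 (congr_fun h5 h)
  refine ⟨ψ, h1, h3, mem_invExact_of_mem_exact _ _ h2 fun g => ?_⟩
  rw [map_sub, hκ.2, (isInvCocycle_canonical h1 h3).2]

/-! ### The isomorphism -/

/-- A linear relation that is bijective is the graph of a linear isomorphism. -/
theorem exists_linearEquiv_of_rel {k X Y : Type*} [Field k] [AddCommGroup X] [Module k X]
    [AddCommGroup Y] [Module k Y] (R : X → Y → Prop)
    (hR : ∀ (c : k) x x' y y', R x y → R x' y' → R (c • x + x') (c • y + y'))
    (hX : ∀ x, ∃ y, R x y) (hY : ∀ y, ∃ x, R x y) (h0 : ∀ y, R 0 y → y = 0)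
    (h0' : ∀ x, R x 0 → x = 0) : ∃ Φ : X ≃ₗ[k] Y, ∀ x y, R x y → Φ x = y := by
  have hu : ∀ x y y', R x y → R x y' → y = y' := by
    intro x y y' h h'
    have h1 := hR (-1) x x y y' h h'
    rw [neg_one_smul, neg_add_cancel, neg_one_smul] at h1
    exact neg_add_eq_zero.1 (h0 _ h1)
  choose F hF using hX
  have hR0 : R 0 0 := by
    have h1 := hR (-1) 0 0 _ _ (hF 0) (hF 0)
    rwa [neg_one_smul, neg_add_cancel, neg_one_smul, neg_add_cancel] at h1
  let L : X →ₗ[k] Y :=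
    { toFun := F
      map_add' := fun x x' => hu _ _ _ (hF _) (by simpa using hR 1 x x' _ _ (hF x) (hF x'))
      map_smul' := fun c x => hu _ _ _ (hF _) (by simpa using hR c x 0 _ _ (hF x) hR0) }
  refine ⟨LinearEquiv.ofBijective L ⟨?_, fun y => ?_⟩, fun x y h => hu _ _ _ (hF x) h⟩
  · rw [← LinearMap.ker_eq_bot, LinearMap.ker_eq_bot']
    intro x hx
    have h1 := hF x
    rw [show F x = 0 from hx] at h1
    exact h0' x h1
  · obtain ⟨x, hx⟩ := hY y
    exact ⟨x, hu _ _ _ (hF x) hx⟩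

/-- Extension of functions on `S_n` by zero. -/
abbrev extend (D : SymplecticAction.{u, v}) (n : ℕ) : (D.rankSet n → ℂ) →ₗ[ℂ] D.G → ℂ :=
  Function.ExtendByZero.linearMap ℂ Subtype.val

theorem extend_apply (ψ : D.rankSet n → ℂ) (g : D.rankSet n) : D.extend n ψ g = ψ g :=
  Subtype.val_injective.extend_apply ψ 0 g

theorem extend_of_notMem (ψ : D.rankSet n → ℂ) {g : D.G} (hg : g ∉ D.rankSet n) :
    D.extend n ψ g = 0 :=
  Function.extend_apply' ψ (0 : D.G → ℂ) g (by rintro ⟨h, rfl⟩; exact hg h.2)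

theorem extend_conj {ψ : D.rankSet n → ℂ} (hψ : ψ ∈ invariantFunctions (D.rankSet n)) (g h : D.G) :
    D.extend n ψ (g⁻¹ * h * g) = D.extend n ψ h := by
  by_cases hh : h ∈ D.rankSet n
  · have h1 := (rank_conj g h).2 hh
    rw [extend_apply ψ ⟨_, h1⟩, extend_apply ψ ⟨h, hh⟩]
    refine hψ _ _ (isConj_iff.2 ⟨g, ?_⟩)
    simp [mul_assoc]
  · rw [extend_of_notMem ψ hh, extend_of_notMem ψ (by rwa [rank_conj])]

theorem extend_restrict (hψ : ∀ g ∉ D.rankSet n, ψ g = 0) :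
    D.extend n (fun g => ψ g) = ψ := by
  funext g
  by_cases hg : g ∈ D.rankSet n
  · exact extend_apply _ ⟨g, hg⟩
  · rw [extend_of_notMem _ hg, hψ g hg]

theorem restrict_mem (hψ' : ∀ g h, ψ (g⁻¹ * h * g) = ψ h) :
    (fun g : D.rankSet n => ψ g) ∈ invariantFunctions (D.rankSet n) := by
  intro s t hst
  obtain ⟨c, hc⟩ := isConj_iff.1 hst
  change ψ s = ψ t
  rw [← hc, ← hψ' c (c * s * c⁻¹)]
  simp [mul_assoc]

theorem Rel.sub {M : Type max u v} [AddCommGroup M] [Module ℂ M] {β : Bimodule ℂ D.Semidirect M}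
    {f f' : Bimodule.Cochain ℂ D.Semidirect M n} {κ κ' : D.V [⋀^Fin n]→ₗ[ℂ] M}
    (h : D.Rel n β f κ) (h' : D.Rel n β f' κ') : D.Rel n β (f - f') (κ - κ') := by
  have h1 := h'.smul_add h (-1)
  rwa [neg_one_smul, neg_one_smul, neg_add_eq_sub, neg_add_eq_sub] at h1

/-- The relation between cohomology classes and invariant functions. -/
def Corresponds (D : SymplecticAction.{u, v}) (n : ℕ) (x : D.cohomology n)
    (ψ : invariantFunctions (D.rankSet n)) : Prop :=
  ∃ f : cocycles ℂ D.Semidirect n, Submodule.Quotient.mk f = x ∧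
    D.Rel n D.regular f (canonical n (D.extend n ψ.1))

theorem mk_eq_zero_iff (f : cocycles ℂ D.Semidirect n) :
    (Submodule.Quotient.mk f : D.cohomology n) = 0 ↔
      (f : Hochschild.Cochain ℂ D.Semidirect n) ∈ boundaries D.regular n := by
  rw [Submodule.Quotient.mk_eq_zero, boundaries_self]
  rfl

theorem Iso.isHom_regular {D' : SymplecticAction.{u, v}} (e : Iso D D') :
    D.regular.IsHom D'.regular e.semidirectEquiv e.semidirectEquiv.toLinearMap where
  l b m := map_mul e.semidirectEquiv b m
  r b m := map_mul e.semidirectEquiv m b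

namespace Corresponds

theorem smul_add {x x' : D.cohomology n} {ψ ψ' : invariantFunctions (D.rankSet n)}
    (h : D.Corresponds n x ψ) (h' : D.Corresponds n x' ψ') (c : ℂ) :
    D.Corresponds n (c • x + x') (c • ψ + ψ') := by
  obtain ⟨f, rfl, hf⟩ := h
  obtain ⟨f', rfl, hf'⟩ := h'
  refine ⟨c • f + f', rfl, ?_⟩
  have h1 := hf.smul_add hf' c
  rw [← map_smul, ← map_add, ← map_smul, ← map_add] at h1
  exact h1

theorem exists_left (ψ : invariantFunctions (D.rankSet n)) : ∃ x, D.Corresponds n x ψ := by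
  obtain ⟨f, hf⟩ := Rel.exists_left D.regular (isInvCocycle_canonical (n := n)
    (fun g hg => extend_of_notMem ψ.1 hg) (extend_conj ψ.2))
  have h1 := hf.d_eq_zero
  rw [d_self] at h1
  exact ⟨_, ⟨f, h1⟩, rfl, hf⟩

theorem exists_right (x : D.cohomology n) : ∃ ψ, D.Corresponds n x ψ := by
  obtain ⟨f, rfl⟩ := Submodule.Quotient.mk_surjective _ x
  obtain ⟨κ, hκ⟩ := Rel.exists_right D.regular (f := f.1) (by rw [d_self]; exact f.2)
  obtain ⟨ψ, h1, h2, h3⟩ := exists_invariant_canonical hκ.isInvCocycle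
  let ψ' : invariantFunctions (D.rankSet n) := ⟨fun g => ψ g, restrict_mem h2⟩
  have hψ' : D.extend n ψ'.1 = ψ := extend_restrict h1
  -- The cocycle f' related to the canonical form need not be f. The difference f' - f is related to
  -- an exact form, hence is a coboundary.
  obtain ⟨x', f', rfl, hf'⟩ := exists_left ψ'
  refine ⟨ψ', f', ?_, hf'⟩
  rw [hψ'] at hf'
  have h4 := hf'.sub hκ
  have h5 := (mk_eq_zero_iff (f' - f)).2 (h4.mem_boundaries (by rwa [← neg_sub, neg_mem_iff]))
  rwa [Submodule.Quotient.mk_sub, sub_eq_zero] at h5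

theorem eq_zero {ψ : invariantFunctions (D.rankSet n)} (h : D.Corresponds n 0 ψ) : ψ = 0 := by
  obtain ⟨f, hf0, hf⟩ := h
  have h1 := mem_exact_of_mem_invExact _ (hf.mem_invExact ((mk_eq_zero_iff f).1 hf0))
  have h2 := eq_zero_of_canonical_mem_exact (fun g hg => extend_of_notMem ψ.1 hg) h1
  ext g
  have h3 := congr_fun h2 g
  rwa [extend_apply] at h3

theorem eq_zero' {x : D.cohomology n} (h : D.Corresponds n x 0) : x = 0 := by
  obtain ⟨f, rfl, hf⟩ := h
  refine (mk_eq_zero_iff f).2 (hf.mem_boundaries ?_)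
  rw [ZeroMemClass.coe_zero, map_zero, map_zero]
  exact zero_mem _

theorem map {D' : SymplecticAction.{u, v}} (e : Iso D D') {x : D.cohomology n}
    {ψ : invariantFunctions (D.rankSet n)} (h : D.Corresponds n x ψ)
    {ψ' : invariantFunctions (D'.rankSet n)}
    (hψ : ∀ g : D.rankSet n, ψ'.1 ⟨e.θ g, e.mem_rankSet g.2⟩ = ψ.1 g) :
    D'.Corresponds n (mapHH e.semidirectEquiv n x) ψ' := by
  obtain ⟨f, rfl, hf⟩ := h
  have h1 := Iso.rel_transport e.isHom_regular hf
  rw [e.pull_canonical] at h1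
  have h2 : D.extend n ψ.1 ∘ e.θ.symm = D'.extend n ψ'.1 := by
    funext g
    obtain ⟨g, rfl⟩ := e.θ.surjective g
    rw [Function.comp_apply, MulEquiv.symm_apply_apply]
    by_cases hg : g ∈ D.rankSet n
    · rw [extend_apply ψ.1 ⟨g, hg⟩, extend_apply ψ'.1 ⟨_, e.mem_rankSet hg⟩]
      exact (hψ ⟨g, hg⟩).symm
    · rw [extend_of_notMem _ hg, extend_of_notMem _ fun h => hg ?_]
      simpa [Iso.symm] using e.symm.mem_rankSet h
  rw [h2] at h1
  have h3 := h1.d_eq_zero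
  rw [d_self] at h3
  exact ⟨⟨_, h3⟩, rfl, h1⟩

end Corresponds

theorem exists_equiv (D : SymplecticAction.{u, v}) (n : ℕ) :
    ∃ Φ : D.cohomology n ≃ₗ[ℂ] invariantFunctions (D.rankSet n),
      ∀ x ψ, D.Corresponds n x ψ → Φ x = ψ :=
  exists_linearEquiv_of_rel (D.Corresponds n) (fun c _ _ _ _ h h' => h.smul_add h' c)
    Corresponds.exists_right Corresponds.exists_left (fun _ h => h.eq_zero) fun _ h => h.eq_zero'

/-- The canonical form of g is nonzero in degree rank(1 - g) but zero in every odd degree. -/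
theorem rankSet_eq_empty (D : SymplecticAction.{u, v}) (hn : Odd n) : D.rankSet n = ∅ := by
  refine Set.eq_empty_of_forall_notMem fun g hg => tau_ne_zero g hg.symm ?_
  exact Koszul.powForm_odd hn

theorem symplecticReflections_eq (D : SymplecticAction.{u, v}) :
    D.symplecticReflections = D.rankSet 2 := by
  ext g
  change Module.finrank ℂ (LinearMap.range _) = 2 ↔ Module.finrank ℂ (LinearMap.range _) = 2
  rw [← neg_sub 1 (D.ρ g), LinearMap.range_neg]

end SymplecticAction

end

theorem mainTheorem5 :
    ∃ Φ : ∀ (D : SymplecticAction.{u, v}) (i : ℕ),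
        D.cohomology i ≃ₗ[ℂ] SymplecticAction.invariantFunctions (D.rankSet i),
      (∀ (D D' : SymplecticAction.{u, v}) (e : SymplecticAction.Iso D D') (i : ℕ)
        (x : D.cohomology i) (g : D.rankSet i),
        (Φ D' i (Hochschild.mapHH e.semidirectEquiv i x)).1 ⟨e.θ g, e.mem_rankSet g.2⟩ =
          (Φ D i x).1 g) ∧
      (∀ (D : SymplecticAction.{u, v}) (i : ℕ), Odd i → Subsingleton (D.cohomology i)) ∧
      (∀ D : SymplecticAction.{u, v},
        ∃ Ψ : D.cohomology 2 ≃ₗ[ℂ]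
            SymplecticAction.invariantFunctions D.symplecticReflections,
          ∀ (x : D.cohomology 2) (s : D.symplecticReflections) (g : D.rankSet 2),
            (s : D.G) = g → (Ψ x).1 s = (Φ D 2 x).1 g) := by
  -- Each Φ is pinned down by the choice-free relation `Corresponds`, so naturality reduces to
  -- transporting that relation along isomorphisms.
  choose Φ hΦ using SymplecticAction.exists_equiv.{u, v}
  refine ⟨Φ, fun D D' e i x g => ?_, fun D i hi => ?_, fun D => ?_⟩
  · obtain ⟨ψ, hψ⟩ := SymplecticAction.Corresponds.exists_right x
    let ψ' : SymplecticAction.invariantFunctions (D'.rankSet i) :=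
      ⟨fun g => ψ.1 ⟨e.θ.symm g, e.symm.mem_rankSet g.2⟩, fun s t hst =>
        ψ.2 _ _ (e.θ.symm.toMonoidHom.map_isConj hst)⟩
    have h : ∀ g : D.rankSet i, ψ'.1 ⟨e.θ g, e.mem_rankSet g.2⟩ = ψ.1 g := fun g =>
      congr_arg ψ.1 (Subtype.ext (e.θ.symm_apply_apply _))
    rw [hΦ D i x ψ hψ, hΦ D' i _ ψ' (hψ.map e h), h]
  · have : IsEmpty (D.rankSet i) := Set.isEmpty_coe_sort.2 (D.rankSet_eq_empty hi)
    exact (Φ D i).injective.subsingleton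
  · suffices H : ∀ S : Set D.G, S = D.rankSet 2 →
        ∃ Ψ : D.cohomology 2 ≃ₗ[ℂ] SymplecticAction.invariantFunctions S,
          ∀ (x : D.cohomology 2) (s : S) (g : D.rankSet 2),
            (s : D.G) = g → (Ψ x).1 s = (Φ D 2 x).1 g from
      H _ D.symplecticReflections_eq
    rintro S rfl
    exact ⟨Φ D 2, fun x s g hsg => by rw [Subtype.ext hsg]⟩
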